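/- Let $\mathcal S,\mathcal U,\mathcal X,\mathcal Y$ be finite non-empty alphabets, let $P_S$ be a distribution on $\mathcal S$, let $W(y|x,s)$ be a state-dependent discrete memoryless channel from $\mathcal X\times\mathcal S$ to $\mathcal Y$, and let the state sequence be i.i.d. with law $P_S$. Let $R>0$ and $\varepsilon>0$. All logarithms are natural. **Random code.** For block length $n$, choose for every type $Q_S$ of sequences in $\mathcal S^n$ conditional types $Q_{U|S}$ and $Q_{X|SU}$ (which may depend on $Q_S$), and put $R(Q_S)=I_Q(S;U)+\varepsilon$. There are $M=\lceil e^{nR}\rceil$ messages. For every $Q_S$ and every message $m$, a bin $\mathcal B(Q_S,m)$ of $\lceil e^{nR(Q_S)}\rceil$ codewords is drawn; all codewords are independent and uniform on the type class $\mathcal T(Q_U)$ of the $U$-marginal of $Q_S\times Q_{U|S}$. Given the message $m$ and the state sequence $s$ of type $\hat P_s$, the encoder selects $u$ uniformly among the codewords of $\mathcal B(\hat P_s,m)$ that lie in the conditional type class $\mathcal T(Q_{U|S}|s)$ (if there is none, an error is declared), then draws $x$ uniformly from $\mathcal T(Q_{X|SU}|s,u)$ and transmits it. **Decoder.** For a real-valued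 metric $G$, the decoder outputs a message $\hat m(y)$ that maximizes $\max_{Q_S}\max_{u\in\mathcal B(Q_S,m)}G(\hat P_{uy},Q_S)$ over $m$; ties are resolved by a deterministic rule that depends only on $y$ and on the set of maximizing messages. $P_e(\mathcal C_n)$ denotes the probability that $\hat m\neq m$ for a uniformly distributed message, and $\mathbb E[P_e(\mathcal C_n)]$ its expectation over the random code. Define $$E_r(R)=\min_{Q_S}\max_{Q_{UX|S}}\min_{Q_{Y|SUX}}\Big\{D(Q_S\|P_S)+D(Q_{Y|SUX}\|W|Q_{UX|S}\times Q_S)+[I_Q(U;Y)-I_Q(U;S)-R]_+\Big\},$$ where $[t]_+=\max\{0,t\}$. **Theorem.** There are numbers $L(\varepsilon)$, $\varepsilon>0$, with $\lim_{\varepsilon\downarrow0}L(\varepsilon)=E_r(R)$, such that for every $\varepsilon>0$ the following hold. 1. For all tie-breaking rules, $\lim_{n\to\infty}-\frac1n\ln\mathbb E[P_e(\mathcal C_n)]=L(\varepsilon)$ when, for every $n$, the conditional types and the metric $G$ are optimized so as to minimize $\mathbb E[P_e(\mathcal C_n)]$. In particular, for all choices of the conditional types, of the metrics and of the tie-breaking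 rules (one for each $n$), $\limsup_{n\to\infty}-\frac1n\ln\mathbb E[P_e(\mathcal C_n)]\le L(\varepsilon)$. 2. The universal decoder with the penalized maximum mutual information metric $G(\hat P_{uy},Q_S)=\hat I_{uy}(U;Y)-R(Q_S)$ attains this exponent: there are conditional types (one choice for each $n$) with which, for all tie-breaking rules, $\lim_{n\to\infty}-\frac1n\ln\mathbb E[P_e(\mathcal C_n)]=L(\varepsilon)$. -/

import Mathlib

open Filter Topology

noncomputable section

namespace GelfandPinsker

/-! ### Finite distributions, types and information measures -/

/-- The law of `f a` when `a` has law `Q`. -/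
def push {A B : Type*} [Fintype A] (f : A → B) (Q : A → ℝ) : B → ℝ := by
  classical
  exact fun b => ∑ a with f a = b, Q a

/-- The empirical distribution of a sequence of length `n`. -/
def emp {A : Type*} {n : ℕ} (a : Fin n → A) : A → ℝ := by
  classical
  exact fun x => ((Finset.univ.filter fun i => a i = x).card : ℝ) / n

/-- The types of sequences of length `n` over `A`. -/
def NType (n : ℕ) (A : Type*) : Type _ :=
  {Q : A → ℝ // ∃ a : Fin n → A, emp a = Q}

/-- The type of a sequence. -/
def typeOf {A : Type*} {n : ℕ} (a : Fin n → A) : NType n A := ⟨emp a, a, rfl⟩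

instance {n : ℕ} {A : Type*} [Fintype A] : Finite (NType n A) :=
  Finite.of_surjective (typeOf : (Fin n → A) → NType n A)
    fun ⟨_, a, ha⟩ => ⟨a, Subtype.ext ha⟩

instance {n : ℕ} {A : Type*} [Fintype A] : Fintype (NType n A) := Fintype.ofFinite _

/-- Entropy, in nats. -/
def entropy {A : Type*} [Fintype A] (Q : A → ℝ) : ℝ := ∑ a, Real.negMulLog (Q a)

/-- The mutual information of the two coordinates of a pair with law `Q`. -/
def mutualInfo {A B : Type*} [Fintype A] [Fintype B] (Q : A × B → ℝ) : ℝ :=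
  entropy (push Prod.fst Q) + entropy (push Prod.snd Q) - entropy Q

open Classical in
/-- The Kullback-Leibler divergence `D(Q‖P)`, which is `⊤` unless `Q ≪ P`. -/
def kl {A : Type*} [Fintype A] (Q P : A → ℝ) : EReal :=
  if ∀ a, P a = 0 → Q a = 0 then ((∑ a, Q a * Real.log (Q a / P a) : ℝ) : EReal) else ⊤

open Classical in
/-- The weighted divergence `D(V‖W|Q)` between two channels from `A` to `B`. -/
def condKl {A B : Type*} [Fintype A] [Fintype B] (V W : A → B → ℝ) (Q : A → ℝ) : EReal :=
  if ∀ a b, Q a ≠ 0 → W a b = 0 → V a b = 0 then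
    ((∑ a, Q a * ∑ b, V a b * Real.log (V a b / W a b) : ℝ) : EReal) else ⊤

/-- The channels (conditional distributions) from `A` to `B`. -/
def channels (A B : Type*) [Fintype B] : Set (A → B → ℝ) := {V | ∀ a, V a ∈ stdSimplex ℝ B}

/-- The joint law of an input with law `Q` and the output of the channel `V`. -/
def joint {A B : Type*} (Q : A → ℝ) (V : A → B → ℝ) : A × B → ℝ := fun p => Q p.1 * V p.1 p.2

/-! ### The exponent function -/

/-- The law on `S × U × X` obtained from `Q_S` and `Q_{UX|S}`, followed by `Q_{Y|SUX}`. The value is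
`D(Q_S‖P_S) + D(Q_{Y|SUX}‖W|Q_{SUX}) + [I(U;Y) - I(U;S) - R]_+`. -/
def exponentObjective {S U X Y : Type*} [Fintype S] [Fintype U] [Fintype X] [Fintype Y]
    (PS : S → ℝ) (W : S × X → Y → ℝ) (R : ℝ)
    (QS : S → ℝ) (K : S → U × X → ℝ) (V : S × U × X → Y → ℝ) : EReal :=
  kl QS PS
    + condKl V (fun a => W (a.1, a.2.2)) (joint QS K)
    + ((max 0 (mutualInfo (push (fun p : (S × U × X) × Y => (p.1.2.1, p.2))
                  (joint (joint QS K) V))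
                - mutualInfo (push (fun a : S × U × X => (a.2.1, a.1)) (joint QS K))
                - R) : ℝ) : EReal)

/-- The exponent function `E_r(R)`, for the auxiliary alphabet `U`. -/
def Er {S X Y : Type*} (U : Type*) [Fintype S] [Fintype U] [Fintype X] [Fintype Y]
    (PS : S → ℝ) (W : S × X → Y → ℝ) (R : ℝ) : EReal :=
  ⨅ QS ∈ stdSimplex ℝ S, ⨆ K ∈ channels S (U × X), ⨅ V ∈ channels (S × U × X) Y,
    exponentObjective PS W R QS K V

/-! ### The random code -/

/-- A choice, for every state type `Q_S` of length `n`, of conditional types `Q_{U|S}`, `Q_{X|SU}`.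
They are recorded through the joint type `Q_S × Q_{U|S} × Q_{X|SU}`. -/
structure Design (n : ℕ) (S U X : Type*) [Fintype S] [Fintype U] [Fintype X] where
  toFun : NType n S → NType n (S × U × X)
  marginal : ∀ q, push Prod.fst (toFun q).1 = q.1

section Code

variable {n : ℕ} {S U X Y : Type*} [Fintype S] [Fintype U] [Fintype X] [Fintype Y]

/-- The joint type `Q_{SUX}` which is used for the state type `q`. -/
def Design.Q (d : Design n S U X) (q : NType n S) : S × U × X → ℝ := (d.toFun q).1

/-- The marginal `Q_{SU}`. -/
def Design.QSU (d : Design n S U X) (q : NType n S) : S × U → ℝ :=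
  push (fun a => (a.1, a.2.1)) (d.Q q)

/-- The marginal `Q_U`. -/
def Design.QU (d : Design n S U X) (q : NType n S) : U → ℝ := push (fun a => a.2.1) (d.Q q)

/-- The binning rate `R(Q_S) = I(S;U) + ε`. -/
def Design.binRate (d : Design n S U X) (ε : ℝ) (q : NType n S) : ℝ := mutualInfo (d.QSU q) + ε

/-- The number of messages, `e^{nR}` rounded up. -/
def numMsg (n : ℕ) (R : ℝ) : ℕ := ⌈Real.exp (n * R)⌉₊

/-- The bin size, `e^{n R(Q_S)}` rounded up. -/
def Design.binSize (d : Design n S U X) (ε : ℝ) (q : NType n S) : ℕ :=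
  ⌈Real.exp (n * d.binRate ε q)⌉₊

/-- The type class `T(Q_U)`, from which the codewords for the state type `q` are drawn. -/
abbrev Design.UClass (d : Design n S U X) (q : NType n S) : Type _ :=
  {u : Fin n → U // emp u = d.QU q}

instance (d : Design n S U X) (q : NType n S) : Fintype (d.UClass q) := Fintype.ofFinite _

/-- A codebook: `C q m k` is the `k`-th codeword of the bin of message `m` for the state
type `q`. -/
abbrev Codebook (d : Design n S U X) (R ε : ℝ) : Type _ :=
  (q : NType n S) → Fin (numMsg n R) → Fin (d.binSize ε q) → d.UClass q

instance (d : Design n S U X) (R ε : ℝ) : Fintype (Codebook d R ε) := Fintype.ofFinite _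

/-- The indices, within the bin of message `m` for the type of `s`, of the codewords that lie in the
conditional type class `T(Q_{U|S}|s)`. -/
def encIndices (d : Design n S U X) {R ε : ℝ} (C : Codebook d R ε) (m : Fin (numMsg n R))
    (s : Fin n → S) : Finset (Fin (d.binSize ε (typeOf s))) := by
  classical
  exact Finset.univ.filter fun k =>
    emp (fun i => (s i, (C (typeOf s) m k).1 i)) = d.QSU (typeOf s)

/-- The conditional type class `T(Q_{X|SU}|s,u)`. -/
def xClass (d : Design n S U X) (s : Fin n → S) (u : Fin n → U) : Finset (Fin n → X) := by
  classical
  exact Finset.univ.filter fun x => emp (fun i => (s i, u i, x i)) = d.Q (typeOf s)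

/-! ### The decoder -/

/-- A decoding metric: a functional of the joint type of a codeword and the channel output, and of a
state type. -/
abbrev Metric (n : ℕ) (S U Y : Type*) : Type _ := (U × Y → ℝ) → NType n S → ℝ

/-- The penalized maximum mutual information metric `I(U;Y) - R(Q_S)`. -/
def mmiMetric (d : Design n S U X) (ε : ℝ) : Metric n S U Y :=
  fun Q q => mutualInfo Q - d.binRate ε q

/-- The metric of a codeword, when `y` is received. -/
def score (d : Design n S U X) {R ε : ℝ} (G : Metric n S U Y) (C : Codebook d R ε)
    (y : Fin n → Y) (q : NType n S) (m : Fin (numMsg n R)) (k : Fin (d.binSize ε q)) : ℝ :=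
  G (emp fun i => ((C q m k).1 i, y i)) q

/-- The messages that maximize `max_{Q_S} max_{u ∈ B(Q_S, m)} G(P_{uy}, Q_S)`, i.e. those which own
a codeword whose metric is at least that of all the codewords of all the bins. -/
def argmaxMsg (d : Design n S U X) {R ε : ℝ} (G : Metric n S U Y) (C : Codebook d R ε)
    (y : Fin n → Y) : Finset (Fin (numMsg n R)) := by
  classical
  exact Finset.univ.filter fun m =>
    ∃ q k, ∀ q' m' k', score d G C y q' m' k' ≤ score d G C y q m k

/-- A deterministic rule for choosing one out of several maximizing messages, given the channel
output and the set of the maximizers. -/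
abbrev TieRule (n : ℕ) (R : ℝ) (Y : Type*) : Type _ :=
  {τ : (Fin n → Y) → Finset (Fin (numMsg n R)) → Fin (numMsg n R) //
    ∀ y A, A.Nonempty → τ y A ∈ A}

/-- The decoded message. -/
def decode (d : Design n S U X) {R ε : ℝ} (G : Metric n S U Y) (τ : TieRule n R Y)
    (C : Codebook d R ε) (y : Fin n → Y) : Fin (numMsg n R) :=
  τ.1 y (argmaxMsg d G C y)

/-! ### The error probability -/

open Classical in
/-- The probability of error, for a given codebook, when the channel input is `x`, the state is `s`
and the message is `m`. -/
def errXS (W : S × X → Y → ℝ) (d : Design n S U X) {R ε : ℝ} (G : Metric n S U Y)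
    (τ : TieRule n R Y) (C : Codebook d R ε) (m : Fin (numMsg n R)) (s : Fin n → S)
    (x : Fin n → X) : ℝ :=
  ∑ y : Fin n → Y, (∏ i, W (s i, x i) (y i)) * (if decode d G τ C y ≠ m then 1 else 0)

open Classical in
/-- The probability of error, for a given codebook, when the state is `s` and the message is `m`.
The codeword `u` is uniform among the codewords of the bin that lie in `T(Q_{U|S}|s)`, the channel
input is uniform in `T(Q_{X|SU}|s,u)`, and the absence of such a codeword `u` is an error. -/
def errS (W : S × X → Y → ℝ) (d : Design n S U X) {R ε : ℝ} (G : Metric n S U Y)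
    (τ : TieRule n R Y) (C : Codebook d R ε) (m : Fin (numMsg n R)) (s : Fin n → S) : ℝ :=
  if encIndices d C m s = ∅ then 1 else
    (∑ k ∈ encIndices d C m s,
      (∑ x ∈ xClass d s (C (typeOf s) m k).1, errXS W d G τ C m s x)
        / (xClass d s (C (typeOf s) m k).1).card)
      / (encIndices d C m s).card

/-- The error probability `P_e(C)` of a codebook. -/
def errorProb (PS : S → ℝ) (W : S × X → Y → ℝ) (d : Design n S U X) {R ε : ℝ}
    (G : Metric n S U Y) (τ : TieRule n R Y) (C : Codebook d R ε) : ℝ :=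
  (∑ m : Fin (numMsg n R), ∑ s : Fin n → S, (∏ i, PS (s i)) * errS W d G τ C m s) / numMsg n R

/-- The expectation of `P_e(C)`: all the codewords are independent, and uniform in their type
classes, so that the codebook is uniform in a finite set. -/
def avgErrorProb (PS : S → ℝ) (W : S × X → Y → ℝ) (R ε : ℝ) (d : Design n S U X)
    (G : Metric n S U Y) (τ : TieRule n R Y) : ℝ :=
  (∑ C : Codebook d R ε, errorProb PS W d G τ C) / Fintype.card (Codebook d R ε)

end Code

/-- The smallest average error probability over all choices of the conditional types and of the
decoding metric. -/
def optErrorProb {S X Y : Type*} (U : Type*) [Fintype S] [Fintype U] [Fintype X] [Fintype Y]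
    (PS : S → ℝ) (W : S × X → Y → ℝ) (R ε : ℝ) (n : ℕ) (τ : TieRule n R Y) : ℝ :=
  ⨅ p : Design n S U X × Metric n S U Y, avgErrorProb PS W R ε p.1 p.2 τ

open Classical in
/-- `-(1/n) ln p`, which is `⊤` for `p = 0`. -/
def rate (n : ℕ) (p : ℝ) : EReal := if p ≤ 0 then ⊤ else ((-(1 / n) * Real.log p : ℝ) : EReal)

end GelfandPinsker

end

/-! The exponent is `L ε = Er U PS W (R + ε)`. With bin rate `I(S;U) + ε`, about `e^{n(R + I(S;U) +
ε)}` codewords exist for each state type, so ε acts as an increase of the rate. Since `[·]_+` is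
nondecreasing and 1-Lipschitz, `Er (R + ε) ≤ Er R ≤ Er (R + ε) + ε`, which gives the limit as ε
decreases to 0.

For fixed ε, the method of types reduces everything to joint types `T` of `(s, u, x, y)`. Up to
polynomial factors, state, input and output have joint type `T` with probability `e^{-n(D + D)}`,
and an independent codeword has the same joint type with `y` as the sent one with probability `e^{-n
I(U;Y)}`. The contribution of `T` to the error is thus `e^{-n gpExp T}`.

Lower bound on the error (`exp_neg_gpExp_le`), for every design, metric and tie rule. A metric
cannot separate codewords of equal joint type with `y`, so a random rival scores at least as well as
the sent codeword with probability at least about `e^{-n I(U;Y)}` (`le_poly_mul_tail`). By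
independence, some rival does so with probability at least a constant times `min 1` of the expected
number of such rivals. Two difficulties cost only constants. A tie rule may favour the true message,
but exchanging the bins of two tied messages shows that it wins no more weight than it loses
(`sum_ind_ties_le`). A better codeword of the sent message's own bin may rescue the decoder, but
after resampling the sent codeword the rest of the bin is seldom exceptionally good
(`expect_binAvg_ge`).

Upper bound (`avgErrorProb_mmi_le`): in the union bound for the penalized metric, the penalty
cancels the bin size, so every state type contributes the same `e^{n(R - t)}` at score level `t`
(`union_mmi_le`). Encoding failures are doubly exponentially rare because of ε.

The min-max-min over laws is transferred to types by uniform continuity and by roundings that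
preserve marginals and zeros (`eventually_exists_of_Er_lt`, `eventually_exists_of_lt_Er`). -/

open scoped BigOperators

noncomputable section

namespace GelfandPinsker

/-! ### Types and type classes -/

section Push

variable {A B C : Type*} [Fintype A]

open Classical in
theorem push_apply (f : A → B) (Q : A → ℝ) (b : B) :
    push f Q b = ∑ a, if f a = b then Q a else 0 := by
  simp [push, Finset.sum_filter]

theorem push_push [Fintype B] (f : A → B) (g : B → C) (Q : A → ℝ) :
    push g (push f Q) = push (g ∘ f) Q := by
  classical
  ext c
  simp only [push_apply, Function.comp]
  simp_rw [← Finset.sum_filter (fun b => g b = c)]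
  rw [Finset.sum_comm]
  refine Finset.sum_congr rfl fun a _ => ?_
  rw [Finset.sum_ite_eq]
  simp

theorem sum_push_mul [Fintype B] (f : A → B) (Q : A → ℝ) (w : B → ℝ) :
    ∑ b, push f Q b * w b = ∑ a, Q a * w (f a) := by
  classical
  simp_rw [push_apply, Finset.sum_mul]
  rw [Finset.sum_comm]
  refine Finset.sum_congr rfl fun a _ => ?_
  simp [ite_mul]

theorem sum_push [Fintype B] (f : A → B) (Q : A → ℝ) : ∑ b, push f Q b = ∑ a, Q a := by
  simpa using sum_push_mul f Q fun _ => 1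

theorem push_nonneg {f : A → B} {Q : A → ℝ} (hQ : ∀ a, 0 ≤ Q a) (b : B) : 0 ≤ push f Q b := by
  classical
  exact Finset.sum_nonneg fun a _ => hQ a

theorem le_push {f : A → B} {Q : A → ℝ} (hQ : ∀ a, 0 ≤ Q a) (a : A) : Q a ≤ push f Q (f a) := by
  classical
  rw [push_apply]
  refine le_trans (by simp) (Finset.single_le_sum (f := fun a' => if f a' = f a then Q a' else 0)
    (fun a' _ => ?_) (Finset.mem_univ a))
  split_ifs
  exacts [hQ a', le_rfl]

theorem push_fst_apply [Fintype B] (Q : A × B → ℝ) (a : A) :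
    push Prod.fst Q a = ∑ b, Q (a, b) := by
  classical
  rw [push_apply, Fintype.sum_prod_type, Finset.sum_eq_single a]
  · simp
  · intro b _ hb
    simp [hb]
  · simp

theorem continuous_push (f : A → B) : Continuous (push f : (A → ℝ) → B → ℝ) := by
  classical
  refine continuous_pi fun b => ?_
  unfold push
  fun_prop

end Push

/-! ### Empirical distributions and permutations of sequences. -/

section Emp

variable {A B : Type*} {n : ℕ}

theorem emp_nonneg (a : Fin n → A) (x : A) : 0 ≤ emp a x := by
  unfold emp; positivity

theorem nat_mul_emp [DecidableEq A] (hn : n ≠ 0) (a : Fin n → A) (x : A) :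
    (n : ℝ) * emp a x = (Finset.univ.filter fun i => a i = x).card := by
  unfold emp
  rw [mul_div_cancel₀ _ (by exact_mod_cast hn)]
  congr!

/-- Positions are grouped by letter. Additive functionals, and hence product probabilities, depend
on a sequence only through its type. -/
theorem sum_comp_eq [Fintype A] (hn : n ≠ 0) (a : Fin n → A) (w : A → ℝ) :
    ∑ i, w (a i) = n * ∑ x, emp a x * w x := by
  classical
  rw [Finset.mul_sum, ← Finset.sum_fiberwise (s := Finset.univ) (g := a)]
  refine Finset.sum_congr rfl fun x _ => ?_
  rw [← mul_assoc, nat_mul_emp hn, Finset.sum_congr rfl (g := fun _ => w x)]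
  · simp
  · intro i hi
    rw [(Finset.mem_filter.1 hi).2]

theorem emp_mem_stdSimplex [Fintype A] (hn : n ≠ 0) (a : Fin n → A) :
    emp a ∈ stdSimplex ℝ A := by
  refine ⟨emp_nonneg a, ?_⟩
  have h := sum_comp_eq hn a fun _ => 1
  have hn' : (n : ℝ) ≠ 0 := by exact_mod_cast hn
  simp only [Finset.sum_const, Finset.card_univ, Fintype.card_fin, nsmul_eq_mul, mul_one] at h
  exact (mul_left_cancel₀ hn' ((mul_one _).trans h)).symm

theorem emp_pos {a : Fin n → A} (i : Fin n) : 0 < emp a (a i) := by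
  classical
  have hn : 0 < n := i.pos
  unfold emp
  have : 0 < (Finset.univ.filter fun j => a j = a i).card :=
    Finset.card_pos.2 ⟨i, by simp⟩
  have h : 0 < ((Finset.univ.filter fun j => a j = a i).card : ℝ) := by exact_mod_cast this
  have hn' : (0 : ℝ) < n := by exact_mod_cast hn
  convert div_pos h hn'

theorem exists_of_emp_ne_zero {a : Fin n → A} {x : A} (h : emp a x ≠ 0) : ∃ i, a i = x := by
  classical
  by_contra! hc
  apply h
  unfold emp
  rw [Finset.filter_false_of_mem (by simpa using hc)]
  simp

theorem push_emp [Fintype A] (f : A → B) (a : Fin n → A) :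
    push f (emp a) = emp fun i => f (a i) := by
  classical
  rcases Nat.eq_zero_or_pos n with rfl | hn
  · ext b
    simp [push_apply, emp]
  ext b
  have h1 := sum_comp_eq hn.ne' a fun x => if f x = b then (1 : ℝ) else 0
  have h2 := nat_mul_emp hn.ne' (fun i => f (a i)) b
  have hn' : (n : ℝ) ≠ 0 := by exact_mod_cast hn.ne'
  refine mul_left_cancel₀ hn' ?_
  rw [h2, push_apply]
  simp only [mul_ite, mul_one, mul_zero] at h1
  rw [← h1]
  simp

theorem emp_comp_perm (a : Fin n → A) (σ : Equiv.Perm (Fin n)) :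
    (emp fun i => a (σ i)) = emp a := by
  classical
  ext x
  unfold emp
  congr 2
  exact Finset.card_equiv σ (by simp)

/-- Each letter occupies equally many positions in both sequences; bijections between these fibres
glue to a permutation. -/
theorem exists_perm_of_emp_eq {a b : Fin n → A} (h : emp a = emp b) :
    ∃ σ : Equiv.Perm (Fin n), ∀ i, b i = a (σ i) := by
  classical
  rcases Nat.eq_zero_or_pos n with rfl | hn
  · exact ⟨1, fun i => i.elim0⟩
  have hc (x : A) : Fintype.card {i // b i = x} = Fintype.card {i // a i = x} := by
    have h1 := nat_mul_emp hn.ne' a x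
    have h2 := nat_mul_emp hn.ne' b x
    rw [h, h2] at h1
    rw [Fintype.card_subtype, Fintype.card_subtype]
    exact_mod_cast h1
  let e (x : A) : {i // b i = x} ≃ {i // a i = x} := Fintype.equivOfCardEq (hc x)
  exact ⟨Equiv.ofFiberEquiv e, fun i => (Equiv.ofFiberEquiv_map e i).symm⟩

theorem exists_emp_eq_div [Fintype A] {k : A → ℕ} (hk : ∑ x, k x = n) :
    ∃ a : Fin n → A, emp a = fun x => (k x : ℝ) / n := by
  classical
  have hc : Fintype.card (Fin n) = Fintype.card (Σ x, Fin (k x)) := by simp [hk]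
  let e := Fintype.equivOfCardEq hc
  refine ⟨fun i => (e i).1, funext fun x => ?_⟩
  unfold emp
  congr 2
  have : (Finset.univ.filter fun i => (e i).1 = x).card =
      Fintype.card {p : Σ x, Fin (k x) // p.1 = x} := by
    rw [← Fintype.card_subtype]
    exact Fintype.card_congr (e.subtypeEquiv fun i => Iff.rfl)
  have h2 : Fintype.card {p : Σ x, Fin (k x) // p.1 = x} = k x := by
    rw [Fintype.card_congr (Equiv.sigmaSubtype x)]
    simp
  convert this.trans h2

theorem prod_comp_eq_exp [Fintype A] (hn : n ≠ 0) {a : Fin n → A} {w : A → ℝ}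
    (hw : ∀ i, 0 < w (a i)) :
    ∏ i, w (a i) = Real.exp (n * ∑ x, emp a x * Real.log (w x)) := by
  rw [← sum_comp_eq hn, Real.exp_sum]
  exact Finset.prod_congr rfl fun i _ => (Real.exp_log (hw i)).symm

end Emp

/-- The polynomial factor `(3(n + 1)) ^ k`. -/
def poly (n k : ℕ) : ℝ := (3 * ((n : ℝ) + 1)) ^ k

theorem one_le_poly (n k : ℕ) : 1 ≤ poly n k := by
  refine one_le_pow₀ ?_
  have : (0 : ℝ) ≤ n := n.cast_nonneg
  linarith

theorem poly_pos (n k : ℕ) : 0 < poly n k := one_pos.trans_le (one_le_poly n k)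

theorem poly_add (n k l : ℕ) : poly n (k + l) = poly n k * poly n l := pow_add _ _ _

/-! ### Numbers of types and sizes of type classes. -/

section Card

variable {A : Type*} [Fintype A] {n : ℕ}

/-- The set of sequences with a given empirical distribution. -/
def typeClass (n : ℕ) (Q : A → ℝ) : Finset (Fin n → A) := by
  classical
  exact Finset.univ.filter fun a => emp a = Q

@[simp]
theorem mem_typeClass {Q : A → ℝ} {a : Fin n → A} : a ∈ typeClass n Q ↔ emp a = Q := by
  simp [typeClass]

/-- A type is determined by its letter counts, each of which lies in `{0, …, n}`. -/
theorem card_nType_le (n : ℕ) (A : Type*) [Fintype A] :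
    (Fintype.card (NType n A) : ℝ) ≤ poly n (Fintype.card A) := by
  classical
  let F : NType n A → A → Fin (n + 1) := fun Q x =>
    ⟨(Finset.univ.filter fun i => Q.2.choose i = x).card,
      Nat.lt_succ_of_le ((Finset.card_le_univ _).trans (by simp))⟩
  have hF : Function.Injective F := by
    intro Q Q' h
    apply Subtype.ext
    rw [← Q.2.choose_spec, ← Q'.2.choose_spec]
    ext x
    have := congrArg Fin.val (congrFun h x)
    simp only [F] at this
    unfold emp
    congr 2
  have h := Fintype.card_le_of_injective F hF
  rw [Fintype.card_fun, Fintype.card_fin] at h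
  calc (Fintype.card (NType n A) : ℝ) ≤ ((n + 1 : ℕ) : ℝ) ^ Fintype.card A := by exact_mod_cast h
    _ ≤ poly n (Fintype.card A) := by
      unfold poly
      gcongr
      push_cast
      have : (0 : ℝ) ≤ n := n.cast_nonneg
      linarith

theorem entropy_emp (a : Fin n → A) :
    n * entropy (emp a) = -(n * ∑ x, emp a x * Real.log (emp a x)) := by
  unfold entropy
  simp [Real.negMulLog]

/-- Under the i.i.d. law `emp a`, every sequence of the class has probability `e^{-nH}`, and these
probabilities sum to at most 1. -/
theorem card_typeClass_le (hn : n ≠ 0) (a : Fin n → A) :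
    ((typeClass n (emp a)).card : ℝ) ≤ Real.exp (n * entropy (emp a)) := by
  classical
  have h1 : ∑ b ∈ typeClass n (emp a), ∏ i, emp a (b i) ≤ 1 := by
    calc ∑ b ∈ typeClass n (emp a), ∏ i, emp a (b i)
        ≤ ∑ b : Fin n → A, ∏ i, emp a (b i) :=
          Finset.sum_le_univ_sum_of_nonneg fun b => Finset.prod_nonneg fun i _ => emp_nonneg _ _
      _ = 1 := by
          rw [← Fintype.sum_pow (emp a), (emp_mem_stdSimplex hn a).2, one_pow]
  rw [Finset.sum_congr rfl (g := fun _ => Real.exp (-(n * entropy (emp a))))] at h1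
  · rw [Finset.sum_const, nsmul_eq_mul, Real.exp_neg, ← div_eq_mul_inv,
      div_le_one (Real.exp_pos _)] at h1
    exact h1
  · intro b hb
    rw [mem_typeClass] at hb
    rw [← hb, prod_comp_eq_exp (a := b) (w := emp b) hn fun i => emp_pos i, entropy_emp, neg_neg]

/-- This is `k! ≤ e k (k/e)^k` in logarithmic form; with `Real.log 0 = 0` it also covers `k = 0`.
The induction step rests on `1 ≤ (k + 1) log ((k + 1) / k)`. -/
theorem log_factorial_le (k : ℕ) :
    Real.log (k.factorial : ℝ) ≤ 1 + Real.log k + k * Real.log k - k := by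
  induction k with
  | zero => simp
  | succ k ih =>
    rcases Nat.eq_zero_or_pos k with rfl | hk
    · simp
    have hk' : (0 : ℝ) < k := by exact_mod_cast hk
    have h1 : 1 - (((k : ℝ) + 1) / k)⁻¹ ≤ Real.log (((k : ℝ) + 1) / k) :=
      Real.one_sub_inv_le_log_of_pos (by positivity)
    rw [Real.log_div (by positivity) (by positivity)] at h1
    have h2 : 1 ≤ ((k : ℝ) + 1) * (Real.log ((k : ℝ) + 1) - Real.log k) := by
      calc (1 : ℝ) = ((k : ℝ) + 1) * (1 - (((k : ℝ) + 1) / k)⁻¹) := by field_simp; ring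
        _ ≤ _ := by gcongr
    rw [Nat.factorial_succ]
    push_cast
    rw [Real.log_mul (by positivity) (by positivity)]
    nlinarith

/-- The multinomial formula by orbit and stabilizer: permutations are sorted by the rearrangement of
`a` they produce, and each fibre is a translate of the stabilizer of `a`. -/
theorem card_perm_eq [DecidableEq A] (a : Fin n → A) :
    (n.factorial : ℝ) =
      (typeClass n (emp a)).card *
        ∏ x, ((Finset.univ.filter fun i => a i = x).card.factorial : ℝ) := by
  have h : (Finset.univ : Finset (Equiv.Perm (Fin n))).card =
      ∑ b ∈ typeClass n (emp a),
        (Finset.univ.filter fun σ : Equiv.Perm (Fin n) => a ∘ σ = b).card :=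
    Finset.card_eq_sum_card_fiberwise fun σ _ => by
      simpa using! emp_comp_perm a σ
  have h2 : ∀ b ∈ typeClass n (emp a),
      (Finset.univ.filter fun σ : Equiv.Perm (Fin n) => a ∘ σ = b).card =
        ∏ x, (Finset.univ.filter fun i => a i = x).card.factorial := by
    intro b hb
    rw [mem_typeClass] at hb
    obtain ⟨τ, hτ⟩ := exists_perm_of_emp_eq hb.symm
    have := DomMulAct.stabilizer_card a
    simp only [Fintype.card_subtype] at this
    rw [← this]
    refine Finset.card_equiv (Equiv.mulRight τ⁻¹) fun σ => ?_
    simp only [Finset.mem_filter, Finset.mem_univ, true_and, funext_iff, Function.comp,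
      Equiv.coe_mulRight, Equiv.Perm.mul_apply, hτ]
    constructor
    · intro h i
      simpa using h (τ⁻¹ i)
    · intro h i
      simpa using h (τ i)
  rw [Finset.sum_congr rfl h2] at h
  simp only [Finset.card_univ, Fintype.card_perm, Fintype.card_fin, Finset.sum_const,
    smul_eq_mul] at h
  exact_mod_cast h

/-- The multinomial coefficient is estimated with `n! ≥ (n/e)^n` above and `log_factorial_le` for
each letter count below. -/
theorem le_card_typeClass (hn : n ≠ 0) (a : Fin n → A) :
    Real.exp (n * entropy (emp a)) ≤ poly n (Fintype.card A) * (typeClass n (emp a)).card := by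
  classical
  have hn' : (0 : ℝ) < n := by exact_mod_cast Nat.pos_of_ne_zero hn
  set k : A → ℕ := fun x => (Finset.univ.filter fun i => a i = x).card with hk
  have hkemp : ∀ x, (n : ℝ) * emp a x = k x := fun x => nat_mul_emp hn a x
  have hcard := card_perm_eq a
  have hT : (0 : ℝ) < (typeClass n (emp a)).card := by
    exact_mod_cast Finset.card_pos.2 ⟨a, by simp⟩
  have hprod : 0 < ∏ x, ((k x).factorial : ℝ) := Finset.prod_pos fun x _ => by positivity
  have hsum : ∑ x, (k x : ℝ) = n := by
    simp_rw [← hkemp, ← Finset.mul_sum, (emp_mem_stdSimplex hn a).2, mul_one]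
  have h1 : (n : ℝ) * Real.log n - n ≤ Real.log (n.factorial : ℝ) := by
    have := Real.pow_div_factorial_le_exp (n : ℝ) hn'.le n
    have h2 := Real.log_le_log (by positivity) this
    rw [Real.log_exp, Real.log_div (by positivity) (by positivity), Real.log_pow] at h2
    linarith
  rw [hcard, Real.log_mul hT.ne' hprod.ne', Real.log_prod (fun x _ => by positivity)] at h1
  have h3 : ∑ x, Real.log ((k x).factorial : ℝ) ≤
      Fintype.card A * Real.log (3 * ((n : ℝ) + 1)) + ∑ x, (k x : ℝ) * Real.log (k x) - n := by
    calc ∑ x, Real.log ((k x).factorial : ℝ)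
        ≤ ∑ x, (Real.log (3 * ((n : ℝ) + 1)) + k x * Real.log (k x) - k x) := by
          refine Finset.sum_le_sum fun x _ => ?_
          refine (log_factorial_le _).trans ?_
          have hkn : (k x : ℝ) ≤ n := by
            rw [← hsum]
            exact Finset.single_le_sum (f := fun x => (k x : ℝ)) (fun _ _ => by positivity)
              (Finset.mem_univ x)
          have h5 : Real.log (k x) ≤ Real.log ((n : ℝ) + 1) := by
            rcases Nat.eq_zero_or_pos (k x) with h0 | h0
            · rw [h0]; simp only [Nat.cast_zero, Real.log_zero]
              exact Real.log_nonneg (by linarith)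
            · exact Real.log_le_log (by exact_mod_cast h0) (by linarith)
          -- The 3 in `poly` serves to absorb the additive 1 of `log_factorial_le`.
          have h6 : 1 ≤ Real.log 3 := by
            rw [Real.le_log_iff_exp_le (by norm_num)]
            exact Real.exp_one_lt_three.le
          rw [Real.log_mul (by norm_num) (by positivity)]
          linarith
      _ = _ := by
          rw [Finset.sum_sub_distrib, Finset.sum_add_distrib, hsum]
          simp
  have h4 : n * entropy (emp a) = n * Real.log n - ∑ x, (k x : ℝ) * Real.log (k x) := by
    rw [entropy_emp, Finset.mul_sum, ← hsum, Finset.sum_mul, hsum, ← Finset.sum_sub_distrib,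
      ← Finset.sum_neg_distrib]
    refine Finset.sum_congr rfl fun x _ => ?_
    rw [← mul_assoc, hkemp]
    rcases Nat.eq_zero_or_pos (k x) with h0 | h0
    · simp [h0]
    · have : emp a x = k x / n := by rw [← hkemp]; field_simp
      have hk0 : (0 : ℝ) < k x := by exact_mod_cast h0
      rw [this, Real.log_div hk0.ne' hn'.ne']
      ring
  have hP := poly_pos n (Fintype.card A)
  rw [← Real.le_log_iff_exp_le (by positivity), Real.log_mul hP.ne' hT.ne', h4, poly, Real.log_pow]
  linarith

end Card

/-! ### Sequences of a given type above a given image sequence. -/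

section Fiber

variable {A B : Type*} [Fintype A] {n : ℕ}

/-- The sequences of a given type that are mapped to a given sequence. -/
def fiberClass {n : ℕ} (f : A → B) (T : A → ℝ) (b : Fin n → B) : Finset (Fin n → A) := by
  classical
  exact (typeClass n T).filter fun a => ∀ i, f (a i) = b i

theorem mem_fiberClass {f : A → B} {T : A → ℝ} {b : Fin n → B} {a : Fin n → A} :
    a ∈ fiberClass f T b ↔ emp a = T ∧ ∀ i, f (a i) = b i := by
  simp [fiberClass]

/-- Permuting positions carries the fibre over `b` to the fibre over any sequence of the same type,
so all these fibres have equal size. Sizes of conditional type classes become quotients of sizes of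
type classes. -/
theorem card_fiberClass_mul [Fintype B] {f : A → B} {T : A → ℝ} {b : Fin n → B}
    (h : push f T = emp b) :
    (typeClass n T).card = (typeClass n (emp b)).card * (fiberClass f T b).card := by
  classical
  have h1 : (typeClass n T).card = ∑ b' ∈ typeClass n (emp b), (fiberClass f T b').card := by
    rw [Finset.card_eq_sum_card_fiberwise (f := fun a i => f (a i)) (t := typeClass n (emp b))]
    · refine Finset.sum_congr rfl fun b' _ => ?_
      congr 1
      ext a
      simp [fiberClass, funext_iff]
    · intro a ha
      simp only [Finset.mem_coe, mem_typeClass] at ha ⊢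
      rw [← push_emp, ha, h]
  rw [h1, Finset.sum_const_nat]
  intro b' hb'
  rw [mem_typeClass] at hb'
  obtain ⟨σ, hσ⟩ := exists_perm_of_emp_eq hb'
  refine Finset.card_equiv (Equiv.arrowCongr σ.symm (Equiv.refl A)) fun a => ?_
  have he : (Equiv.arrowCongr σ.symm (Equiv.refl A)) a = fun i => a (σ i) := by
    ext i; simp [Equiv.arrowCongr]
  rw [he, mem_fiberClass, mem_fiberClass, emp_comp_perm]
  refine and_congr_right fun _ => ⟨fun h i => by rw [hσ, h], fun h i => ?_⟩
  have := h (σ.symm i)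
  rw [hσ] at this
  simpa using this

theorem le_card_fiberClass [Fintype B] (hn : n ≠ 0) {f : A → B} {T : A → ℝ} {b : Fin n → B}
    (h : push f T = emp b) (hT : ∃ a : Fin n → A, emp a = T) :
    Real.exp (n * (entropy T - entropy (emp b))) ≤
      poly n (Fintype.card A) * (fiberClass f T b).card := by
  obtain ⟨a, rfl⟩ := hT
  have h1 := le_card_typeClass hn a
  have h2 := card_typeClass_le hn b
  rw [card_fiberClass_mul h] at h1
  rw [mul_sub, Real.exp_sub, div_le_iff₀ (Real.exp_pos _)]
  refine h1.trans ?_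
  push_cast
  have := poly_pos n (Fintype.card A)
  calc poly n (Fintype.card A) * (((typeClass n (emp b)).card : ℝ) * (fiberClass f (emp a) b).card)
      = poly n (Fintype.card A) * (fiberClass f (emp a) b).card * (typeClass n (emp b)).card := by
        ring
    _ ≤ _ := by gcongr

theorem card_fiberClass_le [Fintype B] (hn : n ≠ 0) {f : A → B} {T : A → ℝ} {b : Fin n → B}
    (h : push f T = emp b) (hT : ∃ a : Fin n → A, emp a = T) :
    ((fiberClass f T b).card : ℝ) ≤
      poly n (Fintype.card B) * Real.exp (n * (entropy T - entropy (emp b))) := by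
  obtain ⟨a, rfl⟩ := hT
  have h1 := card_typeClass_le hn a
  have h2 := le_card_typeClass hn b
  rw [card_fiberClass_mul h] at h1
  have h3 : (0 : ℝ) < (typeClass n (emp b)).card := by
    exact_mod_cast Finset.card_pos.2 ⟨b, by simp⟩
  have := poly_pos n (Fintype.card B)
  rw [mul_sub, Real.exp_sub, ← mul_div_assoc, le_div_iff₀ (Real.exp_pos _)]
  push_cast at h1
  calc ((fiberClass f (emp a) b).card : ℝ) * Real.exp (n * entropy (emp b))
      ≤ (fiberClass f (emp a) b).card *
          (poly n (Fintype.card B) * (typeClass n (emp b)).card) := by gcongr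
    _ = poly n (Fintype.card B) * ((typeClass n (emp b)).card * (fiberClass f (emp a) b).card) := by
        ring
    _ ≤ _ := by gcongr

theorem exists_lift_of_emp_eq {f : A → B} {T : A → ℝ} {b : Fin n → B} (h : push f T = emp b)
    (hT : ∃ a : Fin n → A, emp a = T) : (fiberClass f T b).Nonempty := by
  obtain ⟨a, rfl⟩ := hT
  rw [push_emp] at h
  obtain ⟨σ, hσ⟩ := exists_perm_of_emp_eq h
  exact ⟨fun i => a (σ i), mem_fiberClass.2 ⟨emp_comp_perm a σ, fun i => (hσ i).symm⟩⟩

end Fiber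

/-! ### Joint laws and channels -/

section Joint

variable {A B : Type*} [Fintype A] [Fintype B]

theorem push_fst_joint {Q : A → ℝ} {V : A → B → ℝ} (hV : V ∈ channels A B) :
    push Prod.fst (joint Q V) = Q := by
  ext a
  rw [push_fst_apply]
  simp only [joint]
  rw [← Finset.mul_sum, (hV a).2, mul_one]

omit [Fintype A] in
theorem joint_nonneg {Q : A → ℝ} {V : A → B → ℝ} (hQ : ∀ a, 0 ≤ Q a) (hV : V ∈ channels A B)
    (p : A × B) : 0 ≤ joint Q V p :=
  mul_nonneg (hQ _) ((hV _).1 _)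

theorem joint_mem_stdSimplex {Q : A → ℝ} {V : A → B → ℝ} (hQ : Q ∈ stdSimplex ℝ A)
    (hV : V ∈ channels A B) : joint Q V ∈ stdSimplex ℝ (A × B) :=
  ⟨joint_nonneg hQ.1 hV, by rw [← sum_push Prod.fst, push_fst_joint hV, hQ.2]⟩

omit [Fintype A] in
theorem channel_le_one {V : A → B → ℝ} (hV : V ∈ channels A B) (a : A) (b : B) : V a b ≤ 1 := by
  rw [← (hV a).2]
  exact Finset.single_le_sum (fun b _ => (hV a).1 b) (Finset.mem_univ b)

omit [Fintype A] in
theorem abs_joint_sub_joint_le {Q Q' : A → ℝ} {V : A → B → ℝ} {δ : ℝ} (hV : V ∈ channels A B)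
    (h : ∀ a, |Q a - Q' a| ≤ δ) (p : A × B) : |joint Q V p - joint Q' V p| ≤ δ := by
  simp only [joint]
  rw [← sub_mul, abs_mul, abs_of_nonneg ((hV _).1 _)]
  calc |Q p.1 - Q' p.1| * V p.1 p.2 ≤ |Q p.1 - Q' p.1| * 1 := by
        gcongr; exact channel_le_one hV _ _
    _ ≤ δ := by rw [mul_one]; exact h _

omit [Fintype A] in
theorem channels_nonempty [Nonempty B] : (channels A B).Nonempty := by
  classical
  obtain ⟨b⟩ := ‹Nonempty B›
  exact ⟨fun _ => Pi.single b 1, fun _ => single_mem_stdSimplex ℝ b⟩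

/-- Disintegration, with a prescribed channel where the marginal vanishes. -/
theorem exists_joint_eq {Q : A × B → ℝ} (hQ : ∀ p, 0 ≤ Q p) {V₀ : A → B → ℝ}
    (hV₀ : V₀ ∈ channels A B) :
    ∃ V ∈ channels A B, joint (push Prod.fst Q) V = Q ∧
      ∀ a, push Prod.fst Q a = 0 → V a = V₀ a := by
  classical
  refine ⟨fun a => if push Prod.fst Q a = 0 then V₀ a else fun b => Q (a, b) / push Prod.fst Q a,
    fun a => ?_, ?_, fun a ha => if_pos ha⟩
  · dsimp only
    split_ifs with h
    · exact hV₀ a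
    · refine ⟨fun b => div_nonneg (hQ _) (push_nonneg hQ _), ?_⟩
      rw [← Finset.sum_div, ← push_fst_apply, div_self h]
  · ext ⟨a, b⟩
    simp only [joint]
    split_ifs with h
    · have := le_push (f := Prod.fst) hQ (a, b)
      rw [h] at this
      rw [h, zero_mul, le_antisymm this (hQ _)]
    · rw [mul_div_cancel₀ _ h]

end Joint

/-! ### The exponent function in terms of joint laws -/

section Exponent

variable {S U X Y : Type*} [Fintype S] [Fintype U] [Fintype X] [Fintype Y]

/-- The channel from `S × U × X` to `Y` that ignores the auxiliary letter. -/
def liftW (U : Type*) (W : S × X → Y → ℝ) : S × U × X → Y → ℝ := fun a => W (a.1, a.2.2)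

/-- The value of the objective of the exponent function at a joint law of `(S, U, X, Y)`. -/
def gpExp (PS : S → ℝ) (W : S × X → Y → ℝ) (r : ℝ) (T : (S × U × X) × Y → ℝ) : ℝ :=
  (-entropy (push (fun p => p.1.1) T) - ∑ s, push (fun p => p.1.1) T s * Real.log (PS s))
    + (entropy (push Prod.fst T) - entropy T - ∑ p, T p * Real.log (liftW U W p.1 p.2))
    + max 0 (mutualInfo (push (fun p => (p.1.2.1, p.2)) T)
        - mutualInfo (push (fun p => (p.1.2.1, p.1.1)) T) - r)

theorem continuous_entropy {A : Type*} [Fintype A] : Continuous (entropy : (A → ℝ) → ℝ) := by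
  unfold entropy
  fun_prop

theorem continuous_mutualInfo {A B : Type*} [Fintype A] [Fintype B] :
    Continuous (mutualInfo : (A × B → ℝ) → ℝ) :=
  ((continuous_entropy.comp (continuous_push _)).add
    (continuous_entropy.comp (continuous_push _))).sub continuous_entropy

/-- Continuity holds on the whole space because `Real.log 0 = 0` makes the coefficients `log (PS s)`
and `log (liftW U W a y)` finite constants. Absolute continuity is therefore carried as a separate
condition on zeros from here on. -/
theorem continuous_gpExp (PS : S → ℝ) (W : S × X → Y → ℝ) (r : ℝ) :
    Continuous (gpExp PS W r : ((S × U × X) × Y → ℝ) → ℝ) := by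
  have h1 := continuous_entropy.comp
    (continuous_push (fun p : (S × U × X) × Y => p.1.1))
  have h2 : ∀ s, Continuous fun T => push (fun p : (S × U × X) × Y => p.1.1) T s := fun s =>
    (continuous_apply s).comp (continuous_push _)
  have h3 := continuous_entropy.comp (continuous_push (Prod.fst : (S × U × X) × Y → _))
  have h4 := continuous_entropy (A := (S × U × X) × Y)
  have h5 := continuous_mutualInfo.comp
    (continuous_push (fun p : (S × U × X) × Y => (p.1.2.1, p.2)))
  have h6 := continuous_mutualInfo.comp
    (continuous_push (fun p : (S × U × X) × Y => (p.1.2.1, p.1.1)))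
  simp only [Function.comp_def] at h1 h3 h5 h6
  unfold gpExp
  fun_prop

theorem exists_abs_gpExp_sub_lt (PS : S → ℝ) (W : S × X → Y → ℝ) (r : ℝ) {η : ℝ} (hη : 0 < η) :
    ∃ δ > 0, ∀ T ∈ stdSimplex ℝ ((S × U × X) × Y), ∀ T' ∈ stdSimplex ℝ ((S × U × X) × Y),
      (∀ p, |T p - T' p| < δ) → |gpExp PS W r T - gpExp PS W r T'| < η := by
  have h := (isCompact_stdSimplex ℝ ((S × U × X) × Y)).uniformContinuousOn_of_continuous
    (continuous_gpExp PS W r).continuousOn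
  obtain ⟨δ, hδ, h⟩ := Metric.uniformContinuousOn_iff.1 h η hη
  refine ⟨δ, hδ, fun T hT T' hT' hd => h T hT T' hT' ?_⟩
  rw [dist_pi_lt_iff hδ]
  exact hd

theorem kl_eq {A : Type*} [Fintype A] {Q P : A → ℝ} (h : ∀ a, P a = 0 → Q a = 0) :
    kl Q P = ((-entropy Q - ∑ a, Q a * Real.log (P a) : ℝ) : EReal) := by
  rw [kl, if_pos h]
  congr 1
  unfold entropy
  rw [← Finset.sum_neg_distrib, ← Finset.sum_sub_distrib]
  refine Finset.sum_congr rfl fun a _ => ?_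
  by_cases hQ : Q a = 0
  · simp [hQ]
  · rw [Real.log_div hQ (mt (h a) hQ), Real.negMulLog]
    ring

theorem condKl_eq {A B : Type*} [Fintype A] [Fintype B] {V W : A → B → ℝ} {Q : A → ℝ}
    (hV : V ∈ channels A B) (h : ∀ a b, Q a ≠ 0 → W a b = 0 → V a b = 0) :
    condKl V W Q = ((entropy Q - entropy (joint Q V)
      - ∑ p, joint Q V p * Real.log (W p.1 p.2) : ℝ) : EReal) := by
  rw [condKl, if_pos h]
  congr 1
  have h1 : entropy Q = -∑ p, joint Q V p * Real.log (Q p.1) := by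
    rw [← sum_push_mul Prod.fst (joint Q V) fun a => Real.log (Q a), push_fst_joint hV, entropy,
      ← Finset.sum_neg_distrib]
    simp [Real.negMulLog]
  rw [h1]
  unfold entropy
  rw [← Finset.sum_neg_distrib, ← Finset.sum_sub_distrib, ← Finset.sum_sub_distrib,
    Fintype.sum_prod_type]
  simp_rw [Finset.mul_sum]
  refine Finset.sum_congr rfl fun a _ => Finset.sum_congr rfl fun b _ => ?_
  simp only [joint]
  by_cases hQ : Q a = 0
  · simp [hQ]
  by_cases hVab : V a b = 0
  · simp [hVab]
  rw [Real.log_div hVab (mt (h a b hQ) hVab), Real.negMulLog, Real.log_mul hQ hVab]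
  ring

theorem exponentObjective_eq {PS : S → ℝ} {W : S × X → Y → ℝ} (r : ℝ) {QS : S → ℝ}
    {K : S → U × X → ℝ} {V : S × U × X → Y → ℝ} (hK : K ∈ channels S (U × X))
    (hV : V ∈ channels (S × U × X) Y) (hQP : ∀ s, PS s = 0 → QS s = 0)
    (hVW : ∀ a y, joint QS K a ≠ 0 → liftW U W a y = 0 → V a y = 0) :
    exponentObjective PS W r QS K V = (gpExp PS W r (joint (joint QS K) V) : EReal) := by
  have h1 : push (fun p : (S × U × X) × Y => p.1.1) (joint (joint QS K) V) = QS := by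
    calc push (fun p : (S × U × X) × Y => p.1.1) (joint (joint QS K) V)
        = push Prod.fst (push Prod.fst (joint (joint QS K) V)) := by rw [push_push]; rfl
      _ = QS := by rw [push_fst_joint hV, push_fst_joint hK]
  have h2 : push (fun p : (S × U × X) × Y => (p.1.2.1, p.1.1)) (joint (joint QS K) V)
      = push (fun a : S × U × X => (a.2.1, a.1)) (joint QS K) := by
    conv_rhs => rw [← push_fst_joint (Q := joint QS K) hV, push_push]
    rfl
  have hc := condKl_eq (W := fun a : S × U × X => W (a.1, a.2.2)) (Q := joint QS K) hV hVW
  rw [exponentObjective, kl_eq hQP, hc, gpExp, h1, h2, push_fst_joint hV]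
  norm_cast

/-- An objective below a real number has both divergences finite, and this yields the two conditions
on zeros. -/
theorem exists_of_Er_lt [Nonempty U] [Nonempty X] {PS : S → ℝ} {W : S × X → Y → ℝ} {r b : ℝ}
    (h : Er U PS W r < (b : EReal)) :
    ∃ QS ∈ stdSimplex ℝ S, (∀ s, PS s = 0 → QS s = 0) ∧ ∀ K ∈ channels S (U × X),
      ∃ V ∈ channels (S × U × X) Y,
        (∀ a y, joint QS K a ≠ 0 → liftW U W a y = 0 → V a y = 0) ∧
        gpExp PS W r (joint (joint QS K) V) < b := by
  simp only [Er, iInf_lt_iff] at h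
  obtain ⟨QS, hQS, h⟩ := h
  have key : ∀ K ∈ channels S (U × X), ∃ V ∈ channels (S × U × X) Y,
      exponentObjective PS W r QS K V < b := by
    intro K hK
    have := (le_iSup₂ (f := fun K (_ : K ∈ channels S (U × X)) =>
      ⨅ V ∈ channels (S × U × X) Y, exponentObjective PS W r QS K V) K hK).trans_lt h
    simpa only [iInf_lt_iff, exists_prop] using this
  have hkl : ∀ K V, exponentObjective PS W r QS K V < b →
      (∀ s, PS s = 0 → QS s = 0) ∧
      (∀ a y, joint QS K a ≠ 0 → liftW U W a y = 0 → V a y = 0) := by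
    intro K V hb
    unfold exponentObjective kl condKl at hb
    split_ifs at hb with h1 h2
    · exact ⟨h1, h2⟩
    · simp [EReal.add_top_iff_ne_bot.2] at hb
    · simp at hb
    · simp at hb
  -- The condition on `QS` does not involve `K`, but it is read off from a finite objective, so one
  -- channel has to exist.
  obtain ⟨K₀, hK₀⟩ := channels_nonempty (A := S) (B := U × X)
  obtain ⟨V₀, hV₀, h₀⟩ := key K₀ hK₀
  refine ⟨QS, hQS, (hkl _ _ h₀).1, fun K hK => ?_⟩
  obtain ⟨V, hV, hb⟩ := key K hK
  have hs := hkl _ _ hb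
  refine ⟨V, hV, hs.2, ?_⟩
  rw [exponentObjective_eq r hK hV hs.1 hs.2] at hb
  exact_mod_cast hb

theorem exists_of_lt_Er {PS : S → ℝ} {W : S × X → Y → ℝ} {r a : ℝ}
    (h : (a : EReal) < Er U PS W r) {QS : S → ℝ} (hQS : QS ∈ stdSimplex ℝ S)
    (hQP : ∀ s, PS s = 0 → QS s = 0) :
    ∃ K ∈ channels S (U × X), ∀ V ∈ channels (S × U × X) Y,
        (∀ a y, joint QS K a ≠ 0 → liftW U W a y = 0 → V a y = 0) →
        a < gpExp PS W r (joint (joint QS K) V) := by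
  have h1 := h.trans_le (iInf₂_le QS hQS)
  simp only [lt_iSup_iff] at h1
  obtain ⟨K, hK, h1⟩ := h1
  refine ⟨K, hK, fun V hV hVW => ?_⟩
  have h2 := h1.trans_le (iInf₂_le V hV)
  rw [exponentObjective_eq r hK hV hQP hVW] at h2
  exact_mod_cast h2

theorem Er_antitone (PS : S → ℝ) (W : S × X → Y → ℝ) : Antitone (Er U PS W) := by
  intro r r' h
  refine iInf₂_mono fun QS _ => iSup₂_mono fun K _ => iInf₂_mono fun V _ => ?_
  unfold exponentObjective
  gcongr

/-- The positive part is 1-Lipschitz, so raising the rate by ε lowers the objective by at most ε;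
the real shift passes through the infima and the supremum. -/
theorem Er_le_add (PS : S → ℝ) (W : S × X → Y → ℝ) (r : ℝ) {ε : ℝ} (hε : 0 ≤ ε) :
    Er U PS W r ≤ Er U PS W (r + ε) + (ε : EReal) := by
  have key : ∀ (Q : S → ℝ) (K : S → U × X → ℝ) (V : S × U × X → Y → ℝ),
      exponentObjective PS W r Q K V ≤ exponentObjective PS W (r + ε) Q K V + (ε : EReal) := by
    intro Q K V
    unfold exponentObjective
    rw [add_assoc _ _ (ε : EReal), ← EReal.coe_add]
    gcongr
    refine max_le (by positivity) ?_
    rw [← sub_le_iff_le_add]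
    exact le_trans (by linarith) (le_max_right _ _)
  have hsub : ∀ {a b : EReal}, a - (ε : EReal) ≤ b ↔ a ≤ b + (ε : EReal) := fun {a b} =>
    EReal.sub_le_iff_le_add (by simp) (by simp)
  refine hsub.1 (le_iInf₂ fun QS hQS => hsub.2 ((iInf₂_le QS hQS).trans (iSup₂_le fun K hK => ?_)))
  refine le_trans ?_ (add_le_add_left (le_iSup₂ (f := fun K (_ : K ∈ channels S (U × X)) =>
      ⨅ V ∈ channels (S × U × X) Y, exponentObjective PS W (r + ε) QS K V) K hK) (ε : EReal))
  exact hsub.1 (le_iInf₂ fun V hV => hsub.2 ((iInf₂_le V hV).trans (key QS K V)))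

theorem tendsto_Er (PS : S → ℝ) (W : S × X → Y → ℝ) (R : ℝ) :
    Tendsto (fun ε : ℝ => Er U PS W (R + ε)) (𝓝[>] 0) (𝓝 (Er U PS W R)) := by
  have h1 : Tendsto (fun ε : ℝ => Er U PS W R - (ε : EReal)) (𝓝[>] 0) (𝓝 (Er U PS W R)) := by
    have h2 : Tendsto (fun ε : ℝ => Er U PS W R + ((-ε : ℝ) : EReal)) (𝓝 0)
        (𝓝 (Er U PS W R + ((0 : ℝ) : EReal))) := by
      refine (EReal.continuousAt_add (p := (Er U PS W R, ((0 : ℝ) : EReal)))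
        (by simp) (by simp)).tendsto.comp (tendsto_const_nhds.prodMk_nhds ?_)
      have h3 : Tendsto (fun ε : ℝ => -ε) (𝓝 0) (𝓝 0) := by
        simpa using (tendsto_id (α := ℝ) (x := 𝓝 0)).neg
      exact EReal.tendsto_coe.2 h3
    simp only [EReal.coe_zero, add_zero, EReal.coe_neg, ← sub_eq_add_neg] at h2
    exact h2.mono_left nhdsWithin_le_nhds
  refine tendsto_of_tendsto_of_tendsto_of_le_of_le' h1 tendsto_const_nhds ?_ ?_
  · filter_upwards [self_mem_nhdsWithin] with ε hε
    exact (EReal.sub_le_iff_le_add (by simp) (by simp)).2 (Er_le_add PS W R (le_of_lt hε))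
  · filter_upwards [self_mem_nhdsWithin] with ε hε
    exact Er_antitone PS W (by simpa using le_of_lt hε)

end Exponent

/-! ### Approximation of laws by types -/

/-- After rounding everything down, the missing mass is the sum of the fractional parts, at most the
number of non-integral entries. That many of these entries are rounded up instead, so zeros stay
zeros. -/
theorem exists_nat_rounding {B : Type*} [Fintype B] {w : B → ℝ} (hw : ∀ b, 0 ≤ w b) {k : ℕ}
    (hk : ∑ b, w b = k) :
    ∃ m : B → ℕ, ∑ b, m b = k ∧ ∀ b, |(m b : ℝ) - w b| ≤ 1 ∧ (w b = 0 → m b = 0) := by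
  classical
  set F := Finset.univ.filter fun b => Int.fract (w b) ≠ 0 with hF
  have hfl : ∀ b, (⌊w b⌋₊ : ℝ) = w b - Int.fract (w b) := fun b => by
    rw [natCast_floor_eq_intCast_floor (hw b), Int.self_sub_fract]
  have hsum : ∑ b, Int.fract (w b) = k - ((∑ b, ⌊w b⌋₊ : ℕ) : ℝ) := by
    push_cast
    simp_rw [hfl]
    rw [Finset.sum_sub_distrib, hk]
    ring
  have hle : ∑ b, ⌊w b⌋₊ ≤ k := by
    have : (0 : ℝ) ≤ ∑ b, Int.fract (w b) := Finset.sum_nonneg fun b _ => Int.fract_nonneg _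
    rw [hsum, sub_nonneg] at this
    exact_mod_cast this
  have hr : k - ∑ b, ⌊w b⌋₊ ≤ F.card := by
    have h1 : ∑ b, Int.fract (w b) ≤ F.card := by
      rw [← Finset.sum_filter_ne_zero, Finset.card_eq_sum_ones]
      push_cast
      exact Finset.sum_le_sum fun b _ => (Int.fract_lt_one _).le
    rw [hsum, ← Nat.cast_sub hle] at h1
    exact_mod_cast h1
  obtain ⟨s, hs, hcard⟩ := Finset.exists_subset_card_eq hr
  refine ⟨fun b => ⌊w b⌋₊ + if b ∈ s then 1 else 0, ?_, fun b => ⟨?_, fun h0 => ?_⟩⟩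
  · rw [Finset.sum_add_distrib]
    simp only [Finset.sum_ite_mem, Finset.univ_inter, Finset.sum_const, smul_eq_mul, mul_one]
    omega
  · push_cast
    rw [hfl, abs_le]
    have := Int.fract_nonneg (w b)
    have := (Int.fract_lt_one (w b)).le
    split_ifs <;> constructor <;> linarith
  · have hb : b ∉ s := fun hb => by
      have := hs hb
      simp [hF, h0] at this
    simp [h0, hb]

section Rounding

variable {A B : Type*} [Fintype A] [Fintype B] {n : ℕ}

theorem exists_emp_near (hn : n ≠ 0) {Q : A → ℝ} (hQ : Q ∈ stdSimplex ℝ A) :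
    ∃ a : Fin n → A, ∀ x, |emp a x - Q x| ≤ 1 / n ∧ (Q x = 0 → emp a x = 0) := by
  have hn' : (0 : ℝ) < n := by exact_mod_cast Nat.pos_of_ne_zero hn
  obtain ⟨m, hm, h⟩ := exists_nat_rounding (w := fun x => n * Q x) (k := n)
    (fun x => mul_nonneg hn'.le (hQ.1 x)) (by rw [← Finset.mul_sum, hQ.2, mul_one])
  obtain ⟨a, ha⟩ := exists_emp_eq_div hm
  refine ⟨a, fun x => ?_⟩
  rw [ha]
  refine ⟨?_, fun h0 => ?_⟩
  · rw [le_div_iff₀ hn', ← abs_of_pos hn', ← abs_mul, abs_of_pos hn', sub_mul,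
      div_mul_cancel₀ _ hn'.ne', mul_comm (Q x)]
    exact (h x).1
  · simp [(h x).2 (by simp [h0])]

/-- Each row `Q (x, ·)` is rounded separately; its total `n * emp a x` is already an integer, so the
first marginal is kept exactly. -/
theorem exists_emp_near_of_push (hn : n ≠ 0) {Q : A × B → ℝ} (hQ : ∀ p, 0 ≤ Q p)
    {a : Fin n → A} (hQa : push Prod.fst Q = emp a) :
    ∃ t : Fin n → A × B, push Prod.fst (emp t) = emp a ∧
      ∀ p, |emp t p - Q p| ≤ 1 / n ∧ (Q p = 0 → emp t p = 0) := by
  classical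
  have hn' : (0 : ℝ) < n := by exact_mod_cast Nat.pos_of_ne_zero hn
  have key : ∀ x, ∃ m : B → ℕ, ∑ b, m b = (Finset.univ.filter fun i => a i = x).card ∧
      ∀ b, |(m b : ℝ) - n * Q (x, b)| ≤ 1 ∧ (n * Q (x, b) = 0 → m b = 0) := fun x => by
    refine exists_nat_rounding (fun b => mul_nonneg hn'.le (hQ _)) ?_
    rw [← Finset.mul_sum, ← push_fst_apply, hQa, nat_mul_emp hn]
  choose m hm h using key
  have hsum : ∑ p : A × B, m p.1 p.2 = n := by
    rw [Fintype.sum_prod_type]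
    simp only [hm]
    rw [← Finset.card_eq_sum_card_fiberwise fun i _ => Finset.mem_coe.2 (Finset.mem_univ (a i))]
    simp
  obtain ⟨t, ht⟩ := exists_emp_eq_div hsum
  refine ⟨t, ?_, fun p => ?_⟩
  · ext x
    rw [push_fst_apply, ht]
    simp only
    rw [← Finset.sum_div, div_eq_iff hn'.ne', mul_comm, nat_mul_emp hn, ← hm]
    push_cast
    rfl
  · rw [ht]
    refine ⟨?_, fun h0 => ?_⟩
    · rw [le_div_iff₀ hn', ← abs_of_pos hn', ← abs_mul, abs_of_pos hn', sub_mul,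
        div_mul_cancel₀ _ hn'.ne', mul_comm (Q p)]
      exact (h p.1 p.2).1
    · simp [(h p.1 p.2).2 (by simp [h0])]

end Rounding

/-! ### From the exponent over laws to the exponent over types. -/

section Threshold

variable {S U X Y : Type*} [Fintype S] [Fintype U] [Fintype X] [Fintype Y]

/-- A nearly optimal `QS` is rounded to the type of `s`. A design answers with a joint type `a`,
whose conditional law `K` is a legitimate move against the unrounded `QS`; the adverse channel `V`
found there is then rounded on top of `a`. -/
theorem eventually_exists_of_Er_lt [Nonempty U] [Nonempty X] {PS : S → ℝ} {W : S × X → Y → ℝ}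
    {r b : ℝ} (h : Er U PS W r < (b : EReal)) :
    ∀ᶠ n : ℕ in atTop, ∃ s : Fin n → S, (∀ x, PS x = 0 → emp s x = 0) ∧
      ∀ a : Fin n → S × U × X, push Prod.fst (emp a) = emp s →
        ∃ t : Fin n → (S × U × X) × Y, push Prod.fst (emp t) = emp a ∧
          (∀ p, liftW U W p.1 p.2 = 0 → emp t p = 0) ∧ gpExp PS W r (emp t) < b := by
  obtain ⟨b', hb', hb'b⟩ := EReal.lt_iff_exists_real_btwn.1 h
  obtain ⟨QS, hQS, hQP, hK⟩ := exists_of_Er_lt hb'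
  obtain ⟨δ, hδ, hδ'⟩ := exists_abs_gpExp_sub_lt (U := U) PS W r
    (sub_pos.2 (EReal.coe_lt_coe_iff.1 hb'b))
  filter_upwards [eventually_gt_atTop 0,
    (tendsto_const_div_atTop_nhds_zero_nat 2).eventually (gt_mem_nhds hδ)] with n hn hnδ
  obtain ⟨s, hs⟩ := exists_emp_near hn.ne' hQS
  refine ⟨s, fun x hx => (hs x).2 (hQP x hx), fun a ha => ?_⟩
  obtain ⟨K₀, hK₀⟩ := channels_nonempty (A := S) (B := U × X)
  obtain ⟨K, hKc, hKa, -⟩ := exists_joint_eq (emp_nonneg a) hK₀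
  rw [ha] at hKa
  obtain ⟨V, hV, hVW, hVb⟩ := hK K hKc
  -- Zeros of `QS` remain zeros of `emp s`, so `a` charges only letters at which `V` is known to be
  -- dominated by `W`.
  have hsup : ∀ c, emp a c ≠ 0 → joint QS K c ≠ 0 := by
    intro c hc h0
    apply hc
    rw [← hKa]
    rcases mul_eq_zero.1 h0 with h1 | h1
    · simp [joint, (hs c.1).2 h1]
    · simp [joint, h1]
  obtain ⟨t, hta, ht⟩ := exists_emp_near_of_push hn.ne'
    (joint_nonneg (emp_nonneg a) hV) (push_fst_joint (Q := emp a) hV)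
  refine ⟨t, hta, fun p hp => (ht p).2 ?_, ?_⟩
  · by_cases h0 : emp a p.1 = 0
    · simp [joint, h0]
    · simp [joint, hVW _ _ (hsup _ h0) hp]
  · have h1 := hδ' (emp t) (emp_mem_stdSimplex hn.ne' t) (joint (joint QS K) V)
      (joint_mem_stdSimplex (joint_mem_stdSimplex hQS hKc) hV) fun p => by
        have h2 := (ht p).1
        have h3 := abs_joint_sub_joint_le hV (δ := 1 / n) (Q := emp a) (Q' := joint QS K)
          (fun c => by
            rw [← hKa]
            exact abs_joint_sub_joint_le hKc (fun x => (hs x).1) c) p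
        have h4 := abs_sub_le (emp t p) (joint (emp a) V p) (joint (joint QS K) V p)
        -- One rounding error comes from the state law and one from the channel `V`.
        have h5 : (2 : ℝ) / n = 1 / n + 1 / n := by ring
        linarith
    have := (abs_lt.1 h1).2
    linarith

/-- Here `emp s` itself is used as the state law, so only the good channel `K` is rounded. An
arbitrary `t` above `a` is disintegrated and compared with the same channel applied to the unrounded
law. -/
theorem eventually_exists_of_lt_Er {PS : S → ℝ} {W : S × X → Y → ℝ} {r a₀ : ℝ}
    (hW : W ∈ channels (S × X) Y) (h : (a₀ : EReal) < Er U PS W r) :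
    ∀ᶠ n : ℕ in atTop, ∀ s : Fin n → S, (∀ x, PS x = 0 → emp s x = 0) →
      ∃ a : Fin n → S × U × X, push Prod.fst (emp a) = emp s ∧
        ∀ t : Fin n → (S × U × X) × Y, push Prod.fst (emp t) = emp a →
          (∀ p, liftW U W p.1 p.2 = 0 → emp t p = 0) → a₀ < gpExp PS W r (emp t) := by
  obtain ⟨a₁, ha₁, h₁⟩ := EReal.lt_iff_exists_real_btwn.1 h
  obtain ⟨δ, hδ, hδ'⟩ := exists_abs_gpExp_sub_lt (U := U) PS W r
    (sub_pos.2 (EReal.coe_lt_coe_iff.1 ha₁))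
  have hlW : liftW U W ∈ channels (S × U × X) Y := fun a => hW _
  filter_upwards [eventually_gt_atTop 0,
    (tendsto_const_div_atTop_nhds_zero_nat 1).eventually (gt_mem_nhds hδ)] with n hn hnδ s hs
  have hsS := emp_mem_stdSimplex hn.ne' s
  obtain ⟨K, hK, hKV⟩ := exists_of_lt_Er h₁ hsS hs
  obtain ⟨a, has, ha⟩ := exists_emp_near_of_push hn.ne'
    (joint_nonneg (emp_nonneg s) hK) (push_fst_joint (Q := emp s) hK)
  refine ⟨a, has, fun t hta htW => ?_⟩
  -- Rounding may create new zeros in `emp a`; at these letters `V` is set to `W`, which keeps it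
  -- dominated by `W` on the support of the unrounded law.
  obtain ⟨V, hV, hVt, hV₀⟩ := exists_joint_eq (emp_nonneg t) hlW
  rw [hta] at hVt hV₀
  have h1 := hKV V hV fun c y _ hcy => by
    by_cases h0 : emp a c = 0
    · rw [hV₀ c h0, hcy]
    · have h2 := htW (c, y) hcy
      rw [← hVt] at h2
      exact (mul_eq_zero.1 h2).resolve_left h0
  have h2 := hδ' (emp t) (emp_mem_stdSimplex hn.ne' t) (joint (joint (emp s) K) V)
    (joint_mem_stdSimplex (joint_mem_stdSimplex hsS hK) hV) fun p => by
      rw [← hVt]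
      exact (abs_joint_sub_joint_le hV (fun c => (ha c).1) p).trans_lt hnδ
  have := (abs_lt.1 h2).1
  linarith

end Threshold

/-! ### Uniform expectations over finite products -/

open Classical in
/-- The indicator of a proposition. -/
def ind (p : Prop) : ℝ := if p then 1 else 0

theorem ind_of {p : Prop} (h : p) : ind p = 1 := if_pos h

theorem ind_of_not {p : Prop} (h : ¬p) : ind p = 0 := if_neg h

theorem ind_nonneg (p : Prop) : 0 ≤ ind p := by
  unfold ind; split_ifs <;> norm_num

theorem ind_le_one (p : Prop) : ind p ≤ 1 := by
  unfold ind; split_ifs <;> norm_num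

theorem ind_mono {p q : Prop} (h : p → q) : ind p ≤ ind q := by
  by_cases hp : p
  · rw [ind_of hp, ind_of (h hp)]
  · rw [ind_of_not hp]; exact ind_nonneg q

theorem ind_not (p : Prop) : ind (¬p) = 1 - ind p := by
  by_cases hp : p
  · rw [ind_of hp, ind_of_not (not_not.2 hp), sub_self]
  · rw [ind_of_not hp, ind_of hp, sub_zero]

theorem ind_exists_le {ι : Type*} [Fintype ι] (p : ι → Prop) : ind (∃ i, p i) ≤ ∑ i, ind (p i) := by
  by_cases h : ∃ i, p i
  · obtain ⟨i, hi⟩ := h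
    refine le_trans ?_ (Finset.single_le_sum (fun j _ => ind_nonneg (p j)) (Finset.mem_univ i))
    rw [ind_of hi]
    exact ind_le_one _
  · rw [ind_of_not h]
    exact Finset.sum_nonneg fun i _ => ind_nonneg _

theorem expect_ind_eq {Ω : Type*} [Fintype Ω] (s : Finset Ω) :
    𝔼 ω, ind (ω ∈ s) = (s.card : ℝ) / Fintype.card Ω := by
  rw [Fintype.expect_eq_sum_div_card, ← Finset.sum_subset (Finset.subset_univ s)
    fun ω _ h => ind_of_not h, Finset.sum_congr rfl fun ω h => ind_of h]
  simp

theorem expect_mono {Ω : Type*} [Fintype Ω] {f g : Ω → ℝ} (h : ∀ ω, f ω ≤ g ω) :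
    𝔼 ω, f ω ≤ 𝔼 ω, g ω := Finset.expect_le_expect fun ω _ => h ω

theorem expect_nonneg {Ω : Type*} [Fintype Ω] {f : Ω → ℝ} (h : ∀ ω, 0 ≤ f ω) :
    0 ≤ 𝔼 ω, f ω := Finset.expect_nonneg fun ω _ => h ω

section Pi

variable {ι : Type*} [Fintype ι] [DecidableEq ι] {α : ι → Type*} [∀ i, Fintype (α i)]
  [∀ i, Nonempty (α i)]

/-- Resampling one coordinate. -/
theorem expect_update (φ : (∀ i, α i) → ℝ) (i : ι) :
    𝔼 B, φ B = 𝔼 B : ∀ i, α i, 𝔼 u : α i, φ (Function.update B i u) := by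
  have h1 : 𝔼 B, φ B = 𝔼 B : ∀ i, α i, 𝔼 _u : α i, φ B := by
    simp
  -- Exchanging a coordinate with a fresh sample is an involution, hence preserves the uniform law.
  let e : (∀ i, α i) × α i → (∀ i, α i) × α i := fun p => (Function.update p.1 i p.2, p.1 i)
  have he : Function.Involutive e := fun p => by simp [e]
  rw [h1, ← Finset.expect_product' (f := fun B (_ : α i) => φ B),
    ← Finset.expect_product' (f := fun B (u : α i) => φ (Function.update B i u))]
  exact (Fintype.expect_equiv he.toPerm _ _ fun p => rfl).symm

theorem expect_eval (i : ι) (φ : α i → ℝ) : 𝔼 B : ∀ i, α i, φ (B i) = 𝔼 u, φ u := by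
  rw [expect_update _ i]
  simp

omit [∀ i, Nonempty (α i)] in
theorem expect_prod (f : ∀ i, α i → ℝ) :
    𝔼 B : ∀ i, α i, ∏ i, f i (B i) = ∏ i, 𝔼 u, f i u := by
  simp_rw [Fintype.expect_eq_sum_div_card]
  rw [Finset.prod_div_distrib, Fintype.card_pi]
  push_cast
  rw [Finset.prod_univ_sum, Fintype.piFinset_univ]

theorem expect_ind_forall (J : Finset ι) (p : ∀ i, α i → Prop) :
    𝔼 B : ∀ i, α i, ind (∀ i ∈ J, p i (B i)) = ∏ i ∈ J, 𝔼 u, ind (p i u) := by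
  have h1 : ∀ B : ∀ i, α i, ind (∀ i ∈ J, p i (B i)) =
      ∏ i, if i ∈ J then ind (p i (B i)) else 1 := by
    intro B
    rw [Finset.prod_ite_mem, Finset.univ_inter]
    by_cases h : ∀ i ∈ J, p i (B i)
    · rw [ind_of h, Finset.prod_eq_one fun i hi => ind_of (h i hi)]
    · rw [ind_of_not h]
      push Not at h
      obtain ⟨i, hi, hp⟩ := h
      exact (Finset.prod_eq_zero hi (ind_of_not hp)).symm
  simp_rw [h1]
  rw [expect_prod fun i u => if i ∈ J then ind (p i u) else 1]
  rw [← Finset.univ_inter J, ← Finset.prod_ite_mem]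
  refine Finset.prod_congr rfl fun i _ => ?_
  simp only [Finset.univ_inter]
  split_ifs with h
  · rfl
  · exact Fintype.expect_const 1

end Pi

/-! ### Elementary inequalities -/

theorem one_sub_pow_le_exp {x : ℝ} (hx : x ≤ 1) (k : ℕ) : (1 - x) ^ k ≤ Real.exp (-(k * x)) := by
  calc (1 - x) ^ k ≤ Real.exp (-x) ^ k := by
        refine pow_le_pow_left₀ (by linarith) (Real.one_sub_le_exp_neg x) k
    _ = _ := by rw [← Real.exp_nat_mul]; congr 1; ring

/-- A reverse union bound for independent events: with `t = k x`, `1 - (1 - x)^k ≥ 1 - e^{-t} ≥ t /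
(1 + t) ≥ min 1 t / 2`. -/
theorem min_le_one_sub_pow {x : ℝ} (hx0 : 0 ≤ x) (hx : x ≤ 1) (k : ℕ) :
    min 1 (k * x) / 2 ≤ 1 - (1 - x) ^ k := by
  have h1 := one_sub_pow_le_exp hx k
  set t : ℝ := k * x
  have ht : 0 ≤ t := by positivity
  have h2 : Real.exp (-t) ≤ 1 / (1 + t) := by
    rw [Real.exp_neg, ← one_div]
    gcongr
    linarith [Real.add_one_le_exp t]
  have h3 : min 1 t / 2 ≤ 1 - 1 / (1 + t) := by
    have h4 : 1 - 1 / (1 + t) = t / (1 + t) := by field_simp; ring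
    rw [h4, div_le_div_iff₀ two_pos (by linarith)]
    rcases le_total t 1 with h | h
    · rw [min_eq_right h]; nlinarith
    · rw [min_eq_left h]; linarith
  linarith

theorem mul_min_one_le {c x : ℝ} (hc : c ≤ 1) (hc0 : 0 ≤ c) : c * min 1 x ≤ min 1 (c * x) := by
  rw [mul_min_of_nonneg _ _ hc0, mul_one]
  exact min_le_min_right _ hc

/-! ### Breaking of ties -/

/-- Counting every tie as an error at most doubles the error. Exchange the values of `D` at the
chosen maximizer and at another one: the set of maximizers, and with it the output of `τ`, is
unchanged, while the weight of the winner moves to a message that is decoded wrongly. It is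
essential that `τ` sees only the set of maximizers. -/
theorem sum_ind_ties_le {β : Type*} [Fintype β] {N : ℕ} (hN : 0 < N) (g : β → ℝ) {T : β → ℝ}
    (hT : ∀ b, 0 ≤ T b) {τ : Finset (Fin N) → Fin N} (hτ : ∀ A, A.Nonempty → τ A ∈ A)
    {A : (Fin N → β) → Finset (Fin N)} (hA : ∀ D m, m ∈ A D ↔ ∀ m', g (D m') ≤ g (D m)) :
    ∑ D : Fin N → β, ∑ m, T (D m) * ind (∃ m', m' ≠ m ∧ g (D m) ≤ g (D m')) ≤
      2 * ∑ D : Fin N → β, ∑ m, T (D m) * ind (τ (A D) ≠ m) := by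
  classical
  have : Nonempty (Fin N) := ⟨⟨0, hN⟩⟩
  have hAne : ∀ D, τ (A D) ∈ A D := fun D => hτ _ <| by
    obtain ⟨m, hm⟩ := Finite.exists_max fun m => g (D m)
    exact ⟨m, (hA D m).2 hm⟩
  let good : Finset (Fin N) → Prop := fun s => ∃ m ∈ s, m ≠ τ s
  -- The partner depends only on the set of maximizers; this makes the exchange `E` an involution.
  let f : Finset (Fin N) → Fin N := fun s => if h : good s then h.choose else τ s
  have hf : ∀ s, good s → f s ∈ s ∧ f s ≠ τ s := fun s h => by
    simp only [f, dif_pos h]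
    exact h.choose_spec
  set Gd := Finset.univ.filter fun D => good (A D) with hGd
  let E : (Fin N → β) → Fin N → β := fun D m => D (Equiv.swap (τ (A D)) (f (A D)) m)
  have hAE : ∀ D ∈ Gd, A (E D) = A D := by
    intro D hD
    have hg := hf _ (Finset.mem_filter.1 hD).2
    ext m
    rw [hA]
    have h1 : (∀ m', g (E D m') ≤ g (E D m)) ↔ Equiv.swap (τ (A D)) (f (A D)) m ∈ A D := by
      rw [hA]
      constructor
      · intro h m'
        simpa [E] using h (Equiv.swap (τ (A D)) (f (A D)) m')
      · intro h m'
        exact h _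
    rw [h1]
    rcases eq_or_ne m (τ (A D)) with rfl | h2
    · simp [hg.1, hAne]
    rcases eq_or_ne m (f (A D)) with rfl | h3
    · simp [hg.1, hAne]
    rw [Equiv.swap_apply_of_ne_of_ne h2 h3]
  have hEE : ∀ D ∈ Gd, E (E D) = D := by
    intro D hD
    ext m
    simp only [E]
    rw [show A (fun m => D (Equiv.swap (τ (A D)) (f (A D)) m)) = A D from hAE D hD]
    simp
  have hEG : ∀ D ∈ Gd, E D ∈ Gd := fun D hD => by
    simp only [hGd, Finset.mem_filter, Finset.mem_univ, true_and]
    rw [hAE D hD]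
    exact (Finset.mem_filter.1 hD).2
  have key : ∑ D ∈ Gd, T (D (τ (A D))) = ∑ D ∈ Gd, T (D (f (A D))) := by
    refine Finset.sum_nbij' E E hEG hEG hEE hEE fun D hD => ?_
    rw [hAE D hD]
    simp [E]
  have h1 : ∑ D : Fin N → β, ∑ m, T (D m) * ind (τ (A D) = m ∧ ∃ m', m' ≠ m ∧ g (D m) ≤ g (D m'))
      ≤ ∑ D ∈ Gd, T (D (τ (A D))) := by
    rw [hGd, Finset.sum_filter]
    refine Finset.sum_le_sum fun D _ => ?_
    rw [Finset.sum_eq_single (τ (A D))]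
    · split_ifs with hg
      · exact mul_le_of_le_one_right (hT _) (ind_le_one _)
      · rw [ind_of_not, mul_zero]
        rintro ⟨-, m', hm', hle⟩
        exact hg ⟨m', (hA _ _).2 fun m'' => ((hA _ _).1 (hAne D) m'').trans hle, hm'⟩
    · intro m _ hm
      rw [ind_of_not fun h => hm h.1.symm, mul_zero]
    · simp
  have h2 : ∑ D ∈ Gd, T (D (f (A D))) ≤ ∑ D : Fin N → β, ∑ m, T (D m) * ind (τ (A D) ≠ m) := by
    have h3 : ∀ D : Fin N → β, 0 ≤ ∑ m, T (D m) * ind (τ (A D) ≠ m) := fun D =>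
      Finset.sum_nonneg fun m _ => mul_nonneg (hT _) (ind_nonneg _)
    refine le_trans (Finset.sum_le_sum fun D hD => ?_)
      (Finset.sum_le_univ_sum_of_nonneg (s := Gd) h3)
    refine le_trans (le_of_eq ?_) (Finset.single_le_sum
      (fun m _ => mul_nonneg (hT (D m)) (ind_nonneg (τ (A D) ≠ m))) (Finset.mem_univ (f (A D))))
    rw [ind_of (hf _ (Finset.mem_filter.1 hD).2).2.symm, mul_one]
  have h4 : ∑ D : Fin N → β, ∑ m, T (D m) * ind (∃ m', m' ≠ m ∧ g (D m) ≤ g (D m')) ≤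
      ∑ D : Fin N → β, ∑ m, T (D m) * ind (τ (A D) ≠ m) +
      ∑ D : Fin N → β, ∑ m, T (D m) *
        ind (τ (A D) = m ∧ ∃ m', m' ≠ m ∧ g (D m) ≤ g (D m')) := by
    rw [← Finset.sum_add_distrib]
    refine Finset.sum_le_sum fun D _ => ?_
    rw [← Finset.sum_add_distrib]
    refine Finset.sum_le_sum fun m _ => ?_
    rw [← mul_add]
    refine mul_le_mul_of_nonneg_left ?_ (hT _)
    by_cases h : τ (A D) = m
    · rw [ind_of_not (not_not.2 h), zero_add]
      exact ind_mono fun h' => ⟨h, h'⟩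
    · rw [ind_of h]
      linarith [ind_le_one (∃ m', m' ≠ m ∧ g (D m) ≤ g (D m')),
        ind_nonneg (τ (A D) = m ∧ ∃ m', m' ≠ m ∧ g (D m) ≤ g (D m'))]
  linarith

/-! ### Tails of a score -/

section Tail

variable {β : Type*} [Fintype β]

/-- The probability that the score of a uniform element is at least `t`. -/
def tail (g : β → ℝ) (t : ℝ) : ℝ := 𝔼 b, ind (t ≤ g b)

theorem tail_nonneg (g : β → ℝ) (t : ℝ) : 0 ≤ tail g t := expect_nonneg fun _ => ind_nonneg _

theorem tail_le_one [Nonempty β] (g : β → ℝ) (t : ℝ) : tail g t ≤ 1 := by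
  calc tail g t ≤ 𝔼 _b : β, (1 : ℝ) := expect_mono fun _ => ind_le_one _
    _ = 1 := Fintype.expect_const 1

theorem tail_antitone (g : β → ℝ) : Antitone (tail g) := fun _ _ h =>
  expect_mono fun _ => ind_mono fun h' => h.trans h'

/-- The tail at a random score behaves like a p-value: let `b₀` have the least score among the
elements with tail below `c`; all of these score at least `g b₀`, an event of probability `tail g (g
b₀) < c`. -/
theorem expect_ind_tail_lt_le (g : β → ℝ) {c : ℝ} (hc : 0 ≤ c) :
    𝔼 b, ind (tail g (g b) < c) ≤ c := by
  classical
  rcases (Finset.univ.filter fun b => tail g (g b) < c).eq_empty_or_nonempty with h | h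
  · simp only [Finset.filter_eq_empty_iff, Finset.mem_univ, true_imp_iff] at h
    refine le_trans (le_of_eq ?_) hc
    exact Finset.expect_eq_zero fun b _ => ind_of_not (@h b)
  · obtain ⟨b₀, hb₀, hmin⟩ := Finset.exists_min_image _ g h
    refine le_trans (expect_mono fun b => ind_mono fun hb => ?_) (Finset.mem_filter.1 hb₀).2.le
    exact hmin b (by simpa using hb)

/-- Given `D m = b`, the other `N - 1` entries are independent. One factor 1/2 comes from
`min_le_one_sub_pow`, the other from `N - 1 ≥ N / 2`. -/
theorem expect_ties_ge [Nonempty β] {N : ℕ} (hN : 2 ≤ N) (g : β → ℝ) {T : β → ℝ}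
    (hT : ∀ b, 0 ≤ T b) (m : Fin N) :
    (𝔼 b, T b * min 1 (N * tail g (g b))) / 4 ≤
      𝔼 D : Fin N → β, T (D m) * ind (∃ m', m' ≠ m ∧ g (D m) ≤ g (D m')) := by
  classical
  rw [expect_update _ m, Finset.expect_comm, Finset.expect_div]
  refine expect_mono fun b => ?_
  have h1 : ∀ D : Fin N → β, T (Function.update D m b m) *
      ind (∃ m', m' ≠ m ∧ g (Function.update D m b m) ≤ g (Function.update D m b m')) =
      T b * (1 - ind (∀ m' ∈ Finset.univ.erase m, ¬ g b ≤ g (D m'))) := by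
    intro D
    rw [← ind_not, Function.update_self]
    congr 2
    push Not
    refine propext (exists_congr fun m' => ?_)
    simp only [Finset.mem_erase, Finset.mem_univ, and_true]
    refine and_congr_right fun h => ?_
    rw [Function.update_of_ne h]
  simp_rw [h1]
  rw [← Finset.mul_expect, mul_div_assoc]
  refine mul_le_mul_of_nonneg_left ?_ (hT b)
  rw [Finset.expect_sub_distrib, Fintype.expect_const,
    expect_ind_forall (Finset.univ.erase m) fun _ b' => ¬ g b ≤ g b']
  simp_rw [ind_not]
  rw [Finset.expect_sub_distrib, Fintype.expect_const, Finset.prod_const,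
    Finset.card_erase_of_mem (Finset.mem_univ m), Finset.card_univ, Fintype.card_fin]
  refine le_trans ?_ (min_le_one_sub_pow (tail_nonneg g (g b)) (tail_le_one g _) (N - 1))
  have hN' : (2 : ℝ) ≤ N := by exact_mod_cast hN
  have h2 : (1 / 2 : ℝ) * min 1 (N * tail g (g b)) ≤ min 1 ((N - 1 : ℕ) * tail g (g b)) := by
    refine (mul_min_one_le (by norm_num) (by norm_num)).trans (min_le_min_left _ ?_)
    rw [Nat.cast_sub (by omega)]
    have := tail_nonneg g (g b)
    push_cast
    nlinarith
  linarith

end Tail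

/-! ### Bins -/

section Bins

variable {Θ : Type*} [Fintype Θ] {K : Θ → ℕ} {UC : Θ → Type*} [∀ q, Fintype (UC q)]

/-- The largest score of the codewords of a bin. -/
def binScore [Nonempty (Σ q, Fin (K q))] (γ : ∀ q, UC q → ℝ)
    (B : ∀ i : Σ q, Fin (K q), UC i.1) : ℝ :=
  Finset.univ.sup' Finset.univ_nonempty fun i => γ i.1 (B i)

/-- The indices of the codewords of a bin with a given property. -/
def goodIndices {q : Θ} (P : UC q → Prop) (B : ∀ i : Σ q, Fin (K q), UC i.1) :
    Finset (Fin (K q)) := by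
  classical
  exact Finset.univ.filter fun k => P (B ⟨q, k⟩)

omit [Fintype Θ] [∀ q, Fintype (UC q)] in
theorem mem_goodIndices {q : Θ} {P : UC q → Prop} {B : ∀ i : Σ q, Fin (K q), UC i.1}
    {k : Fin (K q)} : k ∈ goodIndices P B ↔ P (B ⟨q, k⟩) := by
  simp [goodIndices]

omit [Fintype Θ] [∀ q, Fintype (UC q)] in
theorem card_goodIndices_eq {q : Θ} (P : UC q → Prop) (B : ∀ i : Σ q, Fin (K q), UC i.1) :
    ((goodIndices P B).card : ℝ) = ∑ k, ind (P (B ⟨q, k⟩)) := by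
  simp [goodIndices, ind]

variable [DecidableEq Θ]

omit [Fintype Θ] [∀ q, Fintype (UC q)] in
theorem card_goodIndices_update_le {q : Θ} (P : UC q → Prop) (B : ∀ i : Σ q, Fin (K q), UC i.1)
    (k : Fin (K q)) (u : UC q) :
    ((goodIndices P (Function.update B ⟨q, k⟩ u)).card : ℝ) ≤ 1 + (goodIndices P B).card := by
  have : goodIndices P (Function.update B ⟨q, k⟩ u) ⊆ insert k (goodIndices P B) := by
    intro k' hk'
    rw [Finset.mem_insert, mem_goodIndices]
    by_cases h : k' = k
    · exact Or.inl h
    · rw [mem_goodIndices, Function.update_of_ne (by simpa using h)] at hk'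
      exact Or.inr hk'
  have h2 := (Finset.card_le_card this).trans (Finset.card_insert_le _ _)
  rw [add_comm]
  exact_mod_cast h2

variable [Nonempty (Σ q, Fin (K q))]

omit [∀ q, Fintype (UC q)] in
theorem binScore_update_le (γ : ∀ q, UC q → ℝ) (B : ∀ i : Σ q, Fin (K q), UC i.1) (q : Θ)
    (k : Fin (K q)) (u : UC q) :
    binScore γ (Function.update B ⟨q, k⟩ u) ≤ max (binScore γ B) (γ q u) := by
  refine Finset.sup'_le _ _ fun i _ => ?_
  by_cases h : i = ⟨q, k⟩
  · subst h
    simp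
  · rw [Function.update_of_ne h]
    exact le_max_of_le_left (Finset.le_sup' (fun i => γ i.1 (B i)) (Finset.mem_univ i))

variable [∀ q, Nonempty (UC q)]

omit [Nonempty (Σ q, Fin (K q))] in
theorem expect_card_goodIndices {q : Θ} (P : UC q → Prop) :
    𝔼 B : ∀ i : Σ q, Fin (K q), UC i.1, ((goodIndices P B).card : ℝ) =
      K q * 𝔼 u, ind (P u) := by
  simp_rw [card_goodIndices_eq]
  rw [Finset.expect_sum_comm]
  have h (k : Fin (K q)) : 𝔼 B : ∀ i : Σ q, Fin (K q), UC i.1, ind (P (B ⟨q, k⟩)) =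
      𝔼 u, ind (P u) :=
    expect_eval (α := fun i : Σ q, Fin (K q) => UC i.1) ⟨q, k⟩ fun u => ind (P u)
  rw [Finset.sum_congr rfl fun k _ => h k]
  simp

omit [Nonempty (Σ q, Fin (K q))] in
theorem expect_ind_forall_bin {q : Θ} (p : UC q → Prop) :
    𝔼 B : ∀ i : Σ q, Fin (K q), UC i.1, ind (∀ k, p (B ⟨q, k⟩)) = (𝔼 u, ind (p u)) ^ K q := by
  -- The property makes sense only in the fibre over `q`, so it is transported along `i.1 = q` to
  -- apply the statement for dependent products.
  have h := expect_ind_forall (α := fun i : Σ q, Fin (K q) => UC i.1)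
    (Finset.univ.map (Function.Embedding.sigmaMk q)) fun i u => ∀ h : i.1 = q, p (h ▸ u)
  rw [Finset.prod_map] at h
  have h1 : ∀ B : ∀ i : Σ q, Fin (K q), UC i.1,
      (∀ i ∈ Finset.univ.map (Function.Embedding.sigmaMk q), ∀ h : i.1 = q, p (h ▸ B i)) ↔
      ∀ k, p (B ⟨q, k⟩) := by
    intro B
    constructor
    · intro h k
      exact h ⟨q, k⟩ (Finset.mem_map_of_mem (Function.Embedding.sigmaMk q) (Finset.mem_univ k)) rfl
    · rintro h ⟨q', k⟩ - h'
      dsimp only at h'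
      subst h'
      exact h k
  simp_rw [h1] at h
  rw [h]
  have h2 : 𝔼 u : UC q, ind (∀ h : q = q, p (h ▸ u)) = 𝔼 u, ind (p u) :=
    Finset.expect_congr rfl fun u _ => congrArg ind (propext ⟨fun h => h rfl, fun h _ => h⟩)
  refine (Finset.prod_congr rfl fun k _ => h2).trans ?_
  simp

omit [Nonempty (Σ q, Fin (K q))] in
theorem expect_ind_goodIndices_empty {q : Θ} (P : UC q → Prop) :
    𝔼 B : ∀ i : Σ q, Fin (K q), UC i.1, ind (goodIndices P B = ∅) ≤
      Real.exp (-(K q * 𝔼 u, ind (P u))) := by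
  have h2 : ∀ B : ∀ i : Σ q, Fin (K q), UC i.1, ind (goodIndices P B = ∅) =
      ind (∀ k, ¬ P (B ⟨q, k⟩)) := by
    intro B
    congr 1
    simp [goodIndices, Finset.filter_eq_empty_iff]
  simp_rw [h2]
  rw [expect_ind_forall_bin fun u => ¬ P u]
  simp_rw [ind_not]
  rw [Finset.expect_sub_distrib, Fintype.expect_const]
  refine one_sub_pow_le_exp ?_ _
  calc 𝔼 u, ind (P u) ≤ 𝔼 _u : UC q, (1 : ℝ) := expect_mono fun _ => ind_le_one _
    _ = 1 := Fintype.expect_const 1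

theorem min_le_tail_binScore (γ : ∀ q, UC q → ℝ) (q : Θ) (t : ℝ) :
    min 1 (K q * tail (γ q) t) / 2 ≤
      tail (binScore γ : (∀ i : Σ q, Fin (K q), UC i.1) → ℝ) t := by
  refine (min_le_one_sub_pow (tail_nonneg _ _) (tail_le_one _ _) _).trans ?_
  have h := expect_ind_forall_bin (K := K) fun u => ¬ t ≤ γ q u
  simp_rw [ind_not] at h
  rw [Finset.expect_sub_distrib, Fintype.expect_const] at h
  unfold tail
  rw [← h, ← Fintype.expect_const (ι := ∀ i : Σ q, Fin (K q), UC i.1) (1 : ℝ),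
    ← Finset.expect_sub_distrib]
  refine expect_mono fun B => ?_
  rw [← ind_not]
  refine ind_mono fun hn => ?_
  push Not at hn
  obtain ⟨k, hk⟩ := hn
  exact hk.trans (Finset.le_sup' (fun i => γ i.1 (B i)) (Finset.mem_univ ⟨q, k⟩))

/-- The average over the codewords with property `P` in a bin of a function `f`. -/
def binAvg {q : Θ} (P : UC q → Prop) (f : UC q → ℝ) (B : ∀ i : Σ q, Fin (K q), UC i.1) : ℝ :=
  (∑ k ∈ goodIndices P B, f (B ⟨q, k⟩)) / (goodIndices P B).card

omit [Fintype Θ] [∀ q, Fintype (UC q)] [DecidableEq Θ] [Nonempty (Σ q, Fin (K q))]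
  [∀ q, Nonempty (UC q)] in
theorem binAvg_eq {q : Θ} (P : UC q → Prop) (f : UC q → ℝ) (B : ∀ i : Σ q, Fin (K q), UC i.1) :
    binAvg P f B = ∑ k, ind (P (B ⟨q, k⟩)) * f (B ⟨q, k⟩) / (goodIndices P B).card := by
  unfold binAvg goodIndices ind
  rw [Finset.sum_div, Finset.sum_filter]
  refine Finset.sum_congr rfl fun k _ => ?_
  split_ifs <;> simp

/-- A Cauchy–Schwarz bound `E[j/x] ≥ (E j)² / E x`, where `j` indicates that the bin is not in its
top quarter, so `E j ≥ 3/4`. It follows from the pointwise `j/x ≥ 2cj - c²x` with `c = (3/4) / E x`.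
-/
theorem expect_inv_card_ge (γ : ∀ q, UC q → ℝ) {q : Θ} (P : UC q → Prop) :
    9 / 16 / (1 + K q * 𝔼 u, ind (P u)) ≤
      𝔼 B : ∀ i : Σ q, Fin (K q), UC i.1,
        ind (1 / 4 ≤ tail (binScore (K := K) γ) (binScore γ B)) / (1 + (goodIndices P B).card) := by
  set Z : ℝ := 1 + K q * 𝔼 u, ind (P u) with hZ
  have hZ0 : 0 < Z := by
    have : 0 ≤ 𝔼 u, ind (P u) := expect_nonneg fun _ => ind_nonneg _
    positivity
  have h1 : 3 / 4 ≤ 𝔼 B : ∀ i : Σ q, Fin (K q), UC i.1,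
      ind (1 / 4 ≤ tail (binScore (K := K) γ) (binScore γ B)) := by
    have h2 := expect_ind_tail_lt_le (binScore γ : (∀ i : Σ q, Fin (K q), UC i.1) → ℝ)
      (c := 1 / 4) (by norm_num)
    simp_rw [← not_le, ind_not] at h2
    rw [Finset.expect_sub_distrib, Fintype.expect_const] at h2
    linarith
  have h3 : 𝔼 B : ∀ i : Σ q, Fin (K q), UC i.1, (1 + ((goodIndices P B).card : ℝ)) = Z := by
    rw [Finset.expect_add_distrib, Fintype.expect_const, expect_card_goodIndices]
  set c : ℝ := 3 / 4 / Z with hc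
  have hc0 : 0 ≤ c := by positivity
  have hcZ : c * Z = 3 / 4 := div_mul_cancel₀ _ hZ0.ne'
  calc 9 / 16 / Z = 2 * c * (3 / 4) - c ^ 2 * Z := by
        rw [hc]; field_simp; norm_num
    _ ≤ 2 * c * (𝔼 B : ∀ i : Σ q, Fin (K q), UC i.1,
          ind (1 / 4 ≤ tail (binScore (K := K) γ) (binScore γ B))) - c ^ 2 *
          𝔼 B : ∀ i : Σ q, Fin (K q), UC i.1, (1 + ((goodIndices P B).card : ℝ)) := by
        rw [h3]; gcongr
    _ = 𝔼 B : ∀ i : Σ q, Fin (K q), UC i.1,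
          (2 * c * ind (1 / 4 ≤ tail (binScore (K := K) γ) (binScore γ B))
            - c ^ 2 * (1 + ((goodIndices P B).card : ℝ))) := by
        rw [Finset.expect_sub_distrib, Finset.mul_expect, Finset.mul_expect]
    _ ≤ _ := by
        refine expect_mono fun B => ?_
        set x : ℝ := 1 + (goodIndices P B).card
        have hx : 0 < x := by positivity
        rw [le_div_iff₀ hx]
        rcases em (1 / 4 ≤ tail (binScore (K := K) γ) (binScore γ B)) with h | h
        · rw [ind_of h]
          nlinarith [sq_nonneg (c * x - 1)]
        · rw [ind_of_not h]
          nlinarith [sq_nonneg (c * x)]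

/-- Passing from a bin to its sent codeword: the codeword at index `k` is replaced by an independent
`u`. The new bin score is at most the larger of the old one and that of `u`; when the old bin is not
in its top quarter, rivals beat the new bin almost as easily as they beat `u` alone. -/
theorem expect_binAvg_ge {N : ℕ} (hN : 1 ≤ N) (γ : ∀ q, UC q → ℝ) {q : Θ} (P : UC q → Prop)
    {f : UC q → ℝ} (hf : ∀ u, 0 ≤ f u) :
    K q / (1 + K q * 𝔼 u, ind (P u)) / 16 *
        𝔼 u, ind (P u) * f u * min 1 (N * K q * tail (γ q) (γ q u)) ≤
      𝔼 B : ∀ i : Σ q, Fin (K q), UC i.1,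
        binAvg P f B * min 1 (N * tail (binScore (K := K) γ) (binScore γ B)) := by
  set F : ℝ → ℝ := tail (binScore γ : (∀ i : Σ q, Fin (K q), UC i.1) → ℝ) with hF
  have hN' : (1 : ℝ) ≤ N := by exact_mod_cast hN
  have hF0 : ∀ t, 0 ≤ F t := tail_nonneg _
  set J : (∀ i : Σ q, Fin (K q), UC i.1) → ℝ := fun B =>
    ind (1 / 4 ≤ F (binScore γ B)) / (1 + (goodIndices P B).card) with hJ
  have hJ0 : ∀ B, 0 ≤ J B := fun B => div_nonneg (ind_nonneg _) (by positivity)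
  have step : ∀ k : Fin (K q), (𝔼 B, J B) *
      ((𝔼 u, ind (P u) * f u * min 1 (N * K q * tail (γ q) (γ q u))) / 8) ≤
      𝔼 B : ∀ i : Σ q, Fin (K q), UC i.1, ind (P (B ⟨q, k⟩)) * f (B ⟨q, k⟩) /
        (goodIndices P B).card * min 1 (N * F (binScore γ B)) := by
    intro k
    refine le_of_le_of_eq ?_
      (expect_update (α := fun i : Σ q, Fin (K q) => UC i.1) _ ⟨q, k⟩).symm
    rw [Finset.expect_mul]
    refine expect_mono fun B => ?_
    rw [Finset.expect_div, Finset.mul_expect]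
    refine expect_mono (Ω := UC q) fun u => ?_
    simp only [Function.update_self]
    by_cases hu : P u
    swap
    · rw [ind_of_not hu]; simp
    rw [ind_of hu, one_mul]
    set B' := Function.update B (⟨q, k⟩ : Σ q, Fin (K q)) u with hB'
    have hcard1 : 0 < ((goodIndices P B').card : ℝ) := by
      have : k ∈ goodIndices P B' := by
        rw [mem_goodIndices, hB', Function.update_self]; exact hu
      exact_mod_cast Finset.card_pos.2 ⟨k, this⟩
    have hcard2 := card_goodIndices_update_le P B k u
    by_cases hq : 1 / 4 ≤ F (binScore γ B)
    swap
    · rw [hJ]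
      simp only
      rw [ind_of_not hq, zero_div, zero_mul]
      have : 0 ≤ min 1 (N * F (binScore γ B')) :=
        le_min zero_le_one (mul_nonneg (Nat.cast_nonneg _) (hF0 _))
      have := hf u
      positivity
    -- The random normalization is replaced by `1 + ` the old count, which does not depend on `u`;
    -- thus the average factorizes.
    have hJB : J B ≤ 1 / (goodIndices P B').card := by
      rw [hJ]
      simp only
      rw [ind_of hq]
      gcongr
    have hmin : min 1 (N * K q * tail (γ q) (γ q u)) / 8 ≤ min 1 (N * F (binScore γ B')) := by
      have ht : min 1 (K q * tail (γ q) (γ q u)) / 8 ≤ F (binScore γ B') := by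
        refine le_trans ?_ (tail_antitone _ (binScore_update_le γ B q k u))
        rw [← hF]
        have h1 := min_le_tail_binScore (K := K) γ q (γ q u)
        have h2 : min 1 (K q * tail (γ q) (γ q u)) ≤ 1 := min_le_left _ _
        have h3 : 0 ≤ min 1 (K q * tail (γ q) (γ q u)) :=
          le_min zero_le_one (mul_nonneg (Nat.cast_nonneg _) (tail_nonneg _ _))
        rcases le_total (binScore γ B) (γ q u) with h | h
        · rw [max_eq_right h]; linarith
        · rw [max_eq_left h]; linarith
      refine le_min ?_ ?_
      · have : min 1 (N * K q * tail (γ q) (γ q u)) ≤ 1 := min_le_left _ _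
        linarith
      · calc min 1 (N * K q * tail (γ q) (γ q u)) / 8
            ≤ N * (min 1 (K q * tail (γ q) (γ q u)) / 8) := by
              rw [← mul_div_assoc, mul_min_of_nonneg _ _ (by positivity : (0 : ℝ) ≤ N), mul_one,
                ← mul_assoc]
              gcongr
          _ ≤ _ := by gcongr
    calc J B * (f u * min 1 (N * K q * tail (γ q) (γ q u)) / 8)
        = J B * f u * (min 1 (N * K q * tail (γ q) (γ q u)) / 8) := by ring
      _ ≤ 1 / (goodIndices P B').card * f u * min 1 (N * F (binScore γ B')) := by
          have h0 : 0 ≤ min 1 (N * K q * tail (γ q) (γ q u)) / 8 := by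
            have : 0 ≤ tail (γ q) (γ q u) := tail_nonneg _ _
            have : 0 ≤ min 1 (N * K q * tail (γ q) (γ q u)) := le_min zero_le_one (by positivity)
            positivity
          have := hf u
          have := hJ0 B
          gcongr
      _ = _ := by ring
  have hsum := Finset.sum_le_sum fun k (_ : k ∈ (Finset.univ : Finset (Fin (K q)))) => step k
  rw [← Finset.expect_sum_comm, Finset.sum_const, Finset.card_univ, Fintype.card_fin,
    nsmul_eq_mul] at hsum
  simp_rw [← Finset.sum_mul, ← binAvg_eq] at hsum
  refine le_trans ?_ hsum
  have hJge := expect_inv_card_ge (K := K) γ P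
  set X : ℝ := 𝔼 u, ind (P u) * f u * min 1 (N * K q * tail (γ q) (γ q u)) with hX
  have hX0 : 0 ≤ X := expect_nonneg fun u => by
    have : 0 ≤ tail (γ q) (γ q u) := tail_nonneg _ _
    have : 0 ≤ min 1 (N * K q * tail (γ q) (γ q u)) := le_min zero_le_one (by positivity)
    have := hf u
    have := ind_nonneg (P u)
    positivity
  set Z : ℝ := 1 + K q * 𝔼 u, ind (P u) with hZ
  have hZ0 : 0 < Z := by
    have : 0 ≤ 𝔼 u, ind (P u) := expect_nonneg fun _ => ind_nonneg _
    positivity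
  -- The constant 1/16 is `1/2 * 1/8`, after weakening 9/16 to 1/2.
  calc K q / Z / 16 * X = K q * (1 / 2 / Z * (X / 8)) := by ring
    _ ≤ K q * (9 / 16 / Z * (X / 8)) := by
        have : 1 / 2 / Z ≤ 9 / 16 / Z := div_le_div_of_nonneg_right (by norm_num) hZ0.le
        gcongr
    _ ≤ K q * ((𝔼 B, J B) * (X / 8)) := by gcongr

end Bins

/-! ### Errors of a decoder which maximizes a score -/

theorem binAvg_nonneg {Θ : Type*} {K : Θ → ℕ} {UC : Θ → Type*} {q : Θ} (P : UC q → Prop)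
    {f : UC q → ℝ} (hf : ∀ u, 0 ≤ f u) (B : ∀ i : Σ q, Fin (K q), UC i.1) : 0 ≤ binAvg P f B :=
  div_nonneg (Finset.sum_nonneg fun _ _ => hf _) (Nat.cast_nonneg _)

/-- The constant 128 is `16 * 4 * 2`: sent codeword versus bin, independent rivals, and breaking of
ties. -/
theorem expect_error_ge {Θ : Type*} [Fintype Θ] [DecidableEq Θ] {K : Θ → ℕ} {UC : Θ → Type*}
    [∀ q, Fintype (UC q)] [Nonempty (Σ q, Fin (K q))] [∀ q, Nonempty (UC q)]
    {N : ℕ} (hN : 2 ≤ N) (γ : ∀ q, UC q → ℝ) {q : Θ} (P : UC q → Prop)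
    {f : UC q → ℝ} (hf : ∀ u, 0 ≤ f u)
    {τ : Finset (Fin N) → Fin N} (hτ : ∀ A, A.Nonempty → τ A ∈ A)
    {A : (Fin N → ∀ i : Σ q, Fin (K q), UC i.1) → Finset (Fin N)}
    (hA : ∀ D m, m ∈ A D ↔ ∀ m', binScore γ (D m') ≤ binScore γ (D m)) :
    K q / (1 + K q * 𝔼 u, ind (P u)) / 128 *
        𝔼 u, ind (P u) * f u * min 1 (N * K q * tail (γ q) (γ q u)) ≤
      𝔼 D : Fin N → ∀ i : Σ q, Fin (K q), UC i.1,
        (∑ m, binAvg P f (D m) * ind (τ (A D) ≠ m)) / N := by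
  have hN0 : (0 : ℝ) < N := by exact_mod_cast (show 0 < N by omega)
  have h1 := sum_ind_ties_le (by omega) (binScore γ)
    (binAvg_nonneg (K := K) P hf) hτ hA
  have h2 := expect_binAvg_ge (K := K) (N := N) (by omega) γ P hf
  have h3 := fun m => expect_ties_ge hN (binScore (K := K) γ) (binAvg_nonneg (K := K) P hf) m
  have h4 := Finset.sum_le_sum fun m (_ : m ∈ (Finset.univ : Finset (Fin N))) => h3 m
  rw [Finset.sum_const, Finset.card_univ, Fintype.card_fin, nsmul_eq_mul,
    ← Finset.expect_sum_comm] at h4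
  rw [← Finset.expect_div, le_div_iff₀ hN0]
  have h5 : 𝔼 D : Fin N → ∀ i : Σ q, Fin (K q), UC i.1, ∑ m, binAvg P f (D m) *
      ind (∃ m', m' ≠ m ∧ binScore γ (D m) ≤ binScore γ (D m')) ≤
      2 * 𝔼 D : Fin N → ∀ i : Σ q, Fin (K q), UC i.1,
        ∑ m, binAvg P f (D m) * ind (τ (A D) ≠ m) := by
    rw [Fintype.expect_eq_sum_div_card, Fintype.expect_eq_sum_div_card, ← mul_div_assoc]
    gcongr
  nlinarith

theorem le_binScore {Θ : Type*} [Fintype Θ] {K : Θ → ℕ} {UC : Θ → Type*}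
    [Nonempty (Σ q, Fin (K q))] (γ : ∀ q, UC q → ℝ) (B : ∀ i : Σ q, Fin (K q), UC i.1)
    (i : Σ q, Fin (K q)) : γ i.1 (B i) ≤ binScore γ B :=
  Finset.le_sup' (fun i => γ i.1 (B i)) (Finset.mem_univ i)

theorem exists_eq_binScore {Θ : Type*} [Fintype Θ] {K : Θ → ℕ} {UC : Θ → Type*}
    [Nonempty (Σ q, Fin (K q))] (γ : ∀ q, UC q → ℝ) (B : ∀ i : Σ q, Fin (K q), UC i.1) :
    ∃ i, binScore γ B = γ i.1 (B i) := by
  obtain ⟨i, -, hi⟩ := Finset.exists_mem_eq_sup' (Finset.univ_nonempty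
    (α := Σ q, Fin (K q))) fun i => γ i.1 (B i)
  exact ⟨i, hi⟩

/-! ### Conditional type classes -/

section CondClass

variable {A B : Type*} [Fintype A] [Fintype B] {n : ℕ}

/-- The sequences `b` such that `(a, b)` has a given type. -/
def rightClass (T : A × B → ℝ) (a : Fin n → A) : Finset (Fin n → B) := by
  classical
  exact Finset.univ.filter fun b => emp (fun i => (a i, b i)) = T

/-- The sequences `a` such that `(a, b)` has a given type. -/
def leftClass (T : A × B → ℝ) (b : Fin n → B) : Finset (Fin n → A) := by
  classical
  exact Finset.univ.filter fun a => emp (fun i => (a i, b i)) = T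

@[simp]
theorem mem_rightClass {T : A × B → ℝ} {a : Fin n → A} {b : Fin n → B} :
    b ∈ rightClass T a ↔ emp (fun i => (a i, b i)) = T := by
  simp [rightClass]

@[simp]
theorem mem_leftClass {T : A × B → ℝ} {a : Fin n → A} {b : Fin n → B} :
    a ∈ leftClass T b ↔ emp (fun i => (a i, b i)) = T := by
  simp [leftClass]

theorem card_rightClass (T : A × B → ℝ) (a : Fin n → A) :
    (rightClass T a).card = (fiberClass Prod.fst T a).card := by
  refine Finset.card_nbij' (fun b i => (a i, b i)) (fun c i => (c i).2) ?_ ?_ ?_ ?_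
  · intro b hb
    simpa [mem_fiberClass] using hb
  · intro c hc
    simp only [Finset.mem_coe, mem_fiberClass, mem_rightClass] at hc ⊢
    rw [← hc.1]
    congr 1
    ext i : 1
    exact Prod.ext (hc.2 i).symm rfl
  · intro b _
    rfl
  · intro c hc
    simp only [Finset.mem_coe, mem_fiberClass] at hc
    ext i : 1
    exact Prod.ext (hc.2 i).symm rfl

theorem card_leftClass (T : A × B → ℝ) (b : Fin n → B) :
    (leftClass T b).card = (fiberClass Prod.snd T b).card := by
  refine Finset.card_nbij' (fun a i => (a i, b i)) (fun c i => (c i).1) ?_ ?_ ?_ ?_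
  · intro b hb
    simpa [mem_fiberClass] using hb
  · intro c hc
    simp only [Finset.mem_coe, mem_fiberClass, mem_leftClass] at hc ⊢
    rw [← hc.1]
    congr 1
    ext i : 1
    exact Prod.ext rfl (hc.2 i).symm
  · intro b _
    rfl
  · intro c hc
    simp only [Finset.mem_coe, mem_fiberClass] at hc
    ext i : 1
    exact Prod.ext rfl (hc.2 i).symm

theorem entropy_push_equiv (e : A ≃ B) (Q : A → ℝ) : entropy (push e Q) = entropy Q := by
  classical
  unfold entropy
  rw [← e.sum_comp]
  refine Finset.sum_congr rfl fun a _ => ?_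
  rw [push_apply]
  simp

theorem entropy_push_swap {C : Type*} [Fintype C] (f : A → B) (g : A → C) (Q : A → ℝ) :
    entropy (push (fun a => (f a, g a)) Q) = entropy (push (fun a => (g a, f a)) Q) := by
  rw [← entropy_push_equiv (Equiv.prodComm B C), push_push]
  rfl

theorem mutualInfo_push {C : Type*} [Fintype C] (f : A → B) (g : A → C) (Q : A → ℝ) :
    mutualInfo (push (fun a => (f a, g a)) Q) =
      entropy (push f Q) + entropy (push g Q) - entropy (push (fun a => (f a, g a)) Q) := by
  rw [mutualInfo, push_push, push_push]
  rfl

theorem mutualInfo_push_comm {C : Type*} [Fintype C] (f : A → B) (g : A → C) (Q : A → ℝ) :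
    mutualInfo (push (fun a => (f a, g a)) Q) = mutualInfo (push (fun a => (g a, f a)) Q) := by
  rw [mutualInfo_push, mutualInfo_push, entropy_push_swap]
  ring

/-- The probability that a uniform element of the type class of `b` is in the conditional type
class of `T` given `a`, up to a polynomial factor. -/
theorem le_card_rightClass_div (hn : n ≠ 0) {T : A × B → ℝ} (hT : ∃ c : Fin n → A × B, emp c = T)
    {a : Fin n → A} (ha : push Prod.fst T = emp a) :
    Real.exp (-(n * mutualInfo T)) ≤
      poly n (Fintype.card (A × B)) *
        ((rightClass T a).card / (typeClass n (push Prod.snd T)).card) := by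
  have h1 := le_card_fiberClass hn ha hT
  obtain ⟨c, rfl⟩ := hT
  have hs := push_emp Prod.snd c
  have h2 := card_typeClass_le hn fun i => (c i).2
  rw [← hs] at h2
  have h3 : (0 : ℝ) < (typeClass n (push Prod.snd (emp c))).card := by
    exact_mod_cast Finset.card_pos.2 ⟨fun i => (c i).2, by simp [hs]⟩
  rw [card_rightClass, ← mul_div_assoc, le_div_iff₀ h3]
  calc Real.exp (-(n * mutualInfo (emp c))) * (typeClass n (push Prod.snd (emp c))).card
      ≤ Real.exp (-(n * mutualInfo (emp c))) * Real.exp (n * entropy (push Prod.snd (emp c))) := by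
        gcongr
    _ = Real.exp (n * (entropy (emp c) - entropy (emp a))) := by
        rw [← Real.exp_add, mutualInfo, ha]
        congr 1
        ring
    _ ≤ _ := h1

theorem le_card_leftClass_div (hn : n ≠ 0) {T : A × B → ℝ} (hT : ∃ c : Fin n → A × B, emp c = T)
    {b : Fin n → B} (hb : push Prod.snd T = emp b) :
    Real.exp (-(n * mutualInfo T)) ≤
      poly n (Fintype.card (A × B)) *
        ((leftClass T b).card / (typeClass n (push Prod.fst T)).card) := by
  have h1 := le_card_fiberClass hn hb hT
  obtain ⟨c, rfl⟩ := hT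
  have hs := push_emp Prod.fst c
  have h2 := card_typeClass_le hn fun i => (c i).1
  rw [← hs] at h2
  have h3 : (0 : ℝ) < (typeClass n (push Prod.fst (emp c))).card := by
    exact_mod_cast Finset.card_pos.2 ⟨fun i => (c i).1, by simp [hs]⟩
  rw [card_leftClass, ← mul_div_assoc, le_div_iff₀ h3]
  calc Real.exp (-(n * mutualInfo (emp c))) * (typeClass n (push Prod.fst (emp c))).card
      ≤ Real.exp (-(n * mutualInfo (emp c))) * Real.exp (n * entropy (push Prod.fst (emp c))) := by
        gcongr
    _ = Real.exp (n * (entropy (emp c) - entropy (emp b))) := by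
        rw [← Real.exp_add, mutualInfo, hb]
        congr 1
        ring
    _ ≤ _ := h1

end CondClass

/-! ### The codebook as a family of bins -/

section Code

variable {n : ℕ} {S U X Y : Type*} [Fintype S] [Fintype U] [Fintype X] [Fintype Y]
  {R ε : ℝ}

/-- The bins of the messages, for all state types together. -/
def binsEquiv (d : Design n S U X) (R ε : ℝ) :
    Codebook d R ε ≃ (Fin (numMsg n R) → ∀ i : Σ q, Fin (d.binSize ε q), d.UClass i.1) where
  toFun C m i := C i.1 m i.2
  invFun D q m k := D m ⟨q, k⟩
  left_inv _ := rfl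
  right_inv _ := rfl

/-- The score of a codeword when `y` is received. -/
def uScore (d : Design n S U X) (G : Metric n S U Y) (y : Fin n → Y) (q : NType n S)
    (u : d.UClass q) : ℝ :=
  G (emp fun i => (u.1 i, y i)) q

theorem Design.exists_emp_eq (d : Design n S U X) (q : NType n S) :
    ∃ a : Fin n → S × U × X, emp a = d.Q q := (d.toFun q).2

instance (d : Design n S U X) (q : NType n S) : Nonempty (d.UClass q) := by
  obtain ⟨a, ha⟩ := d.exists_emp_eq q
  exact ⟨⟨fun i => (a i).2.1, by rw [Design.QU, ← ha, push_emp]⟩⟩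

theorem Design.exp_le_binSize (d : Design n S U X) (ε : ℝ) (q : NType n S) :
    Real.exp (n * d.binRate ε q) ≤ d.binSize ε q := Nat.le_ceil _

theorem exp_le_numMsg (n : ℕ) (R : ℝ) : Real.exp (n * R) ≤ numMsg n R := Nat.le_ceil _

theorem Design.binSize_pos (d : Design n S U X) (ε : ℝ) (q : NType n S) : 0 < d.binSize ε q := by
  have := (Real.exp_pos _).trans_le (d.exp_le_binSize ε q)
  exact_mod_cast this

theorem numMsg_pos (n : ℕ) (R : ℝ) : 0 < numMsg n R := by
  have := (Real.exp_pos _).trans_le (exp_le_numMsg n R)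
  exact_mod_cast this

theorem two_le_numMsg (hn : n ≠ 0) (hR : 0 < R) : 2 ≤ numMsg n R := by
  have hn' : (0 : ℝ) < n := by exact_mod_cast Nat.pos_of_ne_zero hn
  have h1 : (1 : ℝ) < numMsg n R :=
    (Real.one_lt_exp_iff.2 (mul_pos hn' hR)).trans_le (exp_le_numMsg n R)
  exact_mod_cast h1

theorem nonempty_binIndex (d : Design n S U X) (ε : ℝ) (s : Fin n → S) :
    Nonempty (Σ q, Fin (d.binSize ε q)) :=
  ⟨⟨typeOf s, ⟨0, d.binSize_pos ε _⟩⟩⟩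

omit [Fintype Y] in
theorem mem_argmaxMsg_iff (d : Design n S U X) [Nonempty (Σ q, Fin (d.binSize ε q))]
    (G : Metric n S U Y) (C : Codebook d R ε) (y : Fin n → Y) (m : Fin (numMsg n R)) :
    m ∈ argmaxMsg d G C y ↔ ∀ m', binScore (uScore d G y) (binsEquiv d R ε C m') ≤
      binScore (uScore d G y) (binsEquiv d R ε C m) := by
  simp only [argmaxMsg, Finset.mem_filter, Finset.mem_univ, true_and]
  constructor
  · rintro ⟨q, k, h⟩ m'
    obtain ⟨i, hi⟩ := exists_eq_binScore (uScore d G y) (binsEquiv d R ε C m')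
    rw [hi]
    exact (h i.1 m' i.2).trans (le_binScore (uScore d G y) (binsEquiv d R ε C m) ⟨q, k⟩)
  · intro h
    obtain ⟨i, hi⟩ := exists_eq_binScore (uScore d G y) (binsEquiv d R ε C m)
    refine ⟨i.1, i.2, fun q' m' k' => ?_⟩
    exact (le_binScore (uScore d G y) (binsEquiv d R ε C m') ⟨q', k'⟩).trans ((h m').trans hi.le)

/-- A codeword is jointly typical with the state sequence. -/
def UGood (d : Design n S U X) (s : Fin n → S) (u : d.UClass (typeOf s)) : Prop :=
  emp (fun i => (s i, u.1 i)) = d.QSU (typeOf s)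

/-- The probability of the output `y` when the codeword is `u` and the state sequence is `s`. -/
def outProb (W : S × X → Y → ℝ) (d : Design n S U X) (s : Fin n → S) (y : Fin n → Y)
    (u : d.UClass (typeOf s)) : ℝ :=
  (∑ x ∈ xClass d s u.1, ∏ i, W (s i, x i) (y i)) / (xClass d s u.1).card

theorem outProb_nonneg {W : S × X → Y → ℝ} (hW : W ∈ channels (S × X) Y) (d : Design n S U X)
    (s : Fin n → S) (y : Fin n → Y) (u : d.UClass (typeOf s)) : 0 ≤ outProb W d s y u :=
  div_nonneg (Finset.sum_nonneg fun _ _ => Finset.prod_nonneg fun _ _ => (hW _).1 _)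
    (Nat.cast_nonneg _)

/-- Division by zero gives 0, so `binAvg` vanishes when no codeword is typical, and the encoding and
decoding errors simply add up. -/
theorem errS_eq (W : S × X → Y → ℝ) (d : Design n S U X) (G : Metric n S U Y)
    (τ : TieRule n R Y) (C : Codebook d R ε) (m : Fin (numMsg n R)) (s : Fin n → S) :
    errS W d G τ C m s =
      ind (goodIndices (UGood d s) (binsEquiv d R ε C m) = ∅) +
        ∑ y, binAvg (UGood d s) (outProb W d s y) (binsEquiv d R ε C m) *
          ind (decode d G τ C y ≠ m) := by
  have h1 : encIndices d C m s = goodIndices (UGood d s) (binsEquiv d R ε C m) := by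
    unfold encIndices goodIndices
    congr!
  unfold errS
  rw [h1]
  split_ifs with h
  · rw [ind_of h]
    simp [binAvg, h]
  · rw [ind_of_not h, zero_add]
    unfold binAvg
    simp_rw [div_mul_eq_mul_div]
    rw [← Finset.sum_div]
    congr 1
    simp_rw [Finset.sum_mul]
    rw [Finset.sum_comm]
    refine Finset.sum_congr rfl fun k _ => ?_
    unfold outProb errXS
    rw [Finset.sum_comm, Finset.sum_div]
    refine Finset.sum_congr rfl fun y _ => ?_
    rw [← Finset.sum_mul, div_mul_eq_mul_div]
    unfold ind
    congr!

theorem avgErrorProb_eq (PS : S → ℝ) (W : S × X → Y → ℝ) (R ε : ℝ) (d : Design n S U X)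
    (G : Metric n S U Y) (τ : TieRule n R Y) :
    avgErrorProb PS W R ε d G τ = ∑ s : Fin n → S, (∏ i, PS (s i)) *
      𝔼 C : Codebook d R ε, (∑ m, errS W d G τ C m s) / numMsg n R := by
  unfold avgErrorProb errorProb
  rw [← Fintype.expect_eq_sum_div_card]
  simp_rw [Finset.mul_expect]
  rw [← Finset.expect_sum_comm]
  refine Finset.expect_congr rfl fun C _ => ?_
  rw [Finset.sum_comm, Finset.sum_div]
  refine Finset.sum_congr rfl fun s _ => ?_
  rw [← Finset.mul_sum, mul_div_assoc]

theorem expect_UClass (d : Design n S U X) (q : NType n S) (s : Finset (Fin n → U))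
    (hs : ∀ u ∈ s, emp u = d.QU q) :
    𝔼 u : d.UClass q, ind (u.1 ∈ s) = (s.card : ℝ) / (typeClass n (d.QU q)).card := by
  classical
  have h := expect_ind_eq (Ω := d.UClass q) (Finset.univ.filter fun u => u.1 ∈ s)
  simp only [Finset.mem_filter, Finset.mem_univ, true_and] at h
  rw [h]
  congr 2
  · rw [← Finset.card_map (Function.Embedding.subtype _)]
    congr 1
    ext u
    simp only [Finset.mem_map, Finset.mem_filter, Finset.mem_univ, true_and,
      Function.Embedding.subtype_apply]
    constructor
    · rintro ⟨v, hv, rfl⟩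
      exact hv
    · intro hu
      exact ⟨⟨u, hs u hu⟩, hu, rfl⟩
  · rw [← Finset.card_univ, ← Finset.card_map (Function.Embedding.subtype _)]
    congr 1
    ext u
    simp only [Finset.mem_map, Finset.mem_univ, true_and,
      Function.Embedding.subtype_apply, mem_typeClass]
    constructor
    · rintro ⟨v, rfl⟩
      exact v.2
    · intro hu
      exact ⟨⟨u, hu⟩, rfl⟩

theorem push_fst_QSU (d : Design n S U X) (s : Fin n → S) :
    push Prod.fst (d.QSU (typeOf s)) = emp s := by
  rw [Design.QSU, push_push]
  exact d.marginal (typeOf s)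

theorem push_snd_QSU (d : Design n S U X) (q : NType n S) :
    push Prod.snd (d.QSU q) = d.QU q := by
  rw [Design.QSU, push_push]
  rfl

theorem exists_emp_eq_QSU (d : Design n S U X) (q : NType n S) :
    ∃ c : Fin n → S × U, emp c = d.QSU q := by
  obtain ⟨a, ha⟩ := d.exists_emp_eq q
  exact ⟨fun i => ((a i).1, (a i).2.1), by rw [Design.QSU, ← ha, push_emp]⟩

theorem UGood_iff {d : Design n S U X} {s : Fin n → S} {u : d.UClass (typeOf s)} :
    UGood d s u ↔ u.1 ∈ rightClass (d.QSU (typeOf s)) s := by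
  rw [mem_rightClass, UGood]

/-- A codeword is jointly typical with the state sequence with probability `e^{-n I(S;U)}`, up to a
polynomial factor. -/
theorem exp_neg_mutualInfo_QSU_le (hn : n ≠ 0) (d : Design n S U X) (s : Fin n → S) :
    Real.exp (-(n * mutualInfo (d.QSU (typeOf s)))) ≤
      poly n (Fintype.card (S × U)) * 𝔼 u, ind (UGood d s u) := by
  have h1 := le_card_rightClass_div hn (exists_emp_eq_QSU d (typeOf s)) (push_fst_QSU d s)
  have h2 : 𝔼 u, ind (UGood d s u) =
      ((rightClass (d.QSU (typeOf s)) s).card : ℝ) / (typeClass n (d.QU (typeOf s))).card := by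
    simp_rw [UGood_iff]
    refine expect_UClass d _ _ fun u hu => ?_
    rw [mem_rightClass] at hu
    rw [← push_snd_QSU, ← hu, push_emp]
  rwa [push_snd_QSU, ← h2] at h1

/-- The bins contain enough codewords to cover the conditional type class. -/
theorem le_binSize_mul_expect (hn : n ≠ 0) (d : Design n S U X) (ε : ℝ) (s : Fin n → S) :
    Real.exp (n * ε) ≤ poly n (Fintype.card (S × U)) *
      (d.binSize ε (typeOf s) * 𝔼 u, ind (UGood d s u)) := by
  have h1 := exp_neg_mutualInfo_QSU_le hn d s
  have h3 := d.exp_le_binSize ε (typeOf s)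
  calc Real.exp (n * ε)
      = Real.exp (n * d.binRate ε (typeOf s)) *
          Real.exp (-(n * mutualInfo (d.QSU (typeOf s)))) := by
        rw [← Real.exp_add, Design.binRate]; congr 1; ring
    _ ≤ d.binSize ε (typeOf s) * (poly n (Fintype.card (S × U)) * 𝔼 u, ind (UGood d s u)) := by
        gcongr
    _ = _ := by ring

theorem mem_xClass {d : Design n S U X} {s : Fin n → S} {u : Fin n → U} {x : Fin n → X} :
    x ∈ xClass d s u ↔ emp (fun i => (s i, u i, x i)) = d.Q (typeOf s) := by
  simp [xClass]

theorem xClass_nonempty {d : Design n S U X} {s : Fin n → S} {u : d.UClass (typeOf s)}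
    (hu : UGood d s u) : (xClass d s u.1).Nonempty := by
  obtain ⟨a, ha⟩ := exists_lift_of_emp_eq (f := fun a : S × U × X => (a.1, a.2.1))
    (T := d.Q (typeOf s)) (b := fun i => (s i, u.1 i)) hu.symm (d.exists_emp_eq _)
  rw [mem_fiberClass] at ha
  refine ⟨fun i => (a i).2.2, mem_xClass.2 ?_⟩
  rw [← ha.1]
  congr 1
  funext i
  have := ha.2 i
  rw [Prod.mk.injEq] at this
  exact Prod.ext this.1.symm (Prod.ext this.2.symm rfl)

end Code

/-! ### The lower bound on the average error probability -/

section Lower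

variable {n : ℕ} {S U X Y : Type*} [Fintype S] [Fintype U] [Fintype X] [Fintype Y]
  {R ε : ℝ}

theorem prod_channel_eq_exp (hn : n ≠ 0) {W : S × X → Y → ℝ} (hW : W ∈ channels (S × X) Y)
    {t : Fin n → (S × U × X) × Y} (htW : ∀ p, liftW U W p.1 p.2 = 0 → emp t p = 0) :
    ∏ i, liftW U W (t i).1 (t i).2 =
      Real.exp (n * ∑ p, emp t p * Real.log (liftW U W p.1 p.2)) := by
  refine prod_comp_eq_exp (w := fun p : (S × U × X) × Y => liftW U W p.1 p.2) hn fun i => ?_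
  refine lt_of_le_of_ne ((hW _).1 _) fun h => ?_
  exact (emp_pos (a := t) i).ne' (htW _ h.symm)

/-- The only property of the metric that enters the lower bound: a codeword with the same joint type
with `y` receives the same score, so the tail is at least the probability of that joint type. -/
theorem le_poly_mul_tail (hn : n ≠ 0) (d : Design n S U X) (G : Metric n S U Y) (y : Fin n → Y)
    (q : NType n S) (u : d.UClass q) :
    Real.exp (-(n * mutualInfo (emp fun i => (u.1 i, y i)))) ≤
      poly n (Fintype.card (U × Y)) * tail (uScore d G y q) (uScore d G y q u) := by
  set T := emp fun i => (u.1 i, y i) with hT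
  have h1 := le_card_leftClass_div hn ⟨_, hT.symm⟩
    (show push Prod.snd T = emp y by rw [hT, push_emp])
  have h2 : push Prod.fst T = d.QU q := by rw [hT, push_emp]; exact u.2
  rw [h2, ← expect_UClass d q (leftClass T y)] at h1
  · refine h1.trans (mul_le_mul_of_nonneg_left (expect_mono fun v => ind_mono fun hv => ?_)
      (poly_pos _ _).le)
    rw [mem_leftClass] at hv
    unfold uScore
    rw [hv]
  · intro v hv
    rw [mem_leftClass] at hv
    rw [← h2, ← hv, push_emp]

theorem exp_neg_max_le {P x z : ℝ} (hP : 1 ≤ P) (h : Real.exp z ≤ P * x) :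
    Real.exp (-max 0 (-z)) ≤ P * min 1 x := by
  rw [mul_min_of_nonneg _ _ (by linarith), mul_one]
  refine le_min (le_trans ?_ hP) (le_trans ?_ h)
  · exact Real.exp_le_one_iff.2 (neg_nonpos.2 (le_max_left _ _))
  · refine Real.exp_le_exp.2 ?_
    linarith [le_max_right 0 (-z)]

/-- The sum is restricted to the outputs that complete `(s, u, x)` to the type of `t`; on them the
channel probability and the tail estimate are constant. Rivals of the same state type already
suffice. -/
theorem sum_channel_mul_min_ge (hn : n ≠ 0) {W : S × X → Y → ℝ} (hW : W ∈ channels (S × X) Y)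
    (d : Design n S U X) (G : Metric n S U Y) {s : Fin n → S} {t : Fin n → (S × U × X) × Y}
    (ht : push Prod.fst (emp t) = d.Q (typeOf s))
    (htW : ∀ p, liftW U W p.1 p.2 = 0 → emp t p = 0) {u : d.UClass (typeOf s)}
    {x : Fin n → X} (hx : x ∈ xClass d s u.1) :
    Real.exp (n * ((entropy (emp t) - entropy (push Prod.fst (emp t))
          + ∑ p, emp t p * Real.log (liftW U W p.1 p.2))
        - max 0 (mutualInfo (push (fun p => (p.1.2.1, p.2)) (emp t))
          - mutualInfo (push (fun p => (p.1.2.1, p.1.1)) (emp t)) - (R + ε)))) ≤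
      poly n (Fintype.card ((S × U × X) × Y)) * poly n (Fintype.card (U × Y)) *
      ∑ y, (∏ i, W (s i, x i) (y i)) * min 1 (numMsg n R * d.binSize ε (typeOf s) *
        tail (uScore d G y (typeOf s)) (uScore d G y (typeOf s) u)) := by
  rw [mem_xClass] at hx
  set P1 := poly n (Fintype.card ((S × U × X) × Y)) with hP1
  set P2 := poly n (Fintype.card (U × Y)) with hP2
  have hP1' : 0 < P1 := poly_pos _ _
  have hP2' : 1 ≤ P2 := one_le_poly _ _
  set a : Fin n → S × U × X := fun i => (s i, u.1 i, x i) with ha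
  set IUY := mutualInfo (push (fun p => (p.1.2.1, p.2)) (emp t)) with hIUY
  set IUS := mutualInfo (push (fun p => (p.1.2.1, p.1.1)) (emp t)) with hIUS
  set L := ∑ p, emp t p * Real.log (liftW U W p.1 p.2) with hL
  have hQSU : d.QSU (typeOf s) = push (fun p => (p.1.1, p.1.2.1)) (emp t) := by
    rw [Design.QSU, ← ht, push_push]; rfl
  have hcard : Real.exp (n * (entropy (emp t) - entropy (push Prod.fst (emp t)))) ≤
      P1 * (rightClass (emp t) a).card := by
    rw [card_rightClass, ht, ← hx]
    exact le_card_fiberClass hn (by rw [ht, hx]) ⟨t, rfl⟩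
  have hterm : ∀ y ∈ rightClass (emp t) a,
      Real.exp (n * L) * (Real.exp (-max 0 (-(n * (R + ε + IUS - IUY)))) / P2) ≤
      (∏ i, W (s i, x i) (y i)) * min 1 (numMsg n R * d.binSize ε (typeOf s) *
        tail (uScore d G y (typeOf s)) (uScore d G y (typeOf s) u)) := by
    intro y hy
    rw [mem_rightClass] at hy
    have h1 : ∏ i, W (s i, x i) (y i) = Real.exp (n * L) := by
      have := prod_channel_eq_exp (U := U) hn hW (t := fun i => (a i, y i)) (by rwa [hy])
      rw [hy] at this
      exact this
    have h2 : (emp fun i => (u.1 i, y i)) = push (fun p => (p.1.2.1, p.2)) (emp t) := by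
      rw [← hy, push_emp]
    have h3 := le_poly_mul_tail hn d G y (typeOf s) u
    rw [h2, ← hIUY] at h3
    rw [h1]
    refine mul_le_mul_of_nonneg_left ?_ (Real.exp_pos _).le
    rw [div_le_iff₀' (by linarith)]
    refine exp_neg_max_le hP2' ?_
    have h4 : Real.exp (n * R) ≤ numMsg n R := exp_le_numMsg n R
    have h5 := d.exp_le_binSize ε (typeOf s)
    have h6 : d.binRate ε (typeOf s) = IUS + ε := by
      rw [Design.binRate, hQSU, mutualInfo_push_comm, hIUS]
    have hn0 : (0 : ℝ) ≤ numMsg n R := Nat.cast_nonneg _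
    calc Real.exp (n * (R + ε + IUS - IUY))
        = Real.exp (n * R) * Real.exp (n * d.binRate ε (typeOf s)) * Real.exp (-(n * IUY)) := by
          rw [← Real.exp_add, ← Real.exp_add, h6]; congr 1; ring
      _ ≤ numMsg n R * d.binSize ε (typeOf s) *
          (P2 * tail (uScore d G y (typeOf s)) (uScore d G y (typeOf s) u)) := by gcongr
      _ = _ := by ring
  have hsum : (rightClass (emp t) a).card *
      (Real.exp (n * L) * (Real.exp (-max 0 (-(n * (R + ε + IUS - IUY)))) / P2)) ≤
      ∑ y, (∏ i, W (s i, x i) (y i)) * min 1 (numMsg n R * d.binSize ε (typeOf s) *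
        tail (uScore d G y (typeOf s)) (uScore d G y (typeOf s) u)) := by
    rw [← nsmul_eq_mul, ← Finset.sum_const]
    refine (Finset.sum_le_sum hterm).trans (Finset.sum_le_univ_sum_of_nonneg fun y => ?_)
    refine mul_nonneg (Finset.prod_nonneg fun i _ => (hW _).1 _) (le_min zero_le_one ?_)
    have := tail_nonneg (uScore d G y (typeOf s)) (uScore d G y (typeOf s) u)
    positivity
  have hmax : -max 0 (-((n : ℝ) * (R + ε + IUS - IUY))) = -(n * max 0 (IUY - IUS - (R + ε))) := by
    rw [mul_max_of_nonneg _ _ (Nat.cast_nonneg n), mul_zero]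
    congr 2
    ring
  calc _ = Real.exp (n * (entropy (emp t) - entropy (push Prod.fst (emp t)))) *
        (Real.exp (n * L) * Real.exp (-max 0 (-(n * (R + ε + IUS - IUY))))) := by
        rw [← Real.exp_add, ← Real.exp_add, hmax]
        congr 1
        ring
    _ ≤ (P1 * (rightClass (emp t) a).card) *
        (Real.exp (n * L) * Real.exp (-max 0 (-(n * (R + ε + IUS - IUY))))) := by gcongr
    _ = P1 * P2 * ((rightClass (emp t) a).card *
      (Real.exp (n * L) * (Real.exp (-max 0 (-(n * (R + ε + IUS - IUY)))) / P2))) := by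
        field_simp
    _ ≤ _ := by gcongr

/-- Encoding failures are dropped. The probability `p` of a typical codeword cancels against the
normalization `K / (1 + K p)`, because ε keeps `K p` above the inverse of a polynomial. -/
theorem expect_errS_ge (hn : n ≠ 0) {W : S × X → Y → ℝ} (hW : W ∈ channels (S × X) Y)
    (hR : 0 < R) (hε : 0 < ε) (d : Design n S U X) (G : Metric n S U Y) (τ : TieRule n R Y)
    {s : Fin n → S} {t : Fin n → (S × U × X) × Y}
    (ht : push Prod.fst (emp t) = d.Q (typeOf s))
    (htW : ∀ p, liftW U W p.1 p.2 = 0 → emp t p = 0) :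
    Real.exp (n * ((entropy (emp t) - entropy (push Prod.fst (emp t))
          + ∑ p, emp t p * Real.log (liftW U W p.1 p.2))
        - max 0 (mutualInfo (push (fun p => (p.1.2.1, p.2)) (emp t))
          - mutualInfo (push (fun p => (p.1.2.1, p.1.1)) (emp t)) - (R + ε)))) ≤
      256 * poly n (Fintype.card (S × U)) *
        (poly n (Fintype.card ((S × U × X) × Y)) * poly n (Fintype.card (U × Y))) *
      𝔼 C : Codebook d R ε, (∑ m, errS W d G τ C m s) / numMsg n R := by
  classical
  have : Nonempty (Σ q, Fin (d.binSize ε q)) := nonempty_binIndex d ε s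
  set q := typeOf s with hq
  set N := numMsg n R with hN
  set P0 := poly n (Fintype.card (S × U)) with hP0
  set P12 := poly n (Fintype.card ((S × U × X) × Y)) * poly n (Fintype.card (U × Y)) with hP12
  have hP0' : 1 ≤ P0 := one_le_poly _ _
  have hP12' : 0 < P12 := mul_pos (poly_pos _ _) (poly_pos _ _)
  set E := Real.exp (n * ((entropy (emp t) - entropy (push Prod.fst (emp t))
          + ∑ p, emp t p * Real.log (liftW U W p.1 p.2))
        - max 0 (mutualInfo (push (fun p => (p.1.2.1, p.2)) (emp t))
          - mutualInfo (push (fun p => (p.1.2.1, p.1.1)) (emp t)) - (R + ε)))) with hE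
  have hE0 : 0 < E := Real.exp_pos _
  set p := 𝔼 u, ind (UGood d s u) with hp
  set K := d.binSize ε q with hK
  have hp0 : 0 ≤ p := expect_nonneg fun _ => ind_nonneg _
  have hKp : 1 ≤ P0 * (K * p) := by
    refine le_trans ?_ (le_binSize_mul_expect hn d ε s)
    rw [Real.one_le_exp_iff]
    positivity
  -- the errors for a given output
  have h1 : ∀ y, K / (1 + K * p) / 128 *
      𝔼 u, ind (UGood d s u) * outProb W d s y u *
        min 1 (N * K * tail (uScore d G y q) (uScore d G y q u)) ≤
      𝔼 C : Codebook d R ε, (∑ m, binAvg (UGood d s) (outProb W d s y) (binsEquiv d R ε C m) *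
          ind (decode d G τ C y ≠ m)) / N := by
    intro y
    have h := expect_error_ge (K := d.binSize ε) (two_le_numMsg hn hR) (uScore d G y) (UGood d s)
      (outProb_nonneg hW d s y) (τ := τ.1 y) (fun A hA => τ.2 y A hA)
      (A := fun D => argmaxMsg d G ((binsEquiv d R ε).symm D) y)
      (fun D m => by simpa using mem_argmaxMsg_iff d G ((binsEquiv d R ε).symm D) y m)
    refine h.trans (le_of_eq ?_)
    exact (Fintype.expect_equiv (binsEquiv d R ε) _ _ fun C => by simp [decode, hN]).symm
  have h2 : ∑ y : Fin n → Y, 𝔼 C : Codebook d R ε,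
      (∑ m, binAvg (UGood d s) (outProb W d s y) (binsEquiv d R ε C m) *
          ind (decode d G τ C y ≠ m)) / N ≤
      𝔼 C : Codebook d R ε, (∑ m, errS W d G τ C m s) / N := by
    rw [← Finset.expect_sum_comm]
    refine expect_mono fun C => ?_
    rw [← Finset.sum_div, Finset.sum_comm]
    refine div_le_div_of_nonneg_right (Finset.sum_le_sum fun m _ => ?_) (Nat.cast_nonneg _)
    rw [errS_eq]
    exact le_add_of_nonneg_left (ind_nonneg _)
  have h3 : p * (E / P12) ≤ ∑ y : Fin n → Y, 𝔼 u, ind (UGood d s u) * outProb W d s y u *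
        min 1 (N * K * tail (uScore d G y q) (uScore d G y q u)) := by
    rw [← Finset.expect_sum_comm, hp, Finset.expect_mul]
    refine expect_mono fun u => ?_
    by_cases hu : UGood d s u
    swap
    · simp [ind_of_not hu]
    rw [ind_of hu, one_mul]
    simp only [one_mul]
    have hne := xClass_nonempty hu
    have hc : (0 : ℝ) < (xClass d s u.1).card := by exact_mod_cast Finset.card_pos.2 hne
    unfold outProb
    simp_rw [div_mul_eq_mul_div]
    rw [← Finset.sum_div, le_div_iff₀ hc, div_mul_eq_mul_div, div_le_iff₀ hP12']
    simp_rw [Finset.sum_mul]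
    rw [Finset.sum_comm, mul_comm, ← nsmul_eq_mul, ← Finset.sum_const]
    refine Finset.sum_le_sum fun x hx => ?_
    rw [← Finset.sum_mul, mul_comm _ P12]
    exact sum_channel_mul_min_ge hn hW d G ht htW hx
  have h4 : K / (1 + K * p) / 128 * (p * (E / P12)) ≤
      𝔼 C : Codebook d R ε, (∑ m, errS W d G τ C m s) / N := by
    refine le_trans ?_ h2
    refine le_trans ?_ (Finset.sum_le_sum fun y _ => h1 y)
    rw [← Finset.mul_sum]
    gcongr
  have h5 : 1 ≤ 2 * P0 * (K * p / (1 + K * p)) := by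
    have hx : 0 ≤ (K : ℝ) * p := by positivity
    rw [← mul_div_assoc, le_div_iff₀ (by linarith)]
    nlinarith
  calc E ≤ E * (2 * P0 * (K * p / (1 + K * p))) := le_mul_of_one_le_right hE0.le h5
    _ = 256 * P0 * P12 * (K / (1 + K * p) / 128 * (p * (E / P12))) := by
        field_simp; ring
    _ ≤ _ := by gcongr

theorem errS_nonneg {W : S × X → Y → ℝ} (hW : W ∈ channels (S × X) Y) (d : Design n S U X)
    (G : Metric n S U Y) (τ : TieRule n R Y) (C : Codebook d R ε) (m : Fin (numMsg n R))
    (s : Fin n → S) : 0 ≤ errS W d G τ C m s := by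
  rw [errS_eq]
  exact add_nonneg (ind_nonneg _) (Finset.sum_nonneg fun y _ =>
    mul_nonneg (binAvg_nonneg _ (outProb_nonneg hW d s y) _) (ind_nonneg _))

theorem prod_state_eq_exp (hn : n ≠ 0) {PS : S → ℝ} (hPS : PS ∈ stdSimplex ℝ S) {s : Fin n → S}
    (hs : ∀ x, PS x = 0 → emp s x = 0) :
    ∏ i, PS (s i) = Real.exp (n * ∑ x, emp s x * Real.log (PS x)) := by
  refine prod_comp_eq_exp hn fun i => lt_of_le_of_ne (hPS.1 _) fun h => ?_
  exact (emp_pos (a := s) i).ne' (hs _ h.symm)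

/-- For every design, metric and tie-breaking rule, every joint type that is compatible with the
design bounds the exponent of the average error probability. -/
theorem exp_neg_gpExp_le (hn : n ≠ 0) {PS : S → ℝ} (hPS : PS ∈ stdSimplex ℝ S)
    {W : S × X → Y → ℝ} (hW : W ∈ channels (S × X) Y)
    (hR : 0 < R) (hε : 0 < ε) (d : Design n S U X) (G : Metric n S U Y) (τ : TieRule n R Y)
    {s : Fin n → S} (hs : ∀ x, PS x = 0 → emp s x = 0) {t : Fin n → (S × U × X) × Y}
    (ht : push Prod.fst (emp t) = d.Q (typeOf s))
    (htW : ∀ p, liftW U W p.1 p.2 = 0 → emp t p = 0) :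
    Real.exp (-(n * gpExp PS W (R + ε) (emp t))) ≤
      256 * poly n (Fintype.card S + (Fintype.card (S × U) +
        (Fintype.card ((S × U × X) × Y) + Fintype.card (U × Y)))) *
      avgErrorProb PS W R ε d G τ := by
  set E := Real.exp (n * ((entropy (emp t) - entropy (push Prod.fst (emp t))
          + ∑ p, emp t p * Real.log (liftW U W p.1 p.2))
        - max 0 (mutualInfo (push (fun p => (p.1.2.1, p.2)) (emp t))
          - mutualInfo (push (fun p => (p.1.2.1, p.1.1)) (emp t)) - (R + ε)))) with hE
  set L := ∑ x, emp s x * Real.log (PS x) with hL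
  set P := 256 * poly n (Fintype.card (S × U)) *
        (poly n (Fintype.card ((S × U × X) × Y)) * poly n (Fintype.card (U × Y))) with hP
  have hP0 : 0 < P := mul_pos (mul_pos (by norm_num) (poly_pos _ _))
    (mul_pos (poly_pos _ _) (poly_pos _ _))
  have hmarg : push (fun p => p.1.1) (emp t) = emp s := by
    have := d.marginal (typeOf s)
    change push Prod.fst (d.Q (typeOf s)) = emp s at this
    rw [← ht, push_push] at this
    exact this
  have h1 : ∀ s' ∈ typeClass n (emp s), Real.exp (n * L) * (E / P) ≤ (∏ i, PS (s' i)) *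
      𝔼 C : Codebook d R ε, (∑ m, errS W d G τ C m s') / numMsg n R := by
    intro s' hs'
    rw [mem_typeClass] at hs'
    have hty : typeOf s' = typeOf s := Subtype.ext hs'
    rw [prod_state_eq_exp hn hPS (s := s') (by rwa [hs']), hs']
    refine mul_le_mul_of_nonneg_left ?_ (Real.exp_pos _).le
    rw [div_le_iff₀' hP0]
    exact expect_errS_ge hn hW hR hε d G τ (by rw [ht, hty]) htW
  have h2 : (typeClass n (emp s)).card * (Real.exp (n * L) * (E / P)) ≤
      avgErrorProb PS W R ε d G τ := by
    rw [avgErrorProb_eq, ← nsmul_eq_mul, ← Finset.sum_const]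
    refine (Finset.sum_le_sum h1).trans (Finset.sum_le_univ_sum_of_nonneg fun s' => ?_)
    refine mul_nonneg (Finset.prod_nonneg fun i _ => hPS.1 _) (expect_nonneg fun C => ?_)
    exact div_nonneg (Finset.sum_nonneg fun m _ => errS_nonneg hW d G τ C m s') (Nat.cast_nonneg _)
  have h3 := le_card_typeClass hn s
  calc Real.exp (-(n * gpExp PS W (R + ε) (emp t)))
      = Real.exp (n * entropy (emp s)) * (Real.exp (n * L) * E) := by
        rw [hE, ← Real.exp_add, ← Real.exp_add, gpExp, hmarg]
        congr 1
        ring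
    _ ≤ poly n (Fintype.card S) * (typeClass n (emp s)).card * (Real.exp (n * L) * E) := by
        gcongr
    _ = P * poly n (Fintype.card S) *
        ((typeClass n (emp s)).card * (Real.exp (n * L) * (E / P))) := by field_simp
    _ ≤ P * poly n (Fintype.card S) * avgErrorProb PS W R ε d G τ := by
        have := poly_pos n (Fintype.card S)
        gcongr
    _ = _ := by
        rw [hP]
        simp only [poly_add]
        ring

end Lower

/-! ### The union bound -/

section Union

variable {Θ : Type*} [Fintype Θ] [DecidableEq Θ] {K : Θ → ℕ} {UC : Θ → Type*}
  [∀ q, Fintype (UC q)] [∀ q, Nonempty (UC q)] {N : ℕ}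

theorem expect_ind_exists_le (γ : ∀ q, UC q → ℝ) (t : ℝ) (m : Fin N)
    (B : ∀ i : Σ q, Fin (K q), UC i.1) :
    𝔼 D : Fin N → ∀ i : Σ q, Fin (K q), UC i.1,
      ind (∃ m', m' ≠ m ∧ ∃ i, t ≤ γ i.1 (Function.update D m B m' i)) ≤
      min 1 (N * ∑ q, K q * tail (γ q) t) := by
  refine le_min ?_ ?_
  · refine (expect_mono fun D => ind_le_one _).trans (le_of_eq (Fintype.expect_const 1))
  · have h1 : ∀ D : Fin N → ∀ i : Σ q, Fin (K q), UC i.1,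
        ind (∃ m', m' ≠ m ∧ ∃ i, t ≤ γ i.1 (Function.update D m B m' i)) ≤
        ∑ m' : Fin N, ∑ i, ind (t ≤ γ i.1 (D m' i)) := by
      intro D
      refine (ind_exists_le _).trans (Finset.sum_le_sum fun m' _ => ?_)
      refine le_trans (ind_mono fun h => ?_) (ind_exists_le _)
      obtain ⟨hm', i, hi⟩ := h
      rw [Function.update_of_ne hm'] at hi
      exact ⟨i, hi⟩
    refine (expect_mono h1).trans (le_of_eq ?_)
    rw [Finset.expect_sum_comm]
    simp_rw [Finset.expect_sum_comm]
    have h2 : ∀ (m' : Fin N) (i : Σ q, Fin (K q)),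
        𝔼 D : Fin N → ∀ i : Σ q, Fin (K q), UC i.1, ind (t ≤ γ i.1 (D m' i)) =
        tail (γ i.1) t := by
      intro m' i
      rw [expect_eval (α := fun _ : Fin N => ∀ i : Σ q, Fin (K q), UC i.1) m'
          fun B => ind (t ≤ γ i.1 (B i)),
        expect_eval (α := fun i : Σ q, Fin (K q) => UC i.1) i fun u => ind (t ≤ γ i.1 u)]
      rfl
    simp_rw [h2]
    rw [Finset.sum_const, Finset.card_univ, Fintype.card_fin, nsmul_eq_mul, Fintype.sum_sigma]
    congr 1
    refine Finset.sum_congr rfl fun q _ => (Finset.sum_const (tail (γ q) t)).trans ?_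
    rw [Finset.card_univ, Fintype.card_fin, nsmul_eq_mul]

/-- The bin of message `m` is frozen and the union bound is taken over the other, independent bins;
the bound `Z` per typical codeword then survives averaging over the bin. -/
theorem expect_error_le {Υ : Type*} [Fintype Υ] (γ : Υ → ∀ q, UC q → ℝ) {q : Θ} (P : UC q → Prop)
    {f : Υ → UC q → ℝ} (hf : ∀ y u, 0 ≤ f y u) (m : Fin N)
    {δ : (Fin N → ∀ i : Σ q, Fin (K q), UC i.1) → Υ → Fin N}
    (hδ : ∀ D y, δ D y ≠ m → ∀ i, ∃ m', m' ≠ m ∧ ∃ i', γ y i.1 (D m i) ≤ γ y i'.1 (D m' i'))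
    {Z : ℝ} (hZ : 0 ≤ Z) (hfZ : ∀ u, P u →
      ∑ y, f y u * min 1 (N * ∑ q', K q' * tail (γ y q') (γ y q u)) ≤ Z) :
    𝔼 D : Fin N → ∀ i : Σ q, Fin (K q), UC i.1,
      (ind (goodIndices P (D m) = ∅) + ∑ y, binAvg P (f y) (D m) * ind (δ D y ≠ m)) ≤
      Real.exp (-(K q * 𝔼 u, ind (P u))) + Z := by
  rw [Finset.expect_add_distrib]
  refine add_le_add ?_ ?_
  · rw [expect_eval (α := fun _ : Fin N => ∀ i : Σ q, Fin (K q), UC i.1) m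
      fun B => ind (goodIndices P B = ∅)]
    exact expect_ind_goodIndices_empty P
  · rw [expect_update _ m, Finset.expect_comm]
    refine (expect_mono (g := fun _ => Z) fun B => ?_).trans (le_of_eq (Fintype.expect_const Z))
    simp only [Function.update_self]
    rw [Finset.expect_sum_comm]
    simp_rw [← Finset.mul_expect]
    have h1 : ∀ y, binAvg P (f y) B * 𝔼 D : Fin N → ∀ i : Σ q, Fin (K q), UC i.1,
        ind (δ (Function.update D m B) y ≠ m) ≤
        ∑ k ∈ goodIndices P B, f y (B ⟨q, k⟩) *
          min 1 (N * ∑ q', K q' * tail (γ y q') (γ y q (B ⟨q, k⟩))) /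
            (goodIndices P B).card := by
      intro y
      unfold binAvg
      rw [div_mul_eq_mul_div, Finset.sum_mul, Finset.sum_div]
      refine Finset.sum_le_sum fun k _ => div_le_div_of_nonneg_right
        (mul_le_mul_of_nonneg_left ?_ (hf _ _)) (Nat.cast_nonneg _)
      refine le_trans (expect_mono fun D => ind_mono fun h => ?_)
        (expect_ind_exists_le (γ y) (γ y q (B ⟨q, k⟩)) m B)
      have := hδ _ y h ⟨q, k⟩
      simpa only [Function.update_self] using this
    refine (Finset.sum_le_sum fun y _ => h1 y).trans ?_
    rw [Finset.sum_comm]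
    simp_rw [← Finset.sum_div]
    refine div_le_of_le_mul₀ (Nat.cast_nonneg _) hZ ?_
    rw [mul_comm, ← nsmul_eq_mul, ← Finset.sum_const]
    exact Finset.sum_le_sum fun k hk => hfZ _ (mem_goodIndices.1 hk)

end Union

/-! ### The error probability of the penalized maximum mutual information decoder -/

section CondClassUpper

variable {A B : Type*} [Fintype A] [Fintype B] {n : ℕ}

theorem card_leftClass_div_le (hn : n ≠ 0) {T : A × B → ℝ} (hT : ∃ c : Fin n → A × B, emp c = T)
    {b : Fin n → B} (hb : push Prod.snd T = emp b) :
    ((leftClass T b).card : ℝ) / (typeClass n (push Prod.fst T)).card ≤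
      poly n (Fintype.card A + Fintype.card B) * Real.exp (-(n * mutualInfo T)) := by
  have h1 := card_fiberClass_le hn hb hT
  obtain ⟨c, rfl⟩ := hT
  have hs := push_emp Prod.fst c
  have h2 := le_card_typeClass hn fun i => (c i).1
  rw [← hs] at h2
  have h3 : (0 : ℝ) < (typeClass n (push Prod.fst (emp c))).card := by
    exact_mod_cast Finset.card_pos.2 ⟨fun i => (c i).1, by simp [hs]⟩
  have hB := poly_pos n (Fintype.card B)
  rw [card_leftClass, div_le_iff₀ h3]
  calc _ ≤ poly n (Fintype.card B) * Real.exp (n * (entropy (emp c) - entropy (emp b))) := h1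
    _ = poly n (Fintype.card B) * Real.exp (-(n * mutualInfo (emp c))) *
        Real.exp (n * entropy (push Prod.fst (emp c))) := by
        rw [mul_assoc, ← Real.exp_add, mutualInfo, hb]
        congr 2
        ring
    _ ≤ poly n (Fintype.card B) * Real.exp (-(n * mutualInfo (emp c))) *
        (poly n (Fintype.card A) * (typeClass n (push Prod.fst (emp c))).card) := by gcongr
    _ = _ := by rw [poly_add]; ring

/-- Each type class contributes at most 1, so the sum is at most the number of types. -/
theorem sum_exp_neg_entropy_le (hn : n ≠ 0) :
    ∑ a : Fin n → A, Real.exp (-(n * entropy (emp a))) ≤ poly n (Fintype.card A) := by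
  classical
  rw [← Finset.sum_fiberwise (s := Finset.univ) (g := typeOf)]
  refine le_trans ?_ (card_nType_le n A)
  rw [← Finset.card_univ, Finset.card_eq_sum_ones]
  push_cast
  refine Finset.sum_le_sum fun q _ => ?_
  obtain ⟨_, a, rfl⟩ := q
  rw [Finset.sum_congr rfl (g := fun _ => Real.exp (-(n * entropy (emp a))))]
  · rw [Finset.sum_const, nsmul_eq_mul, Real.exp_neg, ← div_eq_mul_inv,
      div_le_one (Real.exp_pos _)]
    refine le_trans (le_of_eq ?_) (card_typeClass_le hn a)
    congr 2
    ext b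
    rw [Finset.mem_filter, mem_typeClass]
    exact ⟨fun h => congrArg Subtype.val h.2, fun h => ⟨Finset.mem_univ _, Subtype.ext h⟩⟩
  · intro b hb
    rw [show emp b = emp a from congrArg Subtype.val (Finset.mem_filter.1 hb).2]

theorem sum_exp_neg_condEntropy_le (hn : n ≠ 0) (a : Fin n → A) :
    ∑ b : Fin n → B, Real.exp (-(n * (entropy (emp fun i => (a i, b i)) - entropy (emp a)))) ≤
      poly n (Fintype.card (A × B) + Fintype.card A) := by
  classical
  rw [← Finset.sum_fiberwise (s := Finset.univ) (g := fun b => typeOf fun i => (a i, b i)),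
    poly_add]
  calc _ ≤ ∑ q : NType n (A × B), poly n (Fintype.card A) := by
        refine Finset.sum_le_sum fun q _ => ?_
        rw [Finset.sum_congr rfl
          (g := fun _ => Real.exp (-(n * (entropy q.1 - entropy (emp a)))))]
        swap
        · intro b hb
          rw [show emp (fun i => (a i, b i)) = q.1 from
            congrArg Subtype.val (Finset.mem_filter.1 hb).2]
        rcases (Finset.univ.filter fun b : Fin n → B =>
          typeOf (fun i => (a i, b i)) = q).eq_empty_or_nonempty with h | ⟨b, hb⟩
        · rw [h, Finset.sum_empty]
          exact (poly_pos _ _).le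
        have hbq : emp (fun i => (a i, b i)) = q.1 :=
          congrArg Subtype.val (Finset.mem_filter.1 hb).2
        have h1 := card_fiberClass_le hn (f := Prod.fst) (T := q.1) (b := a)
          (by rw [← hbq, push_emp]) q.2
        rw [← card_rightClass] at h1
        rw [Finset.sum_const, nsmul_eq_mul, Real.exp_neg, ← div_eq_mul_inv,
          div_le_iff₀ (Real.exp_pos _)]
        refine le_trans (le_of_eq ?_) h1
        congr 2
        ext b'
        rw [Finset.mem_filter, mem_rightClass]
        exact ⟨fun h => congrArg Subtype.val h.2, fun h => ⟨Finset.mem_univ _, Subtype.ext h⟩⟩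
    _ ≤ _ := by
        rw [Finset.sum_const, Finset.card_univ, nsmul_eq_mul]
        exact mul_le_mul_of_nonneg_right (card_nType_le _ _) (poly_pos _ _).le

end CondClassUpper

/-! ### Tails, union bound and average error for the penalized metric. -/

section Upper

variable {n : ℕ} {S U X Y : Type*} [Fintype S] [Fintype U] [Fintype X] [Fintype Y]
  {R ε : ℝ}

/-- Score at least `t` means `I(U;Y) ≥ t + R(Q_S)`. Each such joint type has probability about
`e^{-nI}`, and there are polynomially many. -/
theorem tail_mmi_le (hn : n ≠ 0) (d : Design n S U X) (ε : ℝ) (y : Fin n → Y) (q : NType n S)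
    (t : ℝ) :
    tail (uScore d (mmiMetric d ε) y q) t ≤
      poly n (Fintype.card (U × Y) + (Fintype.card U + Fintype.card Y)) *
        Real.exp (-(n * (t + d.binRate ε q))) := by
  classical
  have h1 : ∀ u : d.UClass q, ind (t ≤ uScore d (mmiMetric d ε) y q u) ≤
      ∑ T : NType n (U × Y), ind (u.1 ∈ leftClass T.1 y ∧ t + d.binRate ε q ≤ mutualInfo T.1) := by
    intro u
    refine le_trans (ind_mono fun h => ?_) (ind_exists_le _)
    refine ⟨typeOf fun i => (u.1 i, y i), by simp [typeOf], ?_⟩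
    simp only [uScore, mmiMetric] at h
    simp only [typeOf]
    linarith
  unfold tail
  refine (expect_mono h1).trans ?_
  rw [Finset.expect_sum_comm, poly_add, mul_assoc]
  refine le_trans (Finset.sum_le_card_nsmul _ _
    (poly n (Fintype.card U + Fintype.card Y) * Real.exp (-(n * (t + d.binRate ε q))))
    fun T _ => ?_) ?_
  · have hnn : 0 ≤ poly n (Fintype.card U + Fintype.card Y) *
        Real.exp (-(n * (t + d.binRate ε q))) := mul_nonneg (poly_pos _ _).le (Real.exp_pos _).le
    by_cases hex : ∃ u : d.UClass q, u.1 ∈ leftClass T.1 y ∧ t + d.binRate ε q ≤ mutualInfo T.1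
    swap
    · push Not at hex
      refine le_trans (le_of_eq (Finset.expect_eq_zero fun u _ => ind_of_not ?_)) hnn
      rintro ⟨h, h'⟩
      exact (hex u h).not_ge h'
    obtain ⟨u, hu, hI⟩ := hex
    rw [mem_leftClass] at hu
    have hfst : push Prod.fst T.1 = d.QU q := by rw [← hu, push_emp]; exact u.2
    have h2 := card_leftClass_div_le hn T.2 (b := y) (by rw [← hu, push_emp])
    rw [hfst, ← expect_UClass d q] at h2
    · refine (expect_mono fun v => ind_mono fun h => h.1).trans (h2.trans ?_)
      refine mul_le_mul_of_nonneg_left (Real.exp_le_exp.2 ?_) (poly_pos _ _).le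
      have : (0 : ℝ) ≤ n := Nat.cast_nonneg _
      nlinarith
    · intro v hv
      rw [mem_leftClass] at hv
      rw [← hfst, ← hv, push_emp]
  · rw [Finset.card_univ, nsmul_eq_mul]
    exact mul_le_mul_of_nonneg_right (card_nType_le _ _)
      (mul_nonneg (poly_pos _ _).le (Real.exp_pos _).le)

/-- Rounding up is harmless once the exponential is not too small. Instead of nonnegativity of
mutual information, it is enough that `e^{-nI}` is at most a polynomial times a probability. -/
theorem binSize_le (hn : n ≠ 0) (hε : 0 < ε) (d : Design n S U X) (q : NType n S) :
    (d.binSize ε q : ℝ) ≤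
      2 * poly n (Fintype.card (S × U)) * Real.exp (n * d.binRate ε q) := by
  obtain ⟨_, s, rfl⟩ := q
  change (d.binSize ε (typeOf s) : ℝ) ≤
    2 * poly n (Fintype.card (S × U)) * Real.exp (n * d.binRate ε (typeOf s))
  have h1 := exp_neg_mutualInfo_QSU_le hn d s
  have h2 : 𝔼 u, ind (UGood d s u) ≤ 1 :=
    (expect_mono fun _ => ind_le_one _).trans (le_of_eq (Fintype.expect_const 1))
  have hP := one_le_poly n (Fintype.card (S × U))
  set P := poly n (Fintype.card (S × U))
  have h3 : Real.exp (-(n * mutualInfo (d.QSU (typeOf s)))) ≤ P :=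
    h1.trans (mul_le_of_le_one_right (by linarith) h2)
  have h4 : 1 ≤ P * Real.exp (n * d.binRate ε (typeOf s)) := by
    have h5 : Real.exp (n * mutualInfo (d.QSU (typeOf s))) ≤
        Real.exp (n * d.binRate ε (typeOf s)) := by
      unfold Design.binRate
      gcongr
      linarith
    calc (1 : ℝ) = Real.exp (-(n * mutualInfo (d.QSU (typeOf s)))) *
          Real.exp (n * mutualInfo (d.QSU (typeOf s))) := by rw [← Real.exp_add]; simp
      _ ≤ _ := by gcongr
  have h6 : (d.binSize ε (typeOf s) : ℝ) ≤ Real.exp (n * d.binRate ε (typeOf s)) + 1 :=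
    (Nat.ceil_lt_add_one (Real.exp_pos _).le).le
  have h7 : Real.exp (n * d.binRate ε (typeOf s)) ≤
      P * Real.exp (n * d.binRate ε (typeOf s)) :=
    le_mul_of_one_le_left (Real.exp_pos _).le hP
  linarith

theorem numMsg_le (n : ℕ) (hR : 0 < R) : (numMsg n R : ℝ) ≤ 2 * Real.exp (n * R) := by
  have h1 : (numMsg n R : ℝ) ≤ Real.exp (n * R) + 1 := (Nat.ceil_lt_add_one (Real.exp_pos _).le).le
  have h2 : 1 ≤ Real.exp (n * R) := Real.one_le_exp (by positivity)
  linarith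

/-- The exponent of the polynomial factor in the union bound. -/
def unionDegree (S U Y : Type*) [Fintype S] [Fintype U] [Fintype Y] : ℕ :=
  Fintype.card S + (Fintype.card (S × U) + (Fintype.card (U × Y) +
    (Fintype.card U + Fintype.card Y)))

/-- The reason for the penalty: the bin size `e^{nR(Q_S)}` cancels the factor `e^{-nR(Q_S)}` of the
tail, so the bound no longer depends on the state type. -/
theorem union_mmi_le (hn : n ≠ 0) (hR : 0 < R) (hε : 0 < ε) (d : Design n S U X) (y : Fin n → Y)
    (t : ℝ) :
    numMsg n R * ∑ q, d.binSize ε q * tail (uScore d (mmiMetric d ε) y q) t ≤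
      4 * poly n (unionDegree S U Y) * Real.exp (n * (R - t)) := by
  set P1 := poly n (Fintype.card S)
  set P2 := poly n (Fintype.card (S × U))
  set P3 := poly n (Fintype.card (U × Y) + (Fintype.card U + Fintype.card Y))
  have hP1 : 0 < P1 := poly_pos _ _
  have hP2 : 0 < P2 := poly_pos _ _
  have hP3 : 0 < P3 := poly_pos _ _
  have h1 : ∀ q, d.binSize ε q * tail (uScore d (mmiMetric d ε) y q) t ≤
      2 * P2 * P3 * Real.exp (-(n * t)) := by
    intro q
    calc d.binSize ε q * tail (uScore d (mmiMetric d ε) y q) t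
        ≤ (2 * P2 * Real.exp (n * d.binRate ε q)) *
          (P3 * Real.exp (-(n * (t + d.binRate ε q)))) := by
          gcongr
          · exact tail_nonneg _ _
          · exact binSize_le hn hε d q
          · exact tail_mmi_le hn d ε y q t
      _ = 2 * P2 * P3 * (Real.exp (n * d.binRate ε q) *
          Real.exp (-(n * (t + d.binRate ε q)))) := by ring
      _ = _ := by rw [← Real.exp_add]; congr 2; ring
  calc numMsg n R * ∑ q, d.binSize ε q * tail (uScore d (mmiMetric d ε) y q) t
      ≤ (2 * Real.exp (n * R)) * ∑ _q : NType n S, 2 * P2 * P3 * Real.exp (-(n * t)) := by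
        refine mul_le_mul (numMsg_le n hR) (Finset.sum_le_sum fun q _ => h1 q)
          (Finset.sum_nonneg fun q _ => mul_nonneg (Nat.cast_nonneg _) (tail_nonneg _ _)) ?_
        positivity
    _ ≤ (2 * Real.exp (n * R)) * (P1 * (2 * P2 * P3 * Real.exp (-(n * t)))) := by
        rw [Finset.sum_const, Finset.card_univ, nsmul_eq_mul]
        have := card_nType_le n S
        gcongr
    _ = 4 * (P1 * (P2 * P3)) * (Real.exp (n * R) * Real.exp (-(n * t))) := by ring
    _ = _ := by
        rw [← Real.exp_add, unionDegree, poly_add, poly_add n (Fintype.card (S × U))]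
        congr 2
        ring

theorem min_one_le_exp {P z : ℝ} (hP : 1 ≤ P) :
    min 1 (P * Real.exp z) ≤ P * Real.exp (-max 0 (-z)) := by
  rcases le_total z 0 with h | h
  · rw [max_eq_right (by linarith), neg_neg]
    exact min_le_right _ _
  · rw [max_eq_left (by linarith), neg_zero, Real.exp_zero, mul_one]
    exact (min_le_left _ _).trans hP

omit [Fintype Y] in
-- The decoded message is a maximizer, so its best codeword scores at least as well as every
-- codeword of `m`; ties are thereby conceded, which covers every tie rule.
theorem decode_ne_imp (d : Design n S U X) (G : Metric n S U Y) (τ : TieRule n R Y)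
    (C : Codebook d R ε) (y : Fin n → Y) (m : Fin (numMsg n R)) (h : decode d G τ C y ≠ m)
    (i : Σ q, Fin (d.binSize ε q)) :
    ∃ m', m' ≠ m ∧ ∃ i', uScore d G y i.1 (binsEquiv d R ε C m i) ≤
      uScore d G y i'.1 (binsEquiv d R ε C m' i') := by
  have : Nonempty (Σ q, Fin (d.binSize ε q)) := ⟨i⟩
  have : Nonempty (Fin (numMsg n R)) := ⟨m⟩
  have hne : (argmaxMsg d G C y).Nonempty := by
    obtain ⟨m₀, hm₀⟩ := Finite.exists_max fun m =>
      binScore (uScore d G y) (binsEquiv d R ε C m)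
    exact ⟨m₀, (mem_argmaxMsg_iff d G C y m₀).2 hm₀⟩
  have hmem := τ.2 y _ hne
  refine ⟨decode d G τ C y, h, ?_⟩
  obtain ⟨i', hi'⟩ := exists_eq_binScore (uScore d G y) (binsEquiv d R ε C (decode d G τ C y))
  refine ⟨i', ?_⟩
  rw [← hi']
  exact (le_binScore (uScore d G y) (binsEquiv d R ε C m) i).trans
    ((mem_argmaxMsg_iff d G C y _).1 hmem m)

omit [Fintype S] [Fintype U] [Fintype X] [Fintype Y] in
theorem prod_channel_eq_zero {W : S × X → Y → ℝ}
    {t : Fin n → (S × U × X) × Y} (htW : ¬ ∀ p, liftW U W p.1 p.2 = 0 → emp t p = 0) :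
    ∏ i, liftW U W (t i).1 (t i).2 = 0 := by
  push Not at htW
  obtain ⟨p, hp, hp'⟩ := htW
  obtain ⟨i, rfl⟩ := exists_of_emp_ne_zero hp'
  exact Finset.prod_eq_zero (Finset.mem_univ i) hp

omit [Fintype S] in
theorem prod_state_eq_zero {PS : S → ℝ} {s : Fin n → S} (hs : ¬ ∀ x, PS x = 0 → emp s x = 0) :
    ∏ i, PS (s i) = 0 := by
  push Not at hs
  obtain ⟨x, hx, hx'⟩ := hs
  obtain ⟨i, rfl⟩ := exists_of_emp_ne_zero hx'
  exact Finset.prod_eq_zero (Finset.mem_univ i) hx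

/-- For each `y`, the product of the three factors is at most `e^{-n gpExp}` times `e^{-nH(s)}
e^{-nH(y|s,u,x)}` up to a polynomial, and the last weight sums over `y` to a polynomial. Outputs of
zero probability are discarded beforehand. -/
theorem prod_state_mul_sum_le (hn : n ≠ 0) {PS : S → ℝ} (hPS : PS ∈ stdSimplex ℝ S)
    {W : S × X → Y → ℝ} (hW : W ∈ channels (S × X) Y) (hR : 0 < R) (hε : 0 < ε)
    (d : Design n S U X) {s : Fin n → S} (hs : ∀ x, PS x = 0 → emp s x = 0) {a₀ : ℝ}
    (ha : ∀ t : Fin n → (S × U × X) × Y, push Prod.fst (emp t) = d.Q (typeOf s) →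
      (∀ p, liftW U W p.1 p.2 = 0 → emp t p = 0) → a₀ ≤ gpExp PS W (R + ε) (emp t))
    {u : d.UClass (typeOf s)} {x : Fin n → X} (hx : x ∈ xClass d s u.1) :
    (∏ i, PS (s i)) * ∑ y, (∏ i, W (s i, x i) (y i)) *
      min 1 (numMsg n R * ∑ q, d.binSize ε q * tail (uScore d (mmiMetric d ε) y q)
        (uScore d (mmiMetric d ε) y (typeOf s) u)) ≤
      4 * poly n (unionDegree S U Y + (Fintype.card ((S × U × X) × Y) + Fintype.card (S × U × X))) *
        Real.exp (-(n * a₀)) * Real.exp (-(n * entropy (emp s))) := by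
  rw [mem_xClass] at hx
  set P1 := poly n (unionDegree S U Y)
  have hP1 : 1 ≤ P1 := one_le_poly _ _
  set a : Fin n → S × U × X := fun i => (s i, u.1 i, x i) with hadef
  have hterm : ∀ y : Fin n → Y, (∏ i, PS (s i)) * ((∏ i, W (s i, x i) (y i)) *
      min 1 (numMsg n R * ∑ q, d.binSize ε q * tail (uScore d (mmiMetric d ε) y q)
        (uScore d (mmiMetric d ε) y (typeOf s) u))) ≤
      4 * P1 * Real.exp (-(n * a₀)) * Real.exp (-(n * entropy (emp s))) *
        Real.exp (-(n * (entropy (emp fun i => (a i, y i)) - entropy (emp a)))) := by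
    intro y
    set t : Fin n → (S × U × X) × Y := fun i => (a i, y i) with ht
    have hprod : ∏ i, W (s i, x i) (y i) = ∏ i, liftW U W (t i).1 (t i).2 := rfl
    by_cases htW : ∀ p, liftW U W p.1 p.2 = 0 → emp t p = 0
    swap
    · rw [hprod, prod_channel_eq_zero htW]
      have := (one_pos.trans_le hP1).le
      simp only [zero_mul, mul_zero]
      positivity
    have hta : push Prod.fst (emp t) = d.Q (typeOf s) := by rw [push_emp, ← hx]
    have hgp := ha t hta htW
    rw [hprod, prod_channel_eq_exp hn hW htW, prod_state_eq_exp hn hPS hs]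
    have hs' : push (fun p => p.1.1) (emp t) = emp s := by rw [push_emp]
    have hu : push (fun p => (p.1.2.1, p.2)) (emp t) = emp fun i => (u.1 i, y i) := by
      rw [push_emp]
    have hrate : d.binRate ε (typeOf s) =
        mutualInfo (push (fun p => (p.1.2.1, p.1.1)) (emp t)) + ε := by
      rw [Design.binRate, Design.QSU, ← hta, push_push, ← mutualInfo_push_comm]
      rfl
    set L1 := ∑ x, emp s x * Real.log (PS x)
    set L2 := ∑ p, emp t p * Real.log (liftW U W p.1 p.2)
    set M := max 0 (mutualInfo (push (fun p => (p.1.2.1, p.2)) (emp t))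
          - mutualInfo (push (fun p => (p.1.2.1, p.1.1)) (emp t)) - (R + ε)) with hM
    have hmin : min 1 (numMsg n R * ∑ q, d.binSize ε q * tail (uScore d (mmiMetric d ε) y q)
        (uScore d (mmiMetric d ε) y (typeOf s) u)) ≤ 4 * P1 * Real.exp (-(n * M)) := by
      refine (min_le_min_left 1 (union_mmi_le hn hR hε d y _)).trans ?_
      refine (min_one_le_exp (by linarith)).trans (le_of_eq ?_)
      have : uScore d (mmiMetric d ε) y (typeOf s) u =
          mutualInfo (push (fun p => (p.1.2.1, p.2)) (emp t)) - d.binRate ε (typeOf s) := by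
        rw [hu]; rfl
      rw [this, hrate, hM, mul_max_of_nonneg _ _ (Nat.cast_nonneg n), mul_zero]
      congr 4
      ring
    have hgpe : gpExp PS W (R + ε) (emp t) = (-entropy (emp s) - L1) +
        (entropy (emp a) - entropy (emp t) - L2) + M := by
      rw [gpExp, hs', push_emp]
    calc Real.exp (n * L1) * (Real.exp (n * L2) *
          min 1 (numMsg n R * ∑ q, d.binSize ε q * tail (uScore d (mmiMetric d ε) y q)
        (uScore d (mmiMetric d ε) y (typeOf s) u)))
        ≤ Real.exp (n * L1) * (Real.exp (n * L2) * (4 * P1 * Real.exp (-(n * M)))) := by gcongr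
      _ = 4 * P1 * Real.exp (-(n * gpExp PS W (R + ε) (emp t))) *
          Real.exp (-(n * entropy (emp s))) *
          Real.exp (-(n * (entropy (emp t) - entropy (emp a)))) := by
          have : Real.exp (n * L1) * (Real.exp (n * L2) * Real.exp (-(n * M))) =
              Real.exp (-(n * gpExp PS W (R + ε) (emp t))) *
              (Real.exp (-(n * entropy (emp s))) *
              Real.exp (-(n * (entropy (emp t) - entropy (emp a))))) := by
            simp only [← Real.exp_add]
            rw [hgpe]
            congr 1
            ring
          linear_combination (4 * P1) * this
      _ ≤ _ := by gcongr
  rw [Finset.mul_sum]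
  refine (Finset.sum_le_sum fun y _ => hterm y).trans ?_
  rw [← Finset.mul_sum, poly_add]
  have hP1' : 0 < P1 := by linarith
  calc _ ≤ 4 * P1 * Real.exp (-(n * a₀)) * Real.exp (-(n * entropy (emp s))) *
        poly n (Fintype.card ((S × U × X) × Y) + Fintype.card (S × U × X)) := by
        gcongr
        exact sum_exp_neg_condEntropy_le hn a
    _ = _ := by ring

/-- The random coding bound for the penalized maximum mutual information decoder. -/
theorem avgErrorProb_mmi_le (hn : n ≠ 0) {PS : S → ℝ} (hPS : PS ∈ stdSimplex ℝ S)
    {W : S × X → Y → ℝ} (hW : W ∈ channels (S × X) Y) (hR : 0 < R) (hε : 0 < ε)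
    (d : Design n S U X) (τ : TieRule n R Y) {a₀ : ℝ}
    (ha : ∀ s : Fin n → S, (∀ x, PS x = 0 → emp s x = 0) →
      ∀ t : Fin n → (S × U × X) × Y, push Prod.fst (emp t) = d.Q (typeOf s) →
      (∀ p, liftW U W p.1 p.2 = 0 → emp t p = 0) → a₀ ≤ gpExp PS W (R + ε) (emp t)) :
    avgErrorProb PS W R ε d (mmiMetric d ε) τ ≤
      Real.exp (-(Real.exp (n * ε) / poly n (Fintype.card (S × U)))) +
      4 * poly n (Fintype.card S + (unionDegree S U Y +
        (Fintype.card ((S × U × X) × Y) + Fintype.card (S × U × X)))) * Real.exp (-(n * a₀)) := by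
  set P := poly n (unionDegree S U Y +
        (Fintype.card ((S × U × X) × Y) + Fintype.card (S × U × X))) with hP
  have hP0 : 0 < P := poly_pos _ _
  set F := Real.exp (-(Real.exp (n * ε) / poly n (Fintype.card (S × U)))) with hF
  have key : ∀ s : Fin n → S, (∏ i, PS (s i)) * 𝔼 C : Codebook d R ε,
      (∑ m, errS W d (mmiMetric d ε) τ C m s) / numMsg n R ≤
      (∏ i, PS (s i)) * F +
        4 * P * Real.exp (-(n * a₀)) * Real.exp (-(n * entropy (emp s))) := by
    classical
    intro s
    by_cases hs : ∀ x, PS x = 0 → emp s x = 0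
    swap
    · rw [prod_state_eq_zero hs, zero_mul, zero_mul, zero_add]
      positivity
    have hpos : 0 < ∏ i, PS (s i) := by rw [prod_state_eq_exp hn hPS hs]; exact Real.exp_pos _
    -- The state probability is divided out here and restored at the end, so that `e^{-nH(s)}` can
    -- be summed over all state sequences.
    set Z := 4 * P * Real.exp (-(n * a₀)) * Real.exp (-(n * entropy (emp s))) / ∏ i, PS (s i)
      with hZ
    have hZ0 : 0 ≤ Z := by positivity
    have hm : ∀ m : Fin (numMsg n R), 𝔼 C : Codebook d R ε,
        errS W d (mmiMetric d ε) τ C m s ≤ F + Z := by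
      intro m
      have h := expect_error_le (K := d.binSize ε) (fun y => uScore d (mmiMetric d ε) y)
        (UGood d s) (outProb_nonneg hW d s) m
        (δ := fun D y => decode d (mmiMetric d ε) τ ((binsEquiv d R ε).symm D) y)
        (fun D y h i => by
          simpa using decode_ne_imp d (mmiMetric d ε) τ ((binsEquiv d R ε).symm D) y m h i)
        hZ0 (fun u hu => by
          have hne := xClass_nonempty hu
          have hc : (0 : ℝ) < (xClass d s u.1).card := by exact_mod_cast Finset.card_pos.2 hne
          unfold outProb
          simp_rw [div_mul_eq_mul_div]
          rw [← Finset.sum_div, div_le_iff₀ hc]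
          simp_rw [Finset.sum_mul]
          rw [Finset.sum_comm, mul_comm, ← nsmul_eq_mul, ← Finset.sum_const]
          refine Finset.sum_le_sum fun x hx => ?_
          rw [hZ, le_div_iff₀' hpos]
          exact prod_state_mul_sum_le hn hPS hW hR hε d hs (ha s hs) hx)
      refine le_trans (le_of_eq ?_) (h.trans (add_le_add_left ?_ Z))
      · exact Fintype.expect_equiv (binsEquiv d R ε) _ _ fun C => by
          rw [errS_eq]; simp
      · refine Real.exp_le_exp.2 (neg_le_neg ?_)
        rw [div_le_iff₀' (poly_pos _ _)]
        exact le_binSize_mul_expect hn d ε s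
    have hN : (0 : ℝ) < numMsg n R := by exact_mod_cast numMsg_pos n R
    have hE : 𝔼 C : Codebook d R ε, (∑ m, errS W d (mmiMetric d ε) τ C m s) / numMsg n R ≤
        F + Z := by
      rw [← Finset.expect_div, div_le_iff₀ hN, Finset.expect_sum_comm]
      refine (Finset.sum_le_sum fun m _ => hm m).trans (le_of_eq ?_)
      rw [Finset.sum_const, Finset.card_univ, Fintype.card_fin, nsmul_eq_mul, mul_comm]
    refine (mul_le_mul_of_nonneg_left hE hpos.le).trans (le_of_eq ?_)
    rw [mul_add, hZ, mul_div_cancel₀ _ hpos.ne']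
  rw [avgErrorProb_eq]
  refine (Finset.sum_le_sum fun s _ => key s).trans ?_
  rw [Finset.sum_add_distrib, ← Finset.sum_mul, ← Finset.mul_sum, ← Fintype.sum_pow, hPS.2, one_pow,
    one_mul]
  refine add_le_add_right ?_ F
  calc _ ≤ 4 * P * Real.exp (-(n * a₀)) * poly n (Fintype.card S) := by
        gcongr
        exact sum_exp_neg_entropy_le hn
    _ = _ := by rw [poly_add n (Fintype.card S)]; ring

end Upper

/-! ### Exponential rates -/

theorem tendsto_log_poly_div (k : ℕ) {c : ℝ} (hc : 0 < c) :
    Tendsto (fun n : ℕ => Real.log (c * poly n k) / n) atTop (𝓝 0) := by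
  have h1 : Tendsto (fun n : ℕ => Real.log ((n : ℝ) + 1) / n) atTop (𝓝 0) := by
    have h := (Real.tendsto_pow_log_div_mul_add_atTop 1 (-1) 1 one_ne_zero).comp
      (tendsto_atTop_add_const_right _ 1 (tendsto_natCast_atTop_atTop (R := ℝ)))
    refine h.congr fun n => ?_
    simp
  have h2 := tendsto_const_div_atTop_nhds_zero_nat (Real.log c + k * Real.log 3)
  have h3 := h2.add (h1.const_mul (k : ℝ))
  rw [mul_zero, add_zero] at h3
  refine h3.congr fun n => ?_
  rw [Real.log_mul hc.ne' (poly_pos n k).ne', poly, Real.log_pow,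
    Real.log_mul (by norm_num) (by positivity)]
  ring

theorem rate_le_of_le {n : ℕ} (hn : n ≠ 0) {p P b : ℝ} (hP : 0 < P)
    (h : Real.exp (-(n * b)) ≤ P * p) : rate n p ≤ ((b + Real.log P / n : ℝ) : EReal) := by
  have hn' : (0 : ℝ) < n := by exact_mod_cast Nat.pos_of_ne_zero hn
  have hp : 0 < p := pos_of_mul_pos_right ((Real.exp_pos _).trans_le h) hP.le
  rw [rate, if_neg hp.not_ge, EReal.coe_le_coe_iff]
  have h1 := Real.log_le_log (Real.exp_pos _) h
  rw [Real.log_exp, Real.log_mul hP.ne' hp.ne'] at h1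
  rw [← sub_nonneg]
  have : b + Real.log P / n - -(1 / n) * Real.log p = (n * b + Real.log P + Real.log p) / n := by
    field_simp; ring
  rw [this]
  exact div_nonneg (by linarith) hn'.le

theorem le_rate_of_le {n : ℕ} (hn : n ≠ 0) {p P a : ℝ} (hP : 0 < P)
    (h : p ≤ P * Real.exp (-(n * a))) : ((a - Real.log P / n : ℝ) : EReal) ≤ rate n p := by
  have hn' : (0 : ℝ) < n := by exact_mod_cast Nat.pos_of_ne_zero hn
  rw [rate]
  split_ifs with hp
  · exact le_top
  push Not at hp
  rw [EReal.coe_le_coe_iff]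
  have h1 := Real.log_le_log hp h
  rw [Real.log_mul hP.ne' (Real.exp_pos _).ne', Real.log_exp] at h1
  rw [← sub_nonneg]
  have : -(1 / n) * Real.log p - (a - Real.log P / n) = (Real.log P - n * a - Real.log p) / n := by
    field_simp; ring
  rw [this]
  exact div_nonneg (by linarith) hn'.le

/-- The doubly exponential term is negligible. -/
theorem eventually_exp_neg_exp_le {ε : ℝ} (hε : 0 < ε) (k : ℕ) (a : ℝ) :
    ∀ᶠ n : ℕ in atTop, Real.exp (-(Real.exp (n * ε) / poly n k)) ≤ Real.exp (-(n * a)) := by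
  have hc : 0 < |a| + 1 := by positivity
  -- The additional power of the polynomial, together with `|a| + 1`, absorbs the factor `n * a`.
  filter_upwards [(tendsto_log_poly_div (k + 1) hc).eventually (gt_mem_nhds hε),
    eventually_gt_atTop 0] with n hn hn0
  have hn' : (0 : ℝ) < n := by exact_mod_cast hn0
  have hP := poly_pos n k
  have hP' := poly_pos n (k + 1)
  rw [div_lt_iff₀ hn', Real.log_lt_iff_lt_exp (by positivity), mul_comm ε] at hn
  rw [Real.exp_le_exp, neg_le_neg_iff, le_div_iff₀ hP]
  refine le_trans ?_ hn.le
  rw [poly_add, show poly n 1 = 3 * ((n : ℝ) + 1) from pow_one _]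
  have h1 : n * a ≤ (|a| + 1) * (3 * ((n : ℝ) + 1)) := by
    nlinarith [le_abs_self a, abs_nonneg a]
  calc n * a * poly n k ≤ (|a| + 1) * (3 * ((n : ℝ) + 1)) * poly n k := by gcongr
    _ = _ := by ring

theorem rate_antitone (n : ℕ) : Antitone (rate n) := by
  intro p p' h
  unfold rate
  by_cases hp : p ≤ 0
  · rw [if_pos hp]
    exact le_top
  · rw [if_neg hp, if_neg fun h' => hp (h.trans h'), EReal.coe_le_coe_iff]
    have := Real.log_le_log (not_le.1 hp) h
    have hn : (0 : ℝ) ≤ 1 / n := by positivity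
    nlinarith

/-! ### Optimal designs and two-sided bounds on the rates. -/

section Final

variable {S U X Y : Type*} [Fintype S] [Fintype U] [Fintype X] [Fintype Y]

/-- The smallest value of the exponent over the joint types that are compatible with a
joint type of `(S, U, X)`. -/
def typeExp (n : ℕ) (PS : S → ℝ) (W : S × X → Y → ℝ) (r : ℝ) (Q : S × U × X → ℝ) : EReal :=
  ⨅ t : {t : Fin n → (S × U × X) × Y // push Prod.fst (emp t) = Q ∧
    ∀ p, liftW U W p.1 p.2 = 0 → emp t p = 0}, (gpExp PS W r (emp t.1) : EReal)

theorem exists_extension [Nonempty U] [Nonempty X] {n : ℕ} (q : NType n S) :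
    ∃ Q : NType n (S × U × X), push Prod.fst Q.1 = q.1 := by
  obtain ⟨u⟩ := ‹Nonempty U›
  obtain ⟨x⟩ := ‹Nonempty X›
  obtain ⟨_, s, rfl⟩ := q
  exact ⟨typeOf fun i => (s i, u, x), push_emp _ _⟩

/-- For each state type there are finitely many joint types, so a maximizer exists. This design does
not refer to a target exponent, hence one sequence of designs serves all values below `Er` at once.
-/
theorem exists_optimal_design [Nonempty U] [Nonempty X] (n : ℕ) (PS : S → ℝ)
    (W : S × X → Y → ℝ) (r : ℝ) :
    ∃ d : Design n S U X, ∀ q, ∀ Q : NType n (S × U × X), push Prod.fst Q.1 = q.1 →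
      typeExp n PS W r Q.1 ≤ typeExp n PS W r (d.Q q) := by
  have key : ∀ q : NType n S, ∃ Q : {Q : NType n (S × U × X) // push Prod.fst Q.1 = q.1},
      ∀ Q' : {Q : NType n (S × U × X) // push Prod.fst Q.1 = q.1},
        typeExp n PS W r Q'.1.1 ≤ typeExp n PS W r Q.1.1 := fun q => by
    obtain ⟨Q, hQ⟩ := exists_extension (U := U) (X := X) q
    have : Nonempty {Q : NType n (S × U × X) // push Prod.fst Q.1 = q.1} := ⟨⟨Q, hQ⟩⟩
    exact Finite.exists_max _
  choose f hf using key
  exact ⟨⟨fun q => (f q).1, fun q => (f q).2⟩, fun q Q hQ => hf q ⟨Q, hQ⟩⟩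

theorem avgErrorProb_nonneg {PS : S → ℝ} (hPS : PS ∈ stdSimplex ℝ S) {W : S × X → Y → ℝ}
    (hW : W ∈ channels (S × X) Y) (R ε : ℝ) {n : ℕ} (d : Design n S U X) (G : Metric n S U Y)
    (τ : TieRule n R Y) : 0 ≤ avgErrorProb PS W R ε d G τ := by
  rw [avgErrorProb_eq]
  exact Finset.sum_nonneg fun s _ => mul_nonneg (Finset.prod_nonneg fun i _ => hPS.1 _)
    (expect_nonneg fun C => div_nonneg (Finset.sum_nonneg fun m _ => errS_nonneg hW d G τ C m s)
      (Nat.cast_nonneg _))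

/-- No design, metric and tie-breaking rule beats the exponent function. -/
theorem eventually_exp_le_avgErrorProb [Nonempty U] [Nonempty X] {PS : S → ℝ}
    (hPS : PS ∈ stdSimplex ℝ S)
    {W : S × X → Y → ℝ} (hW : W ∈ channels (S × X) Y) {R ε b : ℝ} (hR : 0 < R) (hε : 0 < ε)
    (hb : Er U PS W (R + ε) < (b : EReal)) :
    ∃ k : ℕ, ∀ᶠ n : ℕ in atTop, ∀ (d : Design n S U X) (G : Metric n S U Y) (τ : TieRule n R Y),
      Real.exp (-(n * b)) ≤ 256 * poly n k * avgErrorProb PS W R ε d G τ := by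
  refine ⟨Fintype.card S + (Fintype.card (S × U) +
    (Fintype.card ((S × U × X) × Y) + Fintype.card (U × Y))), ?_⟩
  filter_upwards [eventually_exists_of_Er_lt hb, eventually_gt_atTop 0] with n hn hn0 d G τ
  obtain ⟨s, hs, h⟩ := hn
  obtain ⟨a, ha⟩ := d.exists_emp_eq (typeOf s)
  obtain ⟨t, hta, htW, htb⟩ := h a (by rw [ha]; exact d.marginal (typeOf s))
  refine le_trans ?_ (exp_neg_gpExp_le hn0.ne' hPS hW hR hε d G τ hs (hta.trans ha) htW)
  gcongr

/-- The universal decoder with an optimal design. -/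
theorem eventually_avgErrorProb_le {PS : S → ℝ} (hPS : PS ∈ stdSimplex ℝ S)
    {W : S × X → Y → ℝ} (hW : W ∈ channels (S × X) Y) {R ε a : ℝ} (hR : 0 < R) (hε : 0 < ε)
    (ha : (a : EReal) < Er U PS W (R + ε)) (d : (n : ℕ) → Design n S U X)
    (hd : ∀ n q, ∀ Q : NType n (S × U × X), push Prod.fst Q.1 = q.1 →
      typeExp n PS W (R + ε) Q.1 ≤ typeExp n PS W (R + ε) ((d n).Q q)) :
    ∃ k : ℕ, ∀ᶠ n : ℕ in atTop, ∀ τ : TieRule n R Y,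
      avgErrorProb PS W R ε (d n) (mmiMetric (d n) ε) τ ≤ 5 * poly n k * Real.exp (-(n * a)) := by
  refine ⟨Fintype.card S + (unionDegree S U Y +
        (Fintype.card ((S × U × X) × Y) + Fintype.card (S × U × X))), ?_⟩
  filter_upwards [eventually_exists_of_lt_Er hW ha, eventually_gt_atTop 0,
    eventually_exp_neg_exp_le hε (Fintype.card (S × U)) a] with n hn hn0 hexp τ
  refine (avgErrorProb_mmi_le (a₀ := a) hn0.ne' hPS hW hR hε (d n) τ fun s hs t ht htW => ?_).trans
    ?_
  · obtain ⟨c, hc, h⟩ := hn s hs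
    have h1 : (a : EReal) ≤ typeExp n PS W (R + ε) (emp c) :=
      le_iInf fun t => EReal.coe_le_coe_iff.2 (h t.1 t.2.1 t.2.2).le
    have h2 := (h1.trans (hd n (typeOf s) (typeOf c) hc)).trans (iInf_le _ ⟨t, ht, htW⟩)
    exact_mod_cast h2
  · have h1 := one_le_poly n (Fintype.card S + (unionDegree S U Y +
        (Fintype.card ((S × U × X) × Y) + Fintype.card (S × U × X))))
    have h2 := Real.exp_pos (-(n * a))
    nlinarith

/-- The minorant `p n` is common to all designs, metrics and tie rules, so it also bounds the
infimum `optErrorProb`. -/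
theorem eventually_rate_lt [Nonempty U] [Nonempty X] {PS : S → ℝ} (hPS : PS ∈ stdSimplex ℝ S)
    {W : S × X → Y → ℝ} (hW : W ∈ channels (S × X) Y) {R ε : ℝ} (hR : 0 < R) (hε : 0 < ε)
    {b : EReal} (hb : Er U PS W (R + ε) < b) :
    ∃ p : ℕ → ℝ, (∀ᶠ n : ℕ in atTop, rate n (p n) < b) ∧
      ∀ᶠ n : ℕ in atTop, ∀ (d : Design n S U X) (G : Metric n S U Y) (τ : TieRule n R Y),
        p n ≤ avgErrorProb PS W R ε d G τ := by
  obtain ⟨b₁, hb₁, hb₁'⟩ := EReal.lt_iff_exists_real_btwn.1 hb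
  obtain ⟨b₂, hb₂, hb₂'⟩ := EReal.lt_iff_exists_real_btwn.1 hb₁'
  obtain ⟨k, hk⟩ := eventually_exp_le_avgErrorProb hPS hW hR hε hb₁
  refine ⟨fun n => Real.exp (-(n * b₁)) / (256 * poly n k), ?_, ?_⟩
  · have h := (tendsto_log_poly_div k (c := 256) (by norm_num)).eventually
      (gt_mem_nhds (sub_pos.2 (EReal.coe_lt_coe_iff.1 hb₂)))
    filter_upwards [h, eventually_gt_atTop 0] with n hn hn0
    have hP : 0 < 256 * poly n k := mul_pos (by norm_num) (poly_pos _ _)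
    refine ((rate_le_of_le hn0.ne' hP (b := b₁) (by rw [mul_div_cancel₀ _ hP.ne'])).trans ?_).trans_lt
      hb₂'
    rw [EReal.coe_le_coe_iff]
    linarith
  · filter_upwards [hk] with n hn d G τ
    rw [div_le_iff₀' (mul_pos (by norm_num) (poly_pos _ _))]
    exact hn d G τ

theorem eventually_lt_rate {PS : S → ℝ} (hPS : PS ∈ stdSimplex ℝ S)
    {W : S × X → Y → ℝ} (hW : W ∈ channels (S × X) Y) {R ε : ℝ} (hR : 0 < R) (hε : 0 < ε)
    {a : EReal} (ha : a < Er U PS W (R + ε)) (d : (n : ℕ) → Design n S U X)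
    (hd : ∀ n q, ∀ Q : NType n (S × U × X), push Prod.fst Q.1 = q.1 →
      typeExp n PS W (R + ε) Q.1 ≤ typeExp n PS W (R + ε) ((d n).Q q)) :
    ∀ᶠ n : ℕ in atTop, ∀ τ : TieRule n R Y,
      a < rate n (avgErrorProb PS W R ε (d n) (mmiMetric (d n) ε) τ) := by
  obtain ⟨a₁, ha₁, ha₁'⟩ := EReal.lt_iff_exists_real_btwn.1 ha
  obtain ⟨a₂, ha₂, ha₂'⟩ := EReal.lt_iff_exists_real_btwn.1 ha₁'
  obtain ⟨k, hk⟩ := eventually_avgErrorProb_le hPS hW hR hε ha₂' d hd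
  have h := (tendsto_log_poly_div k (c := 5) (by norm_num)).eventually
    (gt_mem_nhds (sub_pos.2 (EReal.coe_lt_coe_iff.1 ha₂)))
  filter_upwards [hk, h, eventually_gt_atTop 0] with n hn hlog hn0 τ
  refine ha₁.trans_le (le_trans ?_ (le_rate_of_le hn0.ne'
    (mul_pos (by norm_num) (poly_pos n k)) (hn τ)))
  rw [EReal.coe_le_coe_iff]
  linarith

end Final

end GelfandPinsker

end

theorem theorem2 {S U X Y : Type*} [Fintype S] [Fintype U] [Fintype X] [Fintype Y]
    [Nonempty U] [Nonempty X]
    (PS : S → ℝ) (hPS : PS ∈ stdSimplex ℝ S)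
    (W : S × X → Y → ℝ) (hW : W ∈ GelfandPinsker.channels (S × X) Y)
    (R : ℝ) (hR : 0 < R) :
    ∃ L : ℝ → EReal, Tendsto L (𝓝[>] 0) (𝓝 (GelfandPinsker.Er U PS W R)) ∧
      ∀ ε : ℝ, 0 < ε →
        -- the exponent of the optimized ensemble
        (∀ τ : (n : ℕ) → GelfandPinsker.TieRule n R Y,
          Tendsto (fun n => GelfandPinsker.rate n
            (GelfandPinsker.optErrorProb U PS W R ε n (τ n))) atTop (𝓝 (L ε))) ∧
        -- no choice of conditional types and of a decoding metric is better
        (∀ (d : (n : ℕ) → GelfandPinsker.Design n S U X)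
            (G : (n : ℕ) → GelfandPinsker.Metric n S U Y)
            (τ : (n : ℕ) → GelfandPinsker.TieRule n R Y),
          limsup (fun n => GelfandPinsker.rate n
            (GelfandPinsker.avgErrorProb PS W R ε (d n) (G n) (τ n))) atTop ≤ L ε) ∧
        -- the universal decoder achieves the exponent
        (∃ d : (n : ℕ) → GelfandPinsker.Design n S U X,
          ∀ τ : (n : ℕ) → GelfandPinsker.TieRule n R Y,
            Tendsto (fun n => GelfandPinsker.rate n
              (GelfandPinsker.avgErrorProb PS W R ε (d n)
                (GelfandPinsker.mmiMetric (d n) ε) (τ n))) atTop (𝓝 (L ε))) := by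
  -- The excess ε of the bin rate enters the exponent only as a shift of `R`.
  refine ⟨fun ε => GelfandPinsker.Er U PS W (R + ε), GelfandPinsker.tendsto_Er PS W R, fun ε hε => ?_⟩
  choose d hd using fun n => GelfandPinsker.exists_optimal_design (U := U) n PS W (R + ε)
  have hopt : ∀ n τ, GelfandPinsker.optErrorProb U PS W R ε n τ ≤
      GelfandPinsker.avgErrorProb PS W R ε (d n) (GelfandPinsker.mmiMetric (d n) ε) τ :=
    -- A real infimum needs a lower bound to be meaningful; error probabilities are nonnegative.
    fun n τ => ciInf_le ⟨0, by
      rintro _ ⟨p, rfl⟩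
      exact GelfandPinsker.avgErrorProb_nonneg hPS hW R ε p.1 p.2 τ⟩
      (d n, GelfandPinsker.mmiMetric (d n) ε)
  refine ⟨fun τ => tendsto_order.2 ⟨fun a ha => ?_, fun b hb => ?_⟩, fun d' G τ => ?_,
    d, fun τ => tendsto_order.2 ⟨fun a ha => ?_, fun b hb => ?_⟩⟩
  · filter_upwards [GelfandPinsker.eventually_lt_rate hPS hW hR hε ha d hd] with n hn
    exact (hn (τ n)).trans_le (GelfandPinsker.rate_antitone n (hopt n (τ n)))
  · obtain ⟨p, hp, hle⟩ := GelfandPinsker.eventually_rate_lt hPS hW hR hε hb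
    filter_upwards [hp, hle] with n hpn hn
    have : Nonempty (GelfandPinsker.Design n S U X × GelfandPinsker.Metric n S U Y) :=
      ⟨(d n, GelfandPinsker.mmiMetric (d n) ε)⟩
    have hpo : p n ≤ GelfandPinsker.optErrorProb U PS W R ε n (τ n) :=
      le_ciInf fun q => hn q.1 q.2 (τ n)
    exact (GelfandPinsker.rate_antitone n hpo).trans_lt hpn
  · refine le_of_forall_gt_imp_ge_of_dense fun b hb => ?_
    obtain ⟨p, hp, hle⟩ := GelfandPinsker.eventually_rate_lt hPS hW hR hε hb
    refine limsup_le_of_le (h := ?_)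
    filter_upwards [hp, hle] with n hpn hn
    exact (GelfandPinsker.rate_antitone n (hn (d' n) (G n) (τ n))).trans hpn.le
  · filter_upwards [GelfandPinsker.eventually_lt_rate hPS hW hR hε ha d hd] with n hn
    exact hn (τ n)
  · obtain ⟨p, hp, hle⟩ := GelfandPinsker.eventually_rate_lt hPS hW hR hε hb
    filter_upwards [hp, hle] with n hpn hn
    exact (GelfandPinsker.rate_antitone n (hn (d n) _ (τ n))).trans_lt hpn
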